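/- Let $k$ be an algebraically closed field of arbitrary characteristic. Toric varieties over $k$ are the varieties $X_\Sigma$ associated with fans $\Sigma$ (finite sets of strongly convex rational polyhedral cones, closed under taking faces, any two of which meet in a common face) in $N\otimes\mathbb{R}$, where $N\cong\mathbb{Z}^n$ is a lattice. Let $X=Z''_{13}(2,7,4,2)$ be the toric variety of the fan in $\mathbb{R}^3$ (with lattice $\mathbb{Z}^3$) whose rays are generated by $$v_1=(1,1,7),\ v_2=(1,0,0),\ v_3=(0,-1,0),\ v_4=(0,0,-1),\ v_5=(-1,2,2),\ v_6=(0,1,0),\ v_7=(0,0,1),\ v_8=(-1,4,3),$$ and whose three-dimensional cones are $$\langle v_1,v_2,v_4\rangle,\ \langle v_2,v_3,v_4\rangle,\ \langle v_3,v_4,v_5\rangle,\ \langle v_4,v_5,v_6\rangle,\ \langle v_1,v_4,v_6\rangle,\ \langle v_1,v_6,v_7\rangle,$$ $$\langle v_1,v_2,v_7\rangle,\ \langle v_2,v_3,v_7\rangle,\ \langle v_3,v_5,v_8\rangle,\ \langle v_5,v_6,v_8\rangle,\ \langle v_3,v_7,v_8\rangle,\ \langle v_6,v_7,v_8\rangle.$$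 Then $X$ is a smooth complete toric threefold of Picard number (rank of the Picard group) five, and $X$ is not projective. Moreover, let $X\dashrightarrow X'$ be a toric birational map to a toric variety $X'$ (a birational map over $k$ that restricts to an isomorphism of algebraic groups between the big tori) which is an isomorphism in codimension one, that is, it restricts to an isomorphism between open subsets of $X$ and $X'$ whose complements have codimension at least two. If $X'$ is projective, then $X'$ is singular. In particular, there is a smooth complete toric threefold that is not isomorphic in codimension one, through a toric birational map, to any smooth projective toric variety. -/

import Mathlib

open CategoryTheory CategoryTheory.Limits AlgebraicGeometry

universe u

noncomputable section

namespace Toric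

/-! ### Rational polyhedral cones and fans

The lattice is `N = ℤⁿ`, with `N_ℝ = ℝⁿ`; the dual lattice `M = Hom(N, ℤ)` is identified with `ℤⁿ`
through the standard pairing. -/

/-- The pairing `⟨m, v⟩` of `m ∈ M` with `v ∈ N_ℝ`. -/
def pairing {n : ℕ} (m : Fin n → ℤ) (v : Fin n → ℝ) : ℝ := ∑ i, (m i : ℝ) * v i

lemma pairing_add_left {n : ℕ} (m m' : Fin n → ℤ) (v : Fin n → ℝ) :
    pairing (m + m') v = pairing m v + pairing m' v := by
  simp [pairing, add_mul, Finset.sum_add_distrib]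

lemma pairing_neg_left {n : ℕ} (m : Fin n → ℤ) (v : Fin n → ℝ) :
    pairing (-m) v = - pairing m v := by
  simp [pairing]

lemma pairing_zero_left {n : ℕ} (v : Fin n → ℝ) : pairing (0 : Fin n → ℤ) v = 0 := by
  simp [pairing]

lemma pairing_add_right {n : ℕ} (m : Fin n → ℤ) (v w : Fin n → ℝ) :
    pairing m (v + w) = pairing m v + pairing m w := by
  simp [pairing, mul_add, Finset.sum_add_distrib]

lemma pairing_smul_right {n : ℕ} (m : Fin n → ℤ) (c : ℝ) (v : Fin n → ℝ) :
    pairing m (c • v) = c * pairing m v := by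
  simp only [pairing, Finset.mul_sum, Pi.smul_apply, smul_eq_mul]
  exact Finset.sum_congr rfl fun i _ => by ring

lemma pairing_zero_right {n : ℕ} (m : Fin n → ℤ) : pairing m (0 : Fin n → ℝ) = 0 := by
  simp [pairing]

lemma pairing_sum_right {n : ℕ} {ι : Type*} (s : Finset ι) (m : Fin n → ℤ) (w : ι → Fin n → ℝ) :
    pairing m (∑ i ∈ s, w i) = ∑ i ∈ s, pairing m (w i) := by
  classical
  induction s using Finset.induction_on with
  | empty => simp [pairing_zero_right]
  | insert a s ha ih => rw [Finset.sum_insert ha, Finset.sum_insert ha, pairing_add_right, ih]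

/-- The cone in `N_ℝ` spanned by a set of lattice points. -/
def coneOf {n : ℕ} (S : Set (Fin n → ℤ)) : PointedCone ℝ (Fin n → ℝ) :=
  PointedCone.hull ℝ ((fun v i => (v i : ℝ)) '' S)

/-- `τ` is a face of `σ`: `τ = σ ∩ m^⊥` for some `m ∈ M` that is nonnegative on `σ`. -/
def IsFace {n : ℕ} (τ σ : PointedCone ℝ (Fin n → ℝ)) : Prop :=
  ∃ m : Fin n → ℤ, (∀ v ∈ σ, 0 ≤ pairing m v) ∧ ∀ v, v ∈ τ ↔ v ∈ σ ∧ pairing m v = 0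

/-- A fan in `N_ℝ = ℝⁿ`: a finite set of strongly convex rational polyhedral cones, closed under
taking faces, in which any two cones meet in a common face. The zero cone belongs to every
nonempty fan, so listing it as a member just says that the fan is not empty. -/
structure Fan (n : ℕ) where
  cones : Set (PointedCone ℝ (Fin n → ℝ))
  finite : cones.Finite
  bot_mem : ⊥ ∈ cones
  rational : ∀ σ ∈ cones, ∃ S : Set (Fin n → ℤ), S.Finite ∧ σ = coneOf S
  stronglyConvex : ∀ σ ∈ cones, ∀ v ∈ σ, -v ∈ σ → v = 0
  face_mem : ∀ σ ∈ cones, ∀ τ, IsFace τ σ → τ ∈ cones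
  inter_face : ∀ σ ∈ cones, ∀ τ ∈ cones, IsFace (σ ⊓ τ) σ ∧ IsFace (σ ⊓ τ) τ

/-- The semigroup `S_σ = σ^∨ ∩ M`. -/
def dualMonoid {n : ℕ} (σ : PointedCone ℝ (Fin n → ℝ)) : AddSubmonoid (Fin n → ℤ) where
  carrier := {m | ∀ v ∈ σ, 0 ≤ pairing m v}
  zero_mem' := fun v _ => (pairing_zero_left v).ge
  add_mem' := fun {a b} ha hb v hv => by
    rw [pairing_add_left]; exact add_nonneg (ha v hv) (hb v hv)

lemma mem_dualMonoid {n : ℕ} {σ : PointedCone ℝ (Fin n → ℝ)} {m : Fin n → ℤ} :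
    m ∈ dualMonoid σ ↔ ∀ v ∈ σ, 0 ≤ pairing m v := Iff.rfl

lemma dualMonoid_anti {n : ℕ} {σ τ : PointedCone ℝ (Fin n → ℝ)} (h : τ ≤ σ) :
    dualMonoid σ ≤ dualMonoid τ := fun _ hm v hv => hm v (h hv)

/-! ### The toric variety of a fan -/

/-- The coordinate ring `k[S_σ]` of the affine toric variety `U_σ`. -/
abbrev coneRing (k : Type u) [Field k] {n : ℕ} (σ : PointedCone ℝ (Fin n → ℝ)) : Type u :=
  AddMonoidAlgebra k (dualMonoid σ)

/-- The inclusion `k[S_σ] → k[S_τ]` for `τ ⊆ σ`. -/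
def coneRingMap (k : Type u) [Field k] {n : ℕ} {σ τ : PointedCone ℝ (Fin n → ℝ)} (h : τ ≤ σ) :
    coneRing k σ →+* coneRing k τ :=
  AddMonoidAlgebra.mapDomainRingHom k (AddSubmonoid.inclusion (dualMonoid_anti h))

lemma coneRingMap_refl (k : Type u) [Field k] {n : ℕ} (σ : PointedCone ℝ (Fin n → ℝ)) :
    coneRingMap k (le_refl σ) = RingHom.id _ :=
  AddMonoidAlgebra.mapDomainRingHom_id (R := k) (M := dualMonoid σ)

lemma coneRingMap_comp (k : Type u) [Field k] {n : ℕ} {ρ σ τ : PointedCone ℝ (Fin n → ℝ)}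
    (h : σ ≤ ρ) (h' : τ ≤ σ) :
    (coneRingMap k h').comp (coneRingMap k h) = coneRingMap k (h'.trans h) :=
  (AddMonoidAlgebra.mapDomainRingHom_comp (R := k) _ _).symm

lemma coneRingMap_single (k : Type u) [Field k] {n : ℕ} {σ τ : PointedCone ℝ (Fin n → ℝ)}
    (h : τ ≤ σ) (m : dualMonoid σ) (r : k) :
    coneRingMap k h (AddMonoidAlgebra.single m r) =
      AddMonoidAlgebra.single (AddSubmonoid.inclusion (dualMonoid_anti h) m) r :=
  AddMonoidAlgebra.mapDomain_single

lemma coneRingMap_injective (k : Type u) [Field k] {n : ℕ} {σ τ : PointedCone ℝ (Fin n → ℝ)}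
    (h : τ ≤ σ) : Function.Injective (coneRingMap k h) :=
  AddMonoidAlgebra.mapDomain_injective (AddSubmonoid.inclusion_injective _)

lemma coneRingMap_algebraMap (k : Type u) [Field k] {n : ℕ} {σ τ : PointedCone ℝ (Fin n → ℝ)}
    (h : τ ≤ σ) : (coneRingMap k h).comp (algebraMap k (coneRing k σ)) =
      algebraMap k (coneRing k τ) := by
  ext r
  simp [coneRingMap_single]

/-- The diagram of the affine toric varieties `U_σ = Spec k[S_σ]`, `σ ∈ Σ`, and of the inclusions
`U_τ → U_σ`, `τ ⊆ σ`. In a fan `τ ⊆ σ` holds exactly if `τ` is a face of `σ`. -/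
def Fan.diagram (k : Type u) [Field k] {n : ℕ} (F : Fan n) : F.cones ⥤ Scheme.{u} where
  obj σ := Spec (CommRingCat.of (coneRing k σ.1))
  map f := Spec.map (CommRingCat.ofHom (coneRingMap k (leOfHom f)))
  map_id σ := by rw [coneRingMap_refl]; exact Spec.map_id _
  map_comp f g := by
    rw [← Spec.map_comp, ← CommRingCat.ofHom_comp, coneRingMap_comp]

lemma pairing_coneOf_nonneg {n : ℕ} {S : Set (Fin n → ℤ)} {m : Fin n → ℤ}
    (h : ∀ s ∈ S, 0 ≤ pairing m (fun i => (s i : ℝ))) {v : Fin n → ℝ} (hv : v ∈ coneOf S) :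
    0 ≤ pairing m v := by
  induction hv using Submodule.span_induction with
  | mem x hx => obtain ⟨s, hs, rfl⟩ := hx; exact h s hs
  | zero => exact (pairing_zero_right m).ge
  | add x y _ _ hx hy => rw [pairing_add_right]; exact add_nonneg hx hy
  | smul c x _ hx =>
    have : pairing m (c • x) = (c : ℝ) * pairing m x := pairing_smul_right m (c : ℝ) x
    rw [this]; exact mul_nonneg c.2 hx

lemma mem_coneOf {n : ℕ} {S : Set (Fin n → ℤ)} {s : Fin n → ℤ} (hs : s ∈ S) :
    (fun i => (s i : ℝ)) ∈ coneOf S := Submodule.subset_span ⟨s, hs, rfl⟩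

lemma pairing_intCast {n : ℕ} (m s : Fin n → ℤ) :
    pairing m (fun i => (s i : ℝ)) = ((∑ i, m i * s i : ℤ) : ℝ) := by
  simp [pairing]

lemma exists_nat_dual {n : ℕ} {σ τ : PointedCone ℝ (Fin n → ℝ)} {S : Set (Fin n → ℤ)}
    (hS : S.Finite) (hσ : σ = coneOf S) {m : Fin n → ℤ} (hm : m ∈ dualMonoid σ)
    (hτ : ∀ v, v ∈ τ ↔ v ∈ σ ∧ pairing m v = 0) {a : Fin n → ℤ} (ha : a ∈ dualMonoid τ) :
    ∃ N : ℕ, a + N • m ∈ dualMonoid σ := by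
  subst hσ
  obtain ⟨N, hN⟩ : ∃ N : ℕ, ∀ s ∈ S, -pairing a (fun i => (s i : ℝ)) ≤ N := by
    obtain ⟨B, hB⟩ := (hS.image fun s => -pairing a (fun i => (s i : ℝ))).bddAbove
    obtain ⟨N, hN⟩ := exists_nat_ge B
    exact ⟨N, fun s hs => (hB ⟨s, hs, rfl⟩).trans hN⟩
  refine ⟨N, fun v hv => pairing_coneOf_nonneg (fun s hs => ?_) hv⟩
  have hNm : pairing (N • m) (fun i => (s i : ℝ)) = N * pairing m (fun i => (s i : ℝ)) := by
    simp [pairing, Finset.mul_sum, mul_assoc]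
  rw [pairing_add_left, hNm]
  have h0 := hm _ (mem_coneOf hs)
  rcases h0.eq_or_lt with h | h
  · rw [← h, mul_zero, add_zero]
    exact ha _ ((hτ _).2 ⟨mem_coneOf hs, h.symm⟩)
  · have h1 : 1 ≤ pairing m (fun i => (s i : ℝ)) := by
      rw [pairing_intCast] at h ⊢
      have h' : 0 < ∑ i, m i * s i := by exact_mod_cast h
      exact_mod_cast h'
    have := hN s hs
    nlinarith [(Nat.cast_nonneg N : (0 : ℝ) ≤ N)]

/-- If `τ = σ ∩ m^⊥` is a face of `σ` then `k[S_τ]` is the localization of `k[S_σ]` at `χ^m`. -/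
lemma isLocalization_coneRing (k : Type u) [Field k] {n : ℕ} {σ τ : PointedCone ℝ (Fin n → ℝ)}
    {S : Set (Fin n → ℤ)} (hS : S.Finite) (hσ : σ = coneOf S) {m : Fin n → ℤ}
    (hm : m ∈ dualMonoid σ) (hτ : ∀ v, v ∈ τ ↔ v ∈ σ ∧ pairing m v = 0) (h : τ ≤ σ) :
    letI := (coneRingMap k h).toAlgebra
    IsLocalization.Away (AddMonoidAlgebra.single (⟨m, hm⟩ : dualMonoid σ) (1 : k))
      (coneRing k τ) := by
  let := (coneRingMap k h).toAlgebra
  have halg : ∀ x, algebraMap (coneRing k σ) (coneRing k τ) x = coneRingMap k h x := fun _ => rfl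
  have hneg : -m ∈ dualMonoid τ := fun v hv => by
    rw [pairing_neg_left, ((hτ v).1 hv).2, neg_zero]
  have hpow : ∀ N : ℕ, coneRingMap k h
      (AddMonoidAlgebra.single (⟨m, hm⟩ : dualMonoid σ) (1 : k) ^ N) =
      AddMonoidAlgebra.single (N • (⟨m, dualMonoid_anti h hm⟩ : dualMonoid τ)) (1 : k) := by
    intro N
    rw [map_pow, coneRingMap_single, AddMonoidAlgebra.single_pow, one_pow]
    rfl
  have key : ∀ f : coneRing k τ, ∃ (N : ℕ) (g : coneRing k σ),
      f * AddMonoidAlgebra.single (N • (⟨m, dualMonoid_anti h hm⟩ : dualMonoid τ)) (1 : k) =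
        coneRingMap k h g := by
    intro f
    induction f using AddMonoidAlgebra.induction_linear with
    | zero => exact ⟨0, 0, by simp⟩
    | add f g hf hg =>
      obtain ⟨N, f', hf⟩ := hf
      obtain ⟨N', g', hg⟩ := hg
      refine ⟨N + N', f' * AddMonoidAlgebra.single (⟨m, hm⟩ : dualMonoid σ) (1 : k) ^ N' +
        g' * AddMonoidAlgebra.single (⟨m, hm⟩ : dualMonoid σ) (1 : k) ^ N, ?_⟩
      rw [map_add, map_mul, map_mul, ← hf, ← hg, hpow, hpow, mul_assoc, mul_assoc,
        AddMonoidAlgebra.single_mul_single, AddMonoidAlgebra.single_mul_single, mul_one,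
        ← add_nsmul, ← add_nsmul, add_comm N' N, add_mul]
    | single a r =>
      obtain ⟨N, hN⟩ := exists_nat_dual hS hσ hm hτ a.2
      refine ⟨N, AddMonoidAlgebra.single ⟨_, hN⟩ r, ?_⟩
      rw [coneRingMap_single, AddMonoidAlgebra.single_mul_single, mul_one]
      congr 1
  constructor
  refine ⟨?_, ?_, ?_⟩
  · rintro ⟨_, N, rfl⟩
    simp only [halg, map_pow]
    refine IsUnit.pow N (IsUnit.of_mul_eq_one (AddMonoidAlgebra.single ⟨-m, hneg⟩ (1 : k)) ?_)
    rw [coneRingMap_single, AddMonoidAlgebra.single_mul_single, mul_one,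
      AddMonoidAlgebra.one_def]
    congr 1
    ext i
    simp
  · intro f
    obtain ⟨N, g, hg⟩ := key f
    exact ⟨⟨g, ⟨_, N, rfl⟩⟩, by rw [halg, halg, hpow, hg]⟩
  · intro x y hxy
    exact ⟨1, by rw [coneRingMap_injective k h hxy]⟩

lemma Fan.exists_away (k : Type u) [Field k] {n : ℕ} (F : Fan n) {σ τ : F.cones} (f : σ ⟶ τ) :
    ∃ m : Fin n → ℤ, m ∈ dualMonoid τ.1 ∧ ∀ v, v ∈ σ.1 ↔ v ∈ τ.1 ∧ pairing m v = 0 := by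
  obtain ⟨m, hm, h⟩ := (F.inter_face τ.1 τ.2 σ.1 σ.2).1
  rw [inf_eq_right.2 (leOfHom f)] at h
  exact ⟨m, hm, h⟩

instance (k : Type u) [Field k] {n : ℕ} (F : Fan n) {σ τ : F.cones} (f : σ ⟶ τ) :
    IsOpenImmersion ((F.diagram k).map f) := by
  obtain ⟨m, hm, h⟩ := F.exists_away k f
  obtain ⟨S, hS, hτ⟩ := F.rational τ.1 τ.2
  let := (coneRingMap k (leOfHom f)).toAlgebra
  have := isLocalization_coneRing k hS hτ hm h (leOfHom f)
  exact IsOpenImmersion.of_isLocalization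
    (AddMonoidAlgebra.single (⟨m, hm⟩ : dualMonoid τ.1) (1 : k))

lemma Fan.range_diagram_map (k : Type u) [Field k] {n : ℕ} (F : Fan n) {σ τ : F.cones}
    (f : σ ⟶ τ) {m : Fin n → ℤ} (hm : m ∈ dualMonoid τ.1)
    (h : ∀ v, v ∈ σ.1 ↔ v ∈ τ.1 ∧ pairing m v = 0)
    (x : Spec (CommRingCat.of (coneRing k τ.1))) :
    x ∈ Set.range ((F.diagram k).map f) ↔
      AddMonoidAlgebra.single (⟨m, hm⟩ : dualMonoid τ.1) (1 : k) ∉ x.asIdeal := by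
  obtain ⟨S, hS, hτ⟩ := F.rational τ.1 τ.2
  let := (coneRingMap k (leOfHom f)).toAlgebra
  have := isLocalization_coneRing k hS hτ hm h (leOfHom f)
  have := PrimeSpectrum.localization_away_comap_range (coneRing k σ.1)
    (AddMonoidAlgebra.single (⟨m, hm⟩ : dualMonoid τ.1) (1 : k))
  exact Set.ext_iff.1 this x

instance (k : Type u) [Field k] {n : ℕ} (F : Fan n) :
    (F.diagram k ⋙ Scheme.forget).IsLocallyDirected := by
  constructor
  intro i j l fi fj xi xj hij
  replace hij : (F.diagram k).map fi xi = (F.diagram k).map fj xj := hij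
  obtain ⟨m, hm, h⟩ := F.exists_away k fi
  obtain ⟨m', hm', h'⟩ := F.exists_away k fj
  have hmem : i.1 ⊓ j.1 ∈ F.cones := F.face_mem _ i.2 _ (F.inter_face _ i.2 _ j.2).1
  let t : F.cones := ⟨i.1 ⊓ j.1, hmem⟩
  let ti : t ⟶ i := homOfLE (inf_le_left : i.1 ⊓ j.1 ≤ i.1)
  let tj : t ⟶ j := homOfLE (inf_le_right : i.1 ⊓ j.1 ≤ j.1)
  have hsum : ∀ v, v ∈ t.1 ↔ v ∈ l.1 ∧ pairing (m + m') v = 0 := by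
    intro v
    rw [pairing_add_left]
    constructor
    · rintro ⟨hi, hj⟩
      rw [((h v).1 hi).2, ((h' v).1 hj).2]
      exact ⟨((h v).1 hi).1, add_zero 0⟩
    · rintro ⟨hl, h0⟩
      have h1 := hm v hl
      have h2 := hm' v hl
      exact ⟨(h v).2 ⟨hl, by linarith⟩, (h' v).2 ⟨hl, by linarith⟩⟩
  have hx : (F.diagram k).map fi xi ∈ Set.range ((F.diagram k).map (ti ≫ fi)) := by
    refine (F.range_diagram_map k (ti ≫ fi) (add_mem hm hm') hsum _).2 ?_
    have h1 := (F.range_diagram_map k fi hm h _).1 ⟨xi, rfl⟩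
    have h2 := (F.range_diagram_map k fj hm' h' _).1 ⟨xj, hij.symm⟩
    have hmul : AddMonoidAlgebra.single (⟨m + m', add_mem hm hm'⟩ : dualMonoid l.1) (1 : k) =
        AddMonoidAlgebra.single (⟨m, hm⟩ : dualMonoid l.1) (1 : k) *
        AddMonoidAlgebra.single (⟨m', hm'⟩ : dualMonoid l.1) (1 : k) := by
      rw [AddMonoidAlgebra.single_mul_single, mul_one]; rfl
    rw [hmul]
    intro hc
    exact (Ideal.IsPrime.mem_or_mem (PrimeSpectrum.isPrime _) hc).elim h1 h2
  obtain ⟨x, hx⟩ := hx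
  have e1 : (F.diagram k).map ti x = xi := by
    apply ((F.diagram k).map fi).isOpenEmbedding.injective
    rw [← hx, Functor.map_comp]
    rfl
  have e2 : (F.diagram k).map tj x = xj := by
    apply ((F.diagram k).map fj).isOpenEmbedding.injective
    rw [← hij, ← hx, Subsingleton.elim (ti ≫ fi) (tj ≫ fj), Functor.map_comp]
    rfl
  exact ⟨t, ti, tj, x, e1, e2⟩

/-- The toric variety `X_Σ` over `k`, glued from the affine toric varieties `U_σ`, `σ ∈ Σ`,
along the `U_τ`, `τ` a common face. -/
def Fan.variety (k : Type u) [Field k] {n : ℕ} (F : Fan n) : Scheme.{u} := colimit (F.diagram k)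

/-- The open chart `U_σ → X_Σ`. -/
def Fan.chart (k : Type u) [Field k] {n : ℕ} (F : Fan n) (σ : F.cones) :
    Spec (CommRingCat.of (coneRing k σ.1)) ⟶ F.variety k :=
  colimit.ι (F.diagram k) σ

/-- The structure morphism `X_Σ → Spec k`. -/
def Fan.toSpec (k : Type u) [Field k] {n : ℕ} (F : Fan n) :
    F.variety k ⟶ Spec (CommRingCat.of k) :=
  colimit.desc (F.diagram k)
    { pt := Spec (CommRingCat.of k)
      ι :=
        { app := fun σ => Spec.map (CommRingCat.ofHom (algebraMap k (coneRing k σ.1)))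
          naturality := by
            intro σ τ f
            refine Eq.trans ?_ (Category.comp_id _).symm
            exact (Spec.map_comp _ _).symm.trans (congrArg (fun g => Spec.map (CommRingCat.ofHom g))
              (coneRingMap_algebraMap k (leOfHom f))) } }

/-- The inclusion `T_N = Spec k[M] → X_Σ` of the big torus, through the chart of the zero cone. -/
def Fan.torusι (k : Type u) [Field k] {n : ℕ} (F : Fan n) :
    Spec (CommRingCat.of (AddMonoidAlgebra k (Fin n → ℤ))) ⟶ F.variety k :=
  Spec.map (CommRingCat.ofHom (AddMonoidAlgebra.mapDomainRingHom k
    (dualMonoid (⊥ : PointedCone ℝ (Fin n → ℝ))).subtype)) ≫ F.chart k ⟨⊥, F.bot_mem⟩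

/-! ### Geometric notions -/

attribute [local instance] MvPolynomial.gradedAlgebra

/-- Projective `r`-space over `k`, as `Proj k[x₀, …, x_r]`. -/
def projSpace (k : Type u) [Field k] (r : ℕ) : Scheme.{u} :=
  Proj (MvPolynomial.homogeneousSubmodule (Fin (r + 1)) k)

/-- The structure morphism `ℙʳ → Spec k`. -/
def projSpaceToSpec (k : Type u) [Field k] (r : ℕ) :
    projSpace k r ⟶ Spec (CommRingCat.of k) :=
  Proj.toSpecZero (MvPolynomial.homogeneousSubmodule (Fin (r + 1)) k) ≫
    Spec.map (CommRingCat.ofHom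
      (algebraMap k (MvPolynomial.homogeneousSubmodule (Fin (r + 1)) k 0)))

/-- A `k`-scheme is projective if it admits a closed immersion over `k` into some `ℙʳ`. -/
def IsProjective {k : Type u} [Field k] {X : Scheme.{u}} (p : X ⟶ Spec (CommRingCat.of k)) :
    Prop :=
  ∃ (r : ℕ) (i : X ⟶ projSpace k r), IsClosedImmersion i ∧ i ≫ projSpaceToSpec k r = p

section Cartier

variable (X : Scheme.{u}) [IsIntegral X]

/-- The subgroup `𝒪_{X,x}^×` of `K(X)^×`. -/
def stalkUnits (x : X) : Subgroup (X.functionField)ˣ :=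
  (Units.map (algebraMap (X.presheaf.stalk x) X.functionField).toMonoidHom).range

/-- The stalk `K(X)^×/𝒪_{X,x}^×` of the sheaf `K^×/𝒪_X^×`, written additively. -/
def CartierGerm (x : X) : Type u := Additive ((X.functionField)ˣ ⧸ stalkUnits X x)

instance (x : X) : AddCommGroup (CartierGerm X x) :=
  inferInstanceAs (AddCommGroup (Additive ((X.functionField)ˣ ⧸ stalkUnits X x)))

/-- The germ at `x` of the principal Cartier divisor of a rational function. -/
def germDiv (x : X) : Additive (X.functionField)ˣ →+ CartierGerm X x :=
  MonoidHom.toAdditive (QuotientGroup.mk' (stalkUnits X x))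

/-- The group of Cartier divisors on an integral scheme `X`, i.e. of global sections of the sheaf
`K^×/𝒪_X^×`: families of germs that are locally given by a single rational function. -/
def cartierDivisors : AddSubgroup (∀ x : X, CartierGerm X x) where
  carrier := {D | ∀ x : X, ∃ U : X.Opens, x ∈ U ∧ ∃ f : Additive (X.functionField)ˣ,
    ∀ y ∈ U, D y = germDiv X y f}
  zero_mem' := fun x => ⟨⊤, trivial, 0, fun y _ => (map_zero (germDiv X y)).symm⟩
  add_mem' := by
    intro D E hD hE x
    obtain ⟨U, hU, f, hf⟩ := hD x
    obtain ⟨V, hV, g, hg⟩ := hE x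
    refine ⟨U ⊓ V, ⟨hU, hV⟩, f + g, fun y hy => ?_⟩
    rw [Pi.add_apply, hf y hy.1, hg y hy.2, map_add]
  neg_mem' := by
    intro D hD x
    obtain ⟨U, hU, f, hf⟩ := hD x
    exact ⟨U, hU, -f, fun y hy => by rw [Pi.neg_apply, hf y hy, map_neg]⟩

/-- The homomorphism sending a rational function to its principal Cartier divisor. -/
def principalDivisor : Additive (X.functionField)ˣ →+ cartierDivisors X :=
  (AddMonoidHom.pi (germDiv X)).codRestrict (cartierDivisors X)
    fun f _ => ⟨⊤, trivial, f, fun _ _ => rfl⟩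

/-- The Picard group of an integral scheme, as the group of Cartier divisors modulo linear
equivalence. -/
abbrev Pic : Type u := cartierDivisors X ⧸ (principalDivisor X).range

/-- The rank of the Picard group. For a complete toric variety this is the Picard number, since
numerically trivial divisors are linearly trivial there. -/
def picardNumber : ℕ := Module.finrank ℤ (Pic X)

end Cartier

/-- A birational map `X_Σ ⇢ X_Σ'`, given by an isomorphism of dense open subschemes, is toric if it
is defined over `k` and restricts to an isomorphism `T_N ≅ T_N'` of algebraic groups of the big
tori, i.e. to `Spec ψ` for an isomorphism `ψ : k[M'] ≅ k[M]` of bialgebras. -/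
def IsToric {k : Type u} [Field k] {n n' : ℕ} {F : Fan n} {F' : Fan n'}
    (f : (F.variety k).PartialIso (F'.variety k)) : Prop :=
  f.IsOver (F.toSpec k) (F'.toSpec k) ∧
  ∃ ψ : AddMonoidAlgebra k (Fin n' → ℤ) ≃ₐc[k] AddMonoidAlgebra k (Fin n → ℤ),
    (F.torusι k ∣_ f.source) ≫ f.iso.hom ≫ f.target.ι =
      (F.torusι k ⁻¹ᵁ f.source).ι ≫
        Spec.map (CommRingCat.ofHom (ψ : AddMonoidAlgebra k (Fin n' → ℤ) →+* _)) ≫ F'.torusι k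

/-- A partial isomorphism identifies the complements of closed subsets of codimension at least two
(`Order.coheight x` is the codimension of the closure of the point `x`). -/
def IsIsoInCodimOne {X Y : Scheme.{u}} (f : X.PartialIso Y) : Prop :=
  (∀ x : X, x ∉ f.source → 2 ≤ Order.coheight x) ∧
  (∀ y : Y, y ∉ f.target → 2 ≤ Order.coheight y)

/-! ### The fan of `Z''₁₃(2, 7, 4, 2)` -/

section SimplicialFan

variable {n r : ℕ} (v : Fin r → Fin n → ℤ)

/-- The cone spanned by the vectors `v i`, `i ∈ A`. -/
def simplexCone (A : Finset (Fin r)) : PointedCone ℝ (Fin n → ℝ) := coneOf (v '' A)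

lemma mem_simplexCone {A : Finset (Fin r)} {x : Fin n → ℝ} :
    x ∈ simplexCone v A ↔ ∃ a : Fin r → ℝ, (∀ i, 0 ≤ a i) ∧ (∀ i, i ∉ A → a i = 0) ∧
      x = ∑ i, a i • (fun j => (v i j : ℝ)) := by
  classical
  constructor
  · intro hx
    unfold simplexCone coneOf at hx
    induction hx using Submodule.span_induction with
    | mem x hx =>
      obtain ⟨_, ⟨i, hi, rfl⟩, rfl⟩ := hx
      refine ⟨Pi.single i 1, fun j => ?_, fun j hj => ?_, ?_⟩
      · by_cases h : j = i
        · subst h; simp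
        · simp [h]
      · have : j ≠ i := fun h => hj (h ▸ hi)
        simp [this]
      · rw [Finset.sum_eq_single i]
        · simp
        · intro j _ hj; simp [hj]
        · simp
    | zero => exact ⟨0, fun _ => le_rfl, fun _ _ => rfl, by simp⟩
    | add x y _ _ hx hy =>
      obtain ⟨a, ha, ha', rfl⟩ := hx
      obtain ⟨b, hb, hb', rfl⟩ := hy
      refine ⟨a + b, fun i => add_nonneg (ha i) (hb i), fun i hi => ?_, ?_⟩
      · simp [ha' i hi, hb' i hi]
      · rw [← Finset.sum_add_distrib]
        exact Finset.sum_congr rfl fun i _ => (add_smul _ _ _).symm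
    | smul c x _ hx =>
      obtain ⟨a, ha, ha', rfl⟩ := hx
      refine ⟨fun i => (c : ℝ) * a i, fun i => mul_nonneg c.2 (ha i), fun i hi => ?_, ?_⟩
      · simp [ha' i hi]
      · rw [Finset.smul_sum]
        exact Finset.sum_congr rfl fun i _ => (mul_smul (c : ℝ) (a i) _).symm
  · rintro ⟨a, ha, ha', rfl⟩
    refine Submodule.sum_mem _ fun i _ => ?_
    by_cases hi : i ∈ A
    · exact Submodule.smul_mem _ (⟨a i, ha i⟩ : {c : ℝ // 0 ≤ c}) (mem_coneOf ⟨i, hi, rfl⟩)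
    · rw [ha' i hi, zero_smul]; exact Submodule.zero_mem _

/-- The integer pairing. -/
def intPairing (m w : Fin n → ℤ) : ℤ := ∑ j, m j * w j

lemma pairing_comb (m : Fin n → ℤ) (a : Fin r → ℝ) :
    pairing m (∑ i, a i • (fun j => (v i j : ℝ))) = ∑ i, a i * (intPairing m (v i) : ℝ) := by
  rw [pairing_sum_right]
  refine Finset.sum_congr rfl fun i _ => ?_
  rw [pairing_smul_right, pairing_intCast]
  rfl

/-- Every `B ∈ K` indexes part of a basis of the lattice: there are dual vectors. -/
def HasDualVectors (K : Finset (Finset (Fin r))) : Prop :=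
  ∀ B ∈ K, ∀ i ∈ B, ∃ m : Fin n → ℤ, intPairing m (v i) = 1 ∧
    ∀ j ∈ B, j ≠ i → intPairing m (v j) = 0

/-- Any two `B, C ∈ K` are separated by a hyperplane that meets both cones in the span of
`B ∩ C`. -/
def HasSeparators (K : Finset (Finset (Fin r))) : Prop :=
  ∀ B ∈ K, ∀ C ∈ K, ∃ m : Fin n → ℤ, (∀ i ∈ B, i ∉ C → 0 < intPairing m (v i)) ∧
    (∀ i ∈ C, i ∉ B → intPairing m (v i) < 0) ∧ (∀ i ∈ B, i ∈ C → intPairing m (v i) = 0)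

variable {v}

lemma coeff_eq_zero_of_pairing {m : Fin n → ℤ} {a : Fin r → ℝ} {A : Finset (Fin r)}
    (ha : ∀ i, 0 ≤ a i) (ha' : ∀ i, i ∉ A → a i = 0) (hm : ∀ i ∈ A, 0 ≤ intPairing m (v i))
    (h0 : pairing m (∑ i, a i • (fun j => (v i j : ℝ))) = 0) :
    ∀ i, 0 < intPairing m (v i) → a i = 0 := by
  rw [pairing_comb, Finset.sum_eq_zero_iff_of_nonneg] at h0
  · intro i hi
    rcases mul_eq_zero.1 (h0 i (Finset.mem_univ i)) with h | h
    · exact h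
    · exact absurd h (by exact_mod_cast hi.ne')
  · intro i _
    by_cases hi : i ∈ A
    · exact mul_nonneg (ha i) (by exact_mod_cast hm i hi)
    · rw [ha' i hi, zero_mul]

lemma exists_face_vector {K : Finset (Finset (Fin r))} (h1 : HasDualVectors v K)
    {B : Finset (Fin r)} (hB : B ∈ K) (D : Finset (Fin r)) :
    ∃ m : Fin n → ℤ, ∀ i ∈ B, intPairing m (v i) = if i ∈ D then 0 else 1 := by
  classical
  choose! d hd hd' using h1 B hB
  refine ⟨∑ j ∈ B \ D, d j, fun i hi => ?_⟩
  have : intPairing (∑ j ∈ B \ D, d j) (v i) = ∑ j ∈ B \ D, intPairing (d j) (v i) := by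
    simp only [intPairing, Finset.sum_apply, Finset.sum_mul]
    exact Finset.sum_comm
  rw [this]
  split_ifs with h
  · refine Finset.sum_eq_zero fun j hj => ?_
    rw [Finset.mem_sdiff] at hj
    exact hd' j hj.1 i hi fun e => hj.2 (e ▸ h)
  · rw [Finset.sum_eq_single i, hd i hi]
    · intro j hj hji
      exact hd' j (Finset.mem_sdiff.1 hj).1 i hi hji.symm
    · intro h'
      exact absurd (Finset.mem_sdiff.2 ⟨hi, h⟩) h'

lemma isFace_simplexCone {K : Finset (Finset (Fin r))} (h1 : HasDualVectors v K)
    {A B D : Finset (Fin r)} (hB : B ∈ K) (hA : A ⊆ B) (hD : D ⊆ A) :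
    IsFace (simplexCone v D) (simplexCone v A) := by
  obtain ⟨m, hm⟩ := exists_face_vector h1 hB D
  have hm0 : ∀ i ∈ A, 0 ≤ intPairing m (v i) := fun i hi => by
    rw [hm i (hA hi)]; split_ifs <;> simp
  refine ⟨m, fun x hx => ?_, fun x => ⟨fun hx => ?_, ?_⟩⟩
  · refine pairing_coneOf_nonneg ?_ hx
    rintro _ ⟨i, hi, rfl⟩
    rw [pairing_intCast]
    exact_mod_cast hm0 i hi
  · obtain ⟨a, ha, ha', rfl⟩ := (mem_simplexCone v).1 hx
    refine ⟨(mem_simplexCone v).2 ⟨a, ha, fun i hi => ha' i fun h => hi (hD h), rfl⟩, ?_⟩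
    rw [pairing_comb]
    refine Finset.sum_eq_zero fun i _ => ?_
    by_cases hi : i ∈ D
    · rw [hm i (hA (hD hi)), if_pos hi]; simp
    · rw [ha' i hi, zero_mul]
  · rintro ⟨hx, h0⟩
    obtain ⟨a, ha, ha', rfl⟩ := (mem_simplexCone v).1 hx
    refine (mem_simplexCone v).2 ⟨a, ha, fun i hi => ?_, rfl⟩
    by_cases hiA : i ∈ A
    · refine coeff_eq_zero_of_pairing ha ha' hm0 h0 i ?_
      rw [hm i (hA hiA), if_neg hi]; exact one_pos
    · exact ha' i hiA

lemma face_of_simplexCone {A : Finset (Fin r)} {τ : PointedCone ℝ (Fin n → ℝ)}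
    (h : IsFace τ (simplexCone v A)) : ∃ D ⊆ A, τ = simplexCone v D := by
  classical
  obtain ⟨m, hm, hτ⟩ := h
  have hm0 : ∀ i ∈ A, 0 ≤ intPairing m (v i) := fun i hi => by
    have := hm _ (mem_coneOf ⟨i, hi, rfl⟩)
    rw [pairing_intCast] at this
    exact_mod_cast this
  refine ⟨A.filter fun i => intPairing m (v i) = 0, Finset.filter_subset _ _, ?_⟩
  ext x
  rw [hτ]
  constructor
  · rintro ⟨hx, h0⟩
    obtain ⟨a, ha, ha', rfl⟩ := (mem_simplexCone v).1 hx
    refine (mem_simplexCone v).2 ⟨a, ha, fun i hi => ?_, rfl⟩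
    by_cases hiA : i ∈ A
    · refine coeff_eq_zero_of_pairing ha ha' hm0 h0 i ?_
      exact lt_of_le_of_ne (hm0 i hiA) fun e => hi (Finset.mem_filter.2 ⟨hiA, e.symm⟩)
    · exact ha' i hiA
  · intro hx
    obtain ⟨a, ha, ha', rfl⟩ := (mem_simplexCone v).1 hx
    refine ⟨(mem_simplexCone v).2
      ⟨a, ha, fun i hi => ha' i fun h => hi (Finset.mem_filter.1 h).1, rfl⟩, ?_⟩
    rw [pairing_comb]
    refine Finset.sum_eq_zero fun i _ => ?_
    by_cases hi : i ∈ A.filter fun i => intPairing m (v i) = 0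
    · rw [(Finset.mem_filter.1 hi).2]; simp
    · rw [ha' i hi, zero_mul]

lemma coeff_unique {K : Finset (Finset (Fin r))} (h1 : HasDualVectors v K)
    {B : Finset (Fin r)} (hB : B ∈ K) {a b : Fin r → ℝ} (ha : ∀ i, i ∉ B → a i = 0)
    (hb : ∀ i, i ∉ B → b i = 0)
    (h : ∑ i, a i • (fun j => (v i j : ℝ)) = ∑ i, b i • (fun j => (v i j : ℝ))) : a = b := by
  funext i
  by_cases hi : i ∈ B
  · obtain ⟨m, hm, hm'⟩ := h1 B hB i hi
    have key : ∀ c : Fin r → ℝ, (∀ i, i ∉ B → c i = 0) →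
        pairing m (∑ i, c i • (fun j => (v i j : ℝ))) = c i := by
      intro c hc
      rw [pairing_comb, Finset.sum_eq_single i]
      · rw [hm]; simp
      · intro j _ hj
        by_cases hjB : j ∈ B
        · rw [hm' j hjB hj]; simp
        · rw [hc j hjB, zero_mul]
      · simp
    rw [← key a ha, ← key b hb, h]
  · rw [ha i hi, hb i hi]

lemma simplexCone_inf {K : Finset (Finset (Fin r))} (h1 : HasDualVectors v K)
    (h2 : HasSeparators v K) {A A' B C : Finset (Fin r)} (hB : B ∈ K) (hC : C ∈ K) (hA : A ⊆ B)
    (hA' : A' ⊆ C) : simplexCone v A ⊓ simplexCone v A' = simplexCone v (A ∩ A') := by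
  ext x
  constructor
  · rintro ⟨hx, hx'⟩
    obtain ⟨a, ha, ha0, rfl⟩ := (mem_simplexCone v).1 hx
    obtain ⟨b, hb, hb0, hab⟩ := (mem_simplexCone v).1 hx'
    obtain ⟨m, hmB, hmC, hmBC⟩ := h2 B hB C hC
    have hle : ∀ i, i ∈ B → 0 ≤ intPairing m (v i) := fun i hi => by
      by_cases h : i ∈ C
      · exact (hmBC i hi h).ge
      · exact (hmB i hi h).le
    have hneg : ∀ w : Fin n → ℤ, intPairing (-m) w = - intPairing m w := fun w => by
      simp [intPairing]
    have hle' : ∀ i, i ∈ C → 0 ≤ intPairing (-m) (v i) := fun i hi => by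
      rw [hneg]
      by_cases h : i ∈ B
      · exact (neg_eq_zero.2 (hmBC i h hi)).ge
      · exact (neg_pos.2 (hmC i hi h)).le
    have hnn : ∀ (m' : Fin n → ℤ) (c : Fin r → ℝ) (E : Finset (Fin r)), (∀ i, 0 ≤ c i) →
        (∀ i, i ∉ E → c i = 0) → (∀ i ∈ E, 0 ≤ intPairing m' (v i)) →
        0 ≤ pairing m' (∑ i, c i • (fun j => (v i j : ℝ))) := by
      intro m' c E hc hc0 hm'
      rw [pairing_comb]
      refine Finset.sum_nonneg fun i _ => ?_
      by_cases hi : i ∈ E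
      · exact mul_nonneg (hc i) (by exact_mod_cast hm' i hi)
      · rw [hc0 i hi, zero_mul]
    have p1 := hnn m a A ha ha0 fun i hi => hle i (hA hi)
    have p2 := hnn (-m) b A' hb hb0 fun i hi => hle' i (hA' hi)
    rw [← hab, pairing_neg_left] at p2
    have p0 : pairing m (∑ i, a i • (fun j => (v i j : ℝ))) = 0 := le_antisymm (by linarith) p1
    have p0' : pairing (-m) (∑ i, b i • (fun j => (v i j : ℝ))) = 0 := by
      rw [← hab, pairing_neg_left, p0, neg_zero]
    have hb1 := coeff_eq_zero_of_pairing hb hb0 (fun i hi => hle' i (hA' hi)) p0'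
    have hbB : ∀ i, i ∉ B → b i = 0 := fun i hi => by
      by_cases h : i ∈ C
      · exact hb1 i (by rw [hneg]; exact neg_pos.2 (hmC i h hi))
      · exact hb0 i fun h' => h (hA' h')
    have heq : a = b := coeff_unique h1 hB (fun i hi => ha0 i fun h => hi (hA h)) hbB hab
    refine (mem_simplexCone v).2 ⟨a, ha, fun i hi => ?_, rfl⟩
    rw [Finset.mem_inter, not_and_or] at hi
    rcases hi with hi | hi
    · exact ha0 i hi
    · rw [heq]; exact hb0 i hi
  · intro hx
    obtain ⟨a, ha, ha0, rfl⟩ := (mem_simplexCone v).1 hx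
    exact ⟨(mem_simplexCone v).2
        ⟨a, ha, fun i hi => ha0 i fun h => hi (Finset.mem_inter.1 h).1, rfl⟩,
      (mem_simplexCone v).2 ⟨a, ha, fun i hi => ha0 i fun h => hi (Finset.mem_inter.1 h).2, rfl⟩⟩

variable (v)

/-- The fan consisting of the cones over the sets in `K` and over all their subsets. -/
def fanOfSimplices (K : Finset (Finset (Fin r))) (h0 : K.Nonempty) (h1 : HasDualVectors v K)
    (h2 : HasSeparators v K) : Fan n where
  cones := {σ | ∃ B ∈ K, ∃ A ⊆ B, σ = simplexCone v A}
  finite := (Set.finite_range (simplexCone v)).subset (by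
    rintro _ ⟨_, _, A, _, rfl⟩
    exact ⟨A, rfl⟩)
  bot_mem := by
    obtain ⟨B, hB⟩ := h0
    exact ⟨B, hB, ∅, Finset.empty_subset _, by simp [simplexCone, coneOf]⟩
  rational := by
    rintro _ ⟨_, _, A, _, rfl⟩
    exact ⟨v '' A, A.finite_toSet.image v, rfl⟩
  stronglyConvex := by
    rintro _ ⟨B, hB, A, hA, rfl⟩ x hx hx'
    obtain ⟨a, ha, ha0, rfl⟩ := (mem_simplexCone v).1 hx
    obtain ⟨b, hb, hb0, hab⟩ := (mem_simplexCone v).1 hx'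
    have : a = -b := by
      refine coeff_unique h1 hB (fun i hi => ha0 i fun h => hi (hA h))
        (fun i hi => neg_eq_zero.2 (hb0 i fun h => hi (hA h))) ?_
      simp only [Pi.neg_apply, neg_smul, Finset.sum_neg_distrib]
      rw [← hab, neg_neg]
    refine Finset.sum_eq_zero fun i _ => ?_
    have h3 := congrFun this i
    have h4 : a i = 0 := le_antisymm (by rw [h3]; exact neg_nonpos.2 (hb i)) (ha i)
    rw [h4, zero_smul]
  face_mem := by
    rintro _ ⟨B, hB, A, hA, rfl⟩ τ hτ
    obtain ⟨D, hD, rfl⟩ := face_of_simplexCone hτ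
    exact ⟨B, hB, D, hD.trans hA, rfl⟩
  inter_face := by
    rintro _ ⟨B, hB, A, hA, rfl⟩ _ ⟨C, hC, A', hA', rfl⟩
    rw [simplexCone_inf h1 h2 hB hC hA hA']
    exact ⟨isFace_simplexCone h1 hB hA Finset.inter_subset_left,
      isFace_simplexCone h1 hC hA' Finset.inter_subset_right⟩

end SimplicialFan

/-- The primitive generators `v₁, …, v₈` of the rays of the fan of `Z''₁₃(a, b, c, d)`
(`rays a b c d i` is `v_{i+1}`). -/
def rays (a b c d : ℤ) : Fin 8 → Fin 3 → ℤ :=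
  ![![1, 1, b], ![1, 0, 0], ![0, -1, 0], ![0, 0, -1],
    ![-1, a, d], ![0, 1, 0], ![0, 0, 1], ![-1, c, d + 1]]

/-- The sets of indices `i` (shifted down by one) of the maximal cones `⟨v₁, v₂, v₄⟩`,
`⟨v₂, v₃, v₄⟩`, `⟨v₃, v₄, v₅⟩`, `⟨v₄, v₅, v₆⟩`, `⟨v₁, v₄, v₆⟩`, `⟨v₁, v₆, v₇⟩`, `⟨v₁, v₂, v₇⟩`,
`⟨v₂, v₃, v₇⟩`, `⟨v₃, v₅, v₈⟩`, `⟨v₅, v₆, v₈⟩`, `⟨v₃, v₇, v₈⟩`, `⟨v₆, v₇, v₈⟩`. -/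
def maxCones : Finset (Finset (Fin 8)) :=
  {{0, 1, 3}, {1, 2, 3}, {2, 3, 4}, {3, 4, 5}, {0, 3, 5}, {0, 5, 6},
    {0, 1, 6}, {1, 2, 6}, {2, 4, 7}, {4, 5, 7}, {2, 6, 7}, {5, 6, 7}}

/-- Dual basis vectors of the maximal cones. -/
def dualList : List (Fin 3 → ℤ) :=
  [![-7, 0, 1], ![-4, -1, 0], ![-3, 0, -1], ![-2, -1, 0], ![-2, 0, -1],
    ![-2, 1, -2], ![-1, 0, 0], ![-1, 1, 0], ![0, -7, 1], ![0, -1, 0],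
    ![0, 0, -1], ![0, 0, 1], ![0, 1, 0], ![0, 7, -1], ![1, -1, 0],
    ![1, 0, 0], ![2, -1, 2], ![2, 0, 1], ![2, 1, 0], ![3, 0, 1],
    ![4, 1, 0], ![7, 0, -1]]

lemma hasDualVectors : HasDualVectors (rays 2 7 4 2) maxCones := by
  have h : ∀ B ∈ maxCones, ∀ i ∈ B, ∃ m ∈ dualList, intPairing m (rays 2 7 4 2 i) = 1 ∧
      ∀ j ∈ B, j ≠ i → intPairing m (rays 2 7 4 2 j) = 0 := by decide +kernel
  intro B hB i hi
  obtain ⟨m, -, hm⟩ := h B hB i hi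
  exact ⟨m, hm⟩

/-- Separating vectors for the pairs of maximal cones. -/
def sepList : List (Fin 3 → ℤ) :=
  [![0, 0, 0], ![-1, 0, 0], ![-1, 1, 0], ![-1, 1, -1], ![-3, 0, -1],
    ![-5, -1, 0], ![-8, 0, 1], ![-7, -1, 1], ![-8, -1, -1], ![-9, 1, 1],
    ![0, -1, 0], ![-2, 0, -1], ![-2, 1, 0], ![-1, 2, 0], ![-4, 0, -1],
    ![-5, 0, -2], ![0, 0, -1], ![0, -1, -1], ![-2, -1, 0], ![-1, 1, 1],
    ![-4, -1, 0], ![-2, 1, -2], ![-4, -1, -1], ![-5, -1, -1], ![-7, 0, 1],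
    ![-4, 1, -3], ![0, -7, 1], ![-7, -1, -1], ![-5, 1, -3], ![0, -8, 1],
    ![-8, 1, 1], ![-1, 8, -1], ![-1, 9, -1], ![-7, 1, -4]]

lemma hasSeparators : HasSeparators (rays 2 7 4 2) maxCones := by
  have h : ∀ B ∈ maxCones, ∀ C ∈ maxCones, ∃ m ∈ sepList ++ sepList.map Neg.neg,
      (∀ i ∈ B, i ∉ C → 0 < intPairing m (rays 2 7 4 2 i)) ∧
      (∀ i ∈ C, i ∉ B → intPairing m (rays 2 7 4 2 i) < 0) ∧
      (∀ i ∈ B, i ∈ C → intPairing m (rays 2 7 4 2 i) = 0) := by decide +kernel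
  intro B hB C hC
  obtain ⟨m, -, hm⟩ := h B hB C hC
  exact ⟨m, hm⟩

/-- The fan of `Z''₁₃(2, 7, 4, 2)`. -/
def zFan : Fan 3 :=
  fanOfSimplices (rays 2 7 4 2) maxCones ⟨{0, 1, 3}, by decide⟩ hasDualVectors hasSeparators

end Toric

end

/-! The heart of the matter is that the eight rays determine the fan. Suppose that X' is smooth,
projective and isomorphic to X in codimension one through a toric map. Generic points of invariant
prime divisors then correspond, so the fan of X' has the same rays as `zFan`, after the
identification of character lattices given by the map. Its maximal cones are spanned by lattice
bases taken from the eight vectors, contain no further one of the eight, and cover the space. A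
finite check (`forced_triple`) shows that such a cone, if it contains the sum of the generators of a
maximal cone of `zFan`, is that cone. Hence all twelve maximal cones occur in X'
(`exists_basisChart_iff`).

A projective embedding yields a lattice vector for each of these cones, and the vectors form a
strictly convex support function (`exists_strictlyConvex_of_isProjective`). The embedding need not
be equivariant. Its homogeneous coordinates are viewed as rational functions g j; on each chart, an
affine space, they generate a principal fractional ideal, and two of these generators differ on the
torus by a monomial, whose exponents are the vectors sought. Five walls of `zFan` give inequalities
with a positive combination 0 < 0 (`not_exists_strictlyConvex`). Taking X' = X gives the
nonprojectivity of X.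

All schemes are compared inside one field K containing the Laurent polynomial ring: a point x is
studied through its local ring, as the subring `localRing` of K, and through the characters lying in
it. Over a smooth complete X', enough affine-space charts come from the valuative criterion applied
to a Hahn series field (`Fan.exists_cone_nonneg`) together with the fact that smooth pointed affine
toric varieties are affine spaces (`exists_basis_of_smooth`).

For X itself, smoothness holds since the twelve maximal charts are affine spaces. Properness is the
valuative criterion combined with completeness of the fan over arbitrary ordered groups
(`exists_zBasis_nonneg`). The Picard rank is 8 - 3, from the exact sequence 0 → M → ℤ⁸ → Pic X → 0.
-/

noncomputable section

namespace Toric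

/-! ### The combinatorics of the fan of `Z''₁₃(2, 7, 4, 2)` -/

/-- The maximal cones, as ordered triples of indices of rays. -/
def triple : Fin 12 → Fin 3 → Fin 8 :=
  ![![0, 1, 3], ![1, 2, 3], ![2, 3, 4], ![3, 4, 5], ![0, 3, 5], ![0, 5, 6],
    ![0, 1, 6], ![1, 2, 6], ![2, 4, 7], ![4, 5, 7], ![2, 6, 7], ![5, 6, 7]]

/-- The bases of the dual lattice that are dual to the generators of the maximal cones. -/
def dualVec : Fin 12 → Fin 3 → Fin 3 → ℤ :=
  ![![![0, 1, 0], ![1, -1, 0], ![0, 7, -1]], ![![1, 0, 0], ![0, -1, 0], ![0, 0, -1]],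
    ![![-2, -1, 0], ![-2, 0, -1], ![-1, 0, 0]], ![![-2, 0, -1], ![-1, 0, 0], ![2, 1, 0]],
    ![![1, 0, 0], ![7, 0, -1], ![-1, 1, 0]], ![![1, 0, 0], ![-1, 1, 0], ![-7, 0, 1]],
    ![![0, 1, 0], ![1, -1, 0], ![0, -7, 1]], ![![1, 0, 0], ![0, -1, 0], ![0, 0, 1]],
    ![![2, -1, 2], ![-3, 0, -1], ![2, 0, 1]], ![![-3, 0, -1], ![-2, 1, -2], ![2, 0, 1]],
    ![![-4, -1, 0], ![3, 0, 1], ![-1, 0, 0]], ![![4, 1, 0], ![3, 0, 1], ![-1, 0, 0]]]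

/-- The generators of the rays of the fan. -/
abbrev zRay : Fin 8 → Fin 3 → ℤ := rays 2 7 4 2

lemma intPairing_dualVec (t : Fin 12) (i j : Fin 3) :
    intPairing (dualVec t i) (zRay (triple t j)) = if i = j then 1 else 0 := by
  revert t i j; decide +kernel

lemma triple_mem (t : Fin 12) : Finset.univ.image (triple t) ∈ maxCones := by
  revert t; decide +kernel

lemma exists_triple {B : Finset (Fin 8)} (hB : B ∈ maxCones) :
    ∃ t, B = Finset.univ.image (triple t) := by
  revert B; decide +kernel

lemma triple_injective (t : Fin 12) : Function.Injective (triple t) := by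
  revert t; decide +kernel

lemma exists_triple_eq (i : Fin 8) : ∃ t j, triple t j = i := by
  revert i; decide +kernel

lemma intPairing_add_left {n : ℕ} (m m' w : Fin n → ℤ) :
    intPairing (m + m') w = intPairing m w + intPairing m' w := by
  simp [intPairing, add_mul, Finset.sum_add_distrib]

lemma intPairing_smul_left {n : ℕ} (c : ℤ) (m w : Fin n → ℤ) :
    intPairing (c • m) w = c * intPairing m w := by
  simp [intPairing, Finset.mul_sum, mul_assoc]

lemma intPairing_sub_left {n : ℕ} (m m' w : Fin n → ℤ) :
    intPairing (m - m') w = intPairing m w - intPairing m' w := by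
  simp [intPairing, sub_mul, Finset.sum_sub_distrib]

lemma intPairing_neg_left {n : ℕ} (m w : Fin n → ℤ) :
    intPairing (-m) w = - intPairing m w := by
  simp [intPairing]

lemma intPairing_zero_left {n : ℕ} (w : Fin n → ℤ) :
    intPairing (0 : Fin n → ℤ) w = 0 := by
  simp [intPairing]

lemma intPairing_add_right {n : ℕ} (m w w' : Fin n → ℤ) :
    intPairing m (w + w') = intPairing m w + intPairing m w' := by
  simp [intPairing, mul_add, Finset.sum_add_distrib]

lemma intPairing_sum_left {n : ℕ} {ι : Type*} (s : Finset ι) (m : ι → Fin n → ℤ)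
    (w : Fin n → ℤ) : intPairing (∑ i ∈ s, m i) w = ∑ i ∈ s, intPairing (m i) w := by
  simp only [intPairing, Finset.sum_apply, Finset.sum_mul]
  exact Finset.sum_comm

/-- The basis of the dual lattice dual to the generators of a maximal cone. -/
def zBasis (t : Fin 12) : Module.Basis (Fin 3) ℤ (Fin 3 → ℤ) :=
  Module.Basis.ofEquivFun
    { toFun := fun m i => intPairing m (zRay (triple t i))
      map_add' := fun m m' => by ext i; exact intPairing_add_left _ _ _
      map_smul' := fun c m => by ext i; exact intPairing_smul_left _ _ _
      invFun := fun c => ∑ i, c i • dualVec t i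
      left_inv := fun m => by
        fin_cases t <;> ext i <;> fin_cases i <;>
          simp [intPairing, rays, triple, dualVec, Fin.sum_univ_three] <;> ring
      right_inv := fun c => by
        ext i
        simp only [intPairing_sum_left, intPairing_smul_left, intPairing_dualVec]
        simp }

lemma zBasis_repr (t : Fin 12) (m : Fin 3 → ℤ) (i : Fin 3) :
    (zBasis t).repr m i = intPairing m (zRay (triple t i)) := rfl

lemma zBasis_apply (t : Fin 12) (i : Fin 3) : zBasis t i = dualVec t i := by
  apply (zBasis t).repr.injective
  ext j
  rw [Module.Basis.repr_self, Finsupp.single_apply, zBasis_repr, intPairing_dualVec]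

/-- The fan is complete, over every linearly ordered abelian group. -/
lemma exists_zBasis_nonneg {G : Type*} [AddCommGroup G] [LinearOrder G] [IsOrderedAddMonoid G]
    (W : (Fin 3 → ℤ) →+ G) : ∃ t, ∀ i, 0 ≤ W (zBasis t i) := by
  have key : ∀ m : Fin 3 → ℤ, W m = m 0 • W (Pi.single 0 1) + m 1 • W (Pi.single 1 1) +
      m 2 • W (Pi.single 2 1) := by
    intro m
    conv_lhs => rw [← Finset.univ_sum_single m, Fin.sum_univ_three]
    rw [map_add, map_add, ← map_zsmul, ← map_zsmul, ← map_zsmul]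
    simp only [← Pi.single_smul, smul_eq_mul, mul_one]
  have key' : ∀ t i, W (zBasis t i) = dualVec t i 0 • W (Pi.single 0 1) +
      dualVec t i 1 • W (Pi.single 1 1) + dualVec t i 2 • W (Pi.single 2 1) :=
    fun t i => by rw [zBasis_apply]; exact key _
  simp only [key']
  clear key key'
  generalize W (Pi.single 0 1) = a
  generalize W (Pi.single 1 1) = b
  generalize W (Pi.single 2 1) = c
  have h3 : ∀ P : Fin 3 → Prop, P 0 → P 1 → P 2 → ∀ i, P i := by
    intro P h0 h1 h2 i; fin_cases i <;> assumption
  -- The case tree locates the functional among the twelve cones: each comparison is the sign of `W`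
  -- on one of the dual basis vectors, that is, the side of a plane spanned by a wall.
  rcases le_total 0 a with ha | ha
  · rcases le_total 0 b with hb | hb
    · rcases le_total b a with hab | hab
      · rcases le_total ((7 : ℤ) • b) c with h | h
        · refine ⟨6, h3 _ ?_ ?_ ?_⟩ <;> simp [dualVec] <;> grind
        · refine ⟨0, h3 _ ?_ ?_ ?_⟩ <;> simp [dualVec] <;> grind
      · rcases le_total ((7 : ℤ) • a) c with h | h
        · refine ⟨5, h3 _ ?_ ?_ ?_⟩ <;> simp [dualVec] <;> grind
        · refine ⟨4, h3 _ ?_ ?_ ?_⟩ <;> simp [dualVec] <;> grind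
    · rcases le_total 0 c with h | h
      · refine ⟨7, h3 _ ?_ ?_ ?_⟩ <;> simp [dualVec] <;> grind
      · refine ⟨1, h3 _ ?_ ?_ ?_⟩ <;> simp [dualVec] <;> grind
  · rcases le_total ((2 : ℤ) • a + c) 0 with h | h
    · rcases le_total ((2 : ℤ) • a + b) 0 with h' | h'
      · refine ⟨2, h3 _ ?_ ?_ ?_⟩ <;> simp [dualVec] <;> grind
      · refine ⟨3, h3 _ ?_ ?_ ?_⟩ <;> simp [dualVec] <;> grind
    · rcases le_total ((3 : ℤ) • a + c) 0 with h1 | h1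
      · rcases le_total b ((2 : ℤ) • a + (2 : ℤ) • c) with h2 | h2
        · refine ⟨8, h3 _ ?_ ?_ ?_⟩ <;> simp [dualVec] <;> grind
        · refine ⟨9, h3 _ ?_ ?_ ?_⟩ <;> simp [dualVec] <;> grind
      · rcases le_total ((4 : ℤ) • a + b) 0 with h2 | h2
        · refine ⟨10, h3 _ ?_ ?_ ?_⟩ <;> simp [dualVec] <;> grind
        · refine ⟨11, h3 _ ?_ ?_ ?_⟩ <;> simp [dualVec] <;> grind

/-- An interior lattice point of a maximal cone. -/
def interiorPoint (t : Fin 12) : Fin 3 → ℤ := ∑ i, zRay (triple t i)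

/-- The determinant of three vectors. -/
def det3 (x y z : Fin 3 → ℤ) : ℤ :=
  x 0 * (y 1 * z 2 - y 2 * z 1) - x 1 * (y 0 * z 2 - y 2 * z 0) +
    x 2 * (y 0 * z 1 - y 1 * z 0)

-- By Cramer's rule, when the determinant is ±1 the products of determinants are the coordinates of
-- a vector in the basis given by `p`. The hypotheses thus say that `p` spans a smooth cone that
-- contains no other ray generator but contains the interior point of the cone `t`. Only finitely
-- many `(p, t)` exist, and they are all checked.
set_option synthInstance.maxHeartbeats 400000 in
set_option synthInstance.maxSize 2000 in
lemma forced_triple (p : Fin 3 → Fin 8) (t : Fin 12)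
    (hd : det3 (zRay (p 0)) (zRay (p 1)) (zRay (p 2)) = 1 ∨
      det3 (zRay (p 0)) (zRay (p 1)) (zRay (p 2)) = -1)
    (hray : ∀ i, 0 ≤ det3 (zRay (p 0)) (zRay (p 1)) (zRay (p 2)) *
        det3 (zRay i) (zRay (p 1)) (zRay (p 2)) →
      0 ≤ det3 (zRay (p 0)) (zRay (p 1)) (zRay (p 2)) *
        det3 (zRay (p 0)) (zRay i) (zRay (p 2)) →
      0 ≤ det3 (zRay (p 0)) (zRay (p 1)) (zRay (p 2)) *
        det3 (zRay (p 0)) (zRay (p 1)) (zRay i) → i = p 0 ∨ i = p 1 ∨ i = p 2)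
    (h0 : 0 ≤ det3 (zRay (p 0)) (zRay (p 1)) (zRay (p 2)) *
      det3 (interiorPoint t) (zRay (p 1)) (zRay (p 2)))
    (h1 : 0 ≤ det3 (zRay (p 0)) (zRay (p 1)) (zRay (p 2)) *
      det3 (zRay (p 0)) (interiorPoint t) (zRay (p 2)))
    (h2 : 0 ≤ det3 (zRay (p 0)) (zRay (p 1)) (zRay (p 2)) *
      det3 (zRay (p 0)) (zRay (p 1)) (interiorPoint t)) :
    ∀ j, ∃ i, triple t j = p i := by
  generalize e0 : p 0 = x at *
  generalize e1 : p 1 = y at *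
  generalize e2 : p 2 = z at *
  have key : ∀ j, triple t j = x ∨ triple t j = y ∨ triple t j = z := by
    clear e0 e1 e2
    revert x y z t
    decide +kernel
  intro j
  rcases key j with h | h | h
  · exact ⟨0, by rw [h, e0]⟩
  · exact ⟨1, by rw [h, e1]⟩
  · exact ⟨2, by rw [h, e2]⟩

/-- A basis of the lattice which consists of generators of rays, whose cone contains no other
generators, but does contain an interior point of a maximal cone, spans this maximal cone. -/
lemma exists_perm_of_interiorPoint (b : Module.Basis (Fin 3) ℤ (Fin 3 → ℤ)) (p : Fin 3 → Fin 8)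
    (hb : ∀ m i, b.repr m i = intPairing m (zRay (p i)))
    (hray : ∀ i, (∀ j, 0 ≤ intPairing (b j) (zRay i)) → ∃ j, i = p j)
    (t : Fin 12) (ht : ∀ j, 0 ≤ intPairing (b j) (interiorPoint t)) :
    ∀ j, ∃ i, triple t j = p i := by
  have hdual : ∀ i j, intPairing (b i) (zRay (p j)) = if i = j then 1 else 0 := by
    intro i j
    rw [← hb, Module.Basis.repr_self, Finsupp.single_apply]
  have hdet : det3 (b 0) (b 1) (b 2) * det3 (zRay (p 0)) (zRay (p 1)) (zRay (p 2)) = 1 := by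
    have h00 := hdual 0 0
    have h01 := hdual 0 1
    have h02 := hdual 0 2
    have h10 := hdual 1 0
    have h11 := hdual 1 1
    have h12 := hdual 1 2
    have h20 := hdual 2 0
    have h21 := hdual 2 1
    have h22 := hdual 2 2
    have e : det3 (b 0) (b 1) (b 2) * det3 (zRay (p 0)) (zRay (p 1)) (zRay (p 2)) =
      det3 (fun j => intPairing (b 0) (zRay (p j))) (fun j => intPairing (b 1) (zRay (p j)))
        (fun j => intPairing (b 2) (zRay (p j))) := by
      simp only [det3, intPairing, Fin.sum_univ_three]
      ring
    rw [e]
    simp only [det3, h00, h01, h02, h10, h11, h12, h20, h21, h22]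
    decide
  have hexp : ∀ w : Fin 3 → ℤ, w = intPairing (b 0) w • zRay (p 0) +
      intPairing (b 1) w • zRay (p 1) + intPairing (b 2) w • zRay (p 2) := by
    intro w
    have : ∀ m, intPairing m w = intPairing m (intPairing (b 0) w • zRay (p 0) +
      intPairing (b 1) w • zRay (p 1) + intPairing (b 2) w • zRay (p 2)) := by
      intro m
      conv_lhs => rw [← b.sum_repr m, Fin.sum_univ_three, hb, hb, hb]
      simp only [intPairing_add_left, intPairing_smul_left, intPairing_add_right]
      simp only [intPairing, Fin.sum_univ_three, Pi.smul_apply, smul_eq_mul]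
      ring
    ext i
    have h := this (Pi.single i 1)
    simpa [intPairing, Pi.single_apply] using h
  have hd : det3 (zRay (p 0)) (zRay (p 1)) (zRay (p 2)) = 1 ∨
      det3 (zRay (p 0)) (zRay (p 1)) (zRay (p 2)) = -1 :=
    Int.isUnit_iff.1 (IsUnit.of_mul_eq_one _ ((mul_comm _ _).trans hdet))
  have hsq : det3 (zRay (p 0)) (zRay (p 1)) (zRay (p 2)) *
      det3 (zRay (p 0)) (zRay (p 1)) (zRay (p 2)) = 1 := by
    rcases hd with h | h <;> rw [h] <;> rfl
  -- Cramer's rule; since the determinant squares to 1, multiplying by it replaces division.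
  have hc : ∀ w : Fin 3 → ℤ,
      det3 (zRay (p 0)) (zRay (p 1)) (zRay (p 2)) * det3 w (zRay (p 1)) (zRay (p 2)) =
        intPairing (b 0) w ∧
      det3 (zRay (p 0)) (zRay (p 1)) (zRay (p 2)) * det3 (zRay (p 0)) w (zRay (p 2)) =
        intPairing (b 1) w ∧
      det3 (zRay (p 0)) (zRay (p 1)) (zRay (p 2)) * det3 (zRay (p 0)) (zRay (p 1)) w =
        intPairing (b 2) w := by
    intro w
    have h := hexp w
    generalize intPairing (b 0) w = x at *
    generalize intPairing (b 1) w = y at *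
    generalize intPairing (b 2) w = z at *
    rw [h]
    refine ⟨?_, ?_, ?_⟩
    · refine Eq.trans ?_ (mul_one x)
      rw [← hsq]; simp only [det3, Pi.add_apply, Pi.smul_apply, smul_eq_mul]; ring
    · refine Eq.trans ?_ (mul_one y)
      rw [← hsq]; simp only [det3, Pi.add_apply, Pi.smul_apply, smul_eq_mul]; ring
    · refine Eq.trans ?_ (mul_one z)
      rw [← hsq]; simp only [det3, Pi.add_apply, Pi.smul_apply, smul_eq_mul]; ring
  refine forced_triple p t hd (fun i h0 h1 h2 => ?_) ?_ ?_ ?_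
  · rw [(hc _).1] at h0
    rw [(hc _).2.1] at h1
    rw [(hc _).2.2] at h2
    obtain ⟨j, hj⟩ := hray i (by intro j; fin_cases j <;> assumption)
    fin_cases j
    · exact Or.inl hj
    · exact Or.inr (Or.inl hj)
    · exact Or.inr (Or.inr hj)
  · rw [(hc _).1]; exact ht 0
  · rw [(hc _).2.1]; exact ht 1
  · rw [(hc _).2.2]; exact ht 2

/-- There is no strictly convex support function on the fan. -/
lemma not_exists_strictlyConvex (m : Fin 12 → Fin 3 → ℤ)
    (hle : ∀ s t i, intPairing (m s) (zRay (triple s i)) ≤ intPairing (m t) (zRay (triple s i)))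
    (hinj : Function.Injective m) : False := by
  -- For adjacent cones, `j` is the ray of `s` off the common wall. Equality there would make `m s`
  -- and `m t` agree on a basis.
  have hw : ∀ s t j, (∀ i, i ≠ j → ∃ i', triple s i = triple t i') → s ≠ t →
      intPairing (m s) (zRay (triple s j)) < intPairing (m t) (zRay (triple s j)) := by
    intro s t j h hst
    refine lt_of_le_of_ne (hle s t j) fun e => hst (hinj ?_)
    apply (zBasis s).repr.injective
    ext i
    rw [zBasis_repr, zBasis_repr]
    by_cases hij : i = j
    · rw [hij, e]
    · obtain ⟨i', hi'⟩ := h i hij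
      refine le_antisymm (hle s t i) ?_
      rw [hi']
      exact hle t s i'
  have eq : ∀ s t i j, triple s i = triple t j →
      intPairing (m s) (zRay (triple s i)) = intPairing (m t) (zRay (triple t j)) := by
    intro s t i j h
    refine le_antisymm (h ▸ hle s t i) ?_
    rw [h]
    exact hle t s j
  -- The five walls correspond to the relations v₁+v₃+7v₄ = v₂, v₂+v₆ = v₁+7v₄, v₄+v₈ = v₅+2v₆,
  -- v₁+v₃ = v₂+7v₇ and v₅+v₇ = v₈+2v₃. Each makes the support function strictly smaller on the
  -- left, in terms of its values on the rays. With weights 13, 14, 7, 1, 7 the inequalities add up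
  -- to 0 < 0.
  have w1 := hw 0 1 0 (by decide +kernel) (by decide)
  have w2 := hw 0 4 1 (by decide +kernel) (by decide)
  have w3 := hw 3 9 0 (by decide +kernel) (by decide)
  have w4 := hw 6 7 0 (by decide +kernel) (by decide)
  have w5 := hw 8 10 1 (by decide +kernel) (by decide)
  -- These equalities say that the value on a ray does not depend on the cone used to compute it.
  have e1 := eq 0 1 1 0 rfl
  have e2 := eq 0 1 2 2 rfl
  have e3 := eq 0 4 0 0 rfl
  have e4 := eq 0 4 2 1 rfl
  have e5 := eq 3 9 1 0 rfl
  have e6 := eq 3 9 2 1 rfl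
  have e7 := eq 6 7 1 0 rfl
  have e8 := eq 6 7 2 2 rfl
  have e9 := eq 8 10 0 0 rfl
  have e10 := eq 8 10 2 2 rfl
  have e11 := eq 0 6 0 0 rfl
  have e12 := eq 0 6 1 1 rfl
  have e13 := eq 1 7 1 1 rfl
  have e14 := eq 1 7 0 0 rfl
  have e15 := eq 3 4 0 1 rfl
  have e16 := eq 3 4 2 2 rfl
  have e17 := eq 8 9 1 0 rfl
  have e18 := eq 8 9 2 2 rfl
  have e19 := eq 7 10 1 0 rfl
  have e20 := eq 7 10 2 1 rfl
  simp [intPairing, Fin.sum_univ_three, triple, rays] at w1 w2 w3 w4 w5 e1 e2 e3 e4 e5 e6 e7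
  simp [intPairing, Fin.sum_univ_three, triple, rays] at e8 e9 e10 e11 e12 e13 e14 e15 e16 e17 e18 e19 e20
  omega

/-! ### Units of the coordinate ring of a torus -/

/-- If the supports of `f` and its inverse `g` had more than one pair of exponents, two different
pairs would have unique sums. Their coefficients survive in `f * g = 1`, so both sums are 0, which
contradicts uniqueness. -/
lemma isUnit_eq_single {k : Type*} [Field k] {G : Type*} [AddCommGroup G] [TwoUniqueSums G]
    {f : AddMonoidAlgebra k G} (hf : IsUnit f) :
    ∃ (m : G) (c : k), c ≠ 0 ∧ f = AddMonoidAlgebra.single m c := by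
  obtain ⟨g, hg⟩ := hf.exists_right_inv
  have hf0 : f.coeff.support.Nonempty := by
    rw [Finsupp.support_nonempty_iff]
    intro h
    rw [AddMonoidAlgebra.coeff_eq_zero] at h
    simp [h] at hg
  have hg0 : g.coeff.support.Nonempty := by
    rw [Finsupp.support_nonempty_iff]
    intro h
    rw [AddMonoidAlgebra.coeff_eq_zero] at h
    simp [h] at hg
  have hcard : f.coeff.support.card * g.coeff.support.card ≤ 1 := by
    by_contra! h
    obtain ⟨p, hp, q, hq, hne, up, uq⟩ := TwoUniqueSums.uniqueAdd_of_one_lt_card h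
    rw [Finset.mem_product] at hp hq
    have key : ∀ r : G × G, r.1 ∈ f.coeff.support → r.2 ∈ g.coeff.support →
        UniqueAdd f.coeff.support g.coeff.support r.1 r.2 → r.1 + r.2 = 0 := by
      intro r h1 h2 hu
      have := AddMonoidAlgebra.coeff_mul_add_of_uniqueAdd hu
      rw [hg] at this
      by_contra h0
      rw [AddMonoidAlgebra.one_def, AddMonoidAlgebra.coeff_single,
        Finsupp.single_eq_of_ne h0] at this
      exact mul_ne_zero (Finsupp.mem_support_iff.1 h1) (Finsupp.mem_support_iff.1 h2) this.symm
    have e1 := key p hp.1 hp.2 up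
    have e2 := key q hq.1 hq.2 uq
    obtain ⟨h1, h2⟩ := up hq.1 hq.2 (e2.trans e1.symm)
    exact hne (Prod.ext h1.symm h2.symm)
  have h1 : f.coeff.support.card = 1 := by
    have a := hf0.card_pos
    have b := hg0.card_pos
    nlinarith
  obtain ⟨m, hm⟩ := Finset.card_eq_one.1 h1
  obtain ⟨hc, h⟩ := (Finsupp.support_eq_singleton).1 hm
  exact ⟨m, f.coeff m, hc, AddMonoidAlgebra.coeff_injective (by rw [h]; simp)⟩

/-! ### Smooth affine toric varieties -/

/-- The tangent space argument: if the quotient of a polynomial ring by an ideal in the square of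
the augmentation ideal is formally smooth, then the ideal vanishes. -/
lemma ker_eq_bot_of_formallySmooth {k : Type*} [Field k] {σ : Type*} [Finite σ]
    {R : Type*} [CommRing R] [Algebra k R] [Algebra.FormallySmooth k R]
    (π : MvPolynomial σ k →ₐ[k] R) (hπ : Function.Surjective π)
    (hker : RingHom.ker π ≤ RingHom.ker (MvPolynomial.constantCoeff (R := k) (σ := σ)) ^ 2) :
    RingHom.ker π = ⊥ := by
  set J := RingHom.ker π with hJ
  set I := RingHom.ker (MvPolynomial.constantCoeff (R := k) (σ := σ)) with hI
  let q : (MvPolynomial σ k ⧸ J ^ 2) →ₐ[k] R :=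
    Ideal.Quotient.liftₐ (J ^ 2) π fun a ha => RingHom.mem_ker.1 (Ideal.pow_le_self two_ne_zero ha)
  have hqm : ∀ p, q (Ideal.Quotient.mk (J ^ 2) p) = π p := fun _ => rfl
  have hq : Function.Surjective q := fun r => by
    obtain ⟨p, rfl⟩ := hπ r
    exact ⟨Ideal.Quotient.mk _ p, hqm p⟩
  have hnil : IsNilpotent (RingHom.ker q) := by
    refine ⟨2, ?_⟩
    rw [Ideal.zero_eq_bot, eq_bot_iff, sq (RingHom.ker q), Ideal.mul_le]
    intro a ha b hb
    obtain ⟨a, rfl⟩ := Ideal.Quotient.mk_surjective a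
    obtain ⟨b, rfl⟩ := Ideal.Quotient.mk_surjective b
    have ha' : a ∈ J := by rwa [RingHom.mem_ker, hqm] at ha
    have hb' : b ∈ J := by rwa [RingHom.mem_ker, hqm] at hb
    rw [Ideal.mem_bot, ← map_mul, Ideal.Quotient.eq_zero_iff_mem, pow_two]
    exact Ideal.mul_mem_mul ha' hb'
  -- Formal smoothness splits the square-zero extension of `R` by `J / J ^ 2`. The splitting is then
  -- lifted to an endomorphism `τ` of the polynomial ring that is the identity modulo `J` and maps
  -- `J` into `J ^ 2`.
  let s : R →ₐ[k] (MvPolynomial σ k ⧸ J ^ 2) :=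
    Algebra.FormallySmooth.liftOfSurjective (AlgHom.id k R) q hq hnil
  have hs : ∀ r, q (s r) = r := fun r =>
    Algebra.FormallySmooth.liftOfSurjective_apply (AlgHom.id k R) q hq hnil r
  choose y hy using fun i : σ => Ideal.Quotient.mk_surjective (I := J ^ 2) (s (π (MvPolynomial.X i)))
  let τ : MvPolynomial σ k →ₐ[k] MvPolynomial σ k := MvPolynomial.aeval y
  have hτ : ∀ p, Ideal.Quotient.mk (J ^ 2) (τ p) = s (π p) := by
    intro p
    have : (Ideal.Quotient.mkₐ k (J ^ 2)).comp τ = s.comp π := by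
      refine MvPolynomial.algHom_ext fun i => ?_
      simpa [τ] using hy i
    exact DFunLike.congr_fun this p
  have hτJ : ∀ p, τ p - p ∈ J := by
    intro p
    rw [hJ, RingHom.mem_ker, map_sub, sub_eq_zero]
    have := hs (π p)
    rwa [← hτ, hqm] at this
  have hJI : J ≤ I := hker.trans (Ideal.pow_le_self two_ne_zero)
  -- `τ - id` behaves like a derivation with values in `J`, so on products of two elements of `I` it
  -- gains a factor in `I`.
  have h2 : ∀ p ∈ I ^ 2, τ p - p ∈ I * J := by
    intro p hp
    rw [pow_two] at hp
    induction hp using Submodule.mul_induction_on' with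
    | mem_mul_mem a ha b hb =>
      have hτb : τ b ∈ I := by
        have := I.add_mem (hJI (hτJ b)) hb
        rwa [sub_add_cancel] at this
      have : τ (a * b) - a * b = τ b * (τ a - a) + a * (τ b - b) := by rw [map_mul]; ring
      rw [this]
      exact Ideal.add_mem _ (Ideal.mul_mem_mul hτb (hτJ a)) (Ideal.mul_mem_mul ha (hτJ b))
    | add a _ b _ ha hb =>
      rw [map_add, add_sub_add_comm]
      exact Ideal.add_mem _ ha hb
  have hle : J ≤ I * J := by
    intro p hp
    have h3 : τ p ∈ J ^ 2 := by
      rw [← Ideal.Quotient.eq_zero_iff_mem, hτ, RingHom.mem_ker.1 hp, map_zero]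
    have h4 : τ p ∈ I * J := by
      rw [pow_two] at h3
      exact Ideal.mul_mono_left hJI h3
    -- Thus `J = I * J`. By Nakayama an element congruent to 1 modulo `I` kills `J`; it is nonzero
    -- and the polynomial ring is a domain, so `J = 0`.
    have := Ideal.sub_mem _ h4 (h2 p (hker hp))
    rwa [sub_sub_cancel] at this
  have hfg : J.FG := IsNoetherian.noetherian J
  obtain ⟨r, hr, h0⟩ := Submodule.exists_sub_one_mem_and_smul_eq_zero_of_fg_of_le_smul I J hfg hle
  have hr0 : r ≠ 0 := by
    rintro rfl
    rw [hI, RingHom.mem_ker] at hr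
    simp at hr
  rw [eq_bot_iff]
  intro p hp
  exact (mul_eq_zero.1 (h0 p hp)).resolve_left hr0

open AddMonoidAlgebra in
/-- If the algebra of a submonoid of `ℤⁿ` without nontrivial units is smooth, and the submonoid
generates `ℤⁿ`, then the submonoid is generated by a basis of `ℤⁿ`. -/
lemma exists_basis_of_smooth {k : Type*} [Field k] {n : ℕ} (S : AddSubmonoid (Fin n → ℤ))
    (hS : ∀ x ∈ S, -x ∈ S → x = 0) (hgen : ∀ m : Fin n → ℤ, ∃ a ∈ S, ∃ b ∈ S, m = a - b)
    [Algebra.Smooth k (AddMonoidAlgebra k S)] :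
    ∃ b : Module.Basis (Fin n) ℤ (Fin n → ℤ), ∀ m, m ∈ S ↔ ∀ i, 0 ≤ b.repr m i := by
  classical
  have hfg : AddMonoid.FG S := AddMonoidAlgebra.fg_of_finiteType (R := k)
  -- Take a generating set `G` of least cardinality. The aim is that the presentation of `S` by `G`
  -- has no relations.
  have hex : ∃ N, ∃ G : Finset S, G.card = N ∧ AddSubmonoid.closure (G : Set S) = ⊤ := by
    obtain ⟨G, hG⟩ := AddMonoid.fg_def.1 hfg
    exact ⟨_, G, rfl, hG⟩
  obtain ⟨G, hcard, hG⟩ := Nat.find_spec hex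
  have hmin : ∀ G' : Finset S, AddSubmonoid.closure (G' : Set S) = ⊤ → G.card ≤ G'.card :=
    fun G' h => hcard ▸ Nat.find_min' hex ⟨G', rfl, h⟩
  have hpos : ∀ x y : S, x + y = 0 → x = 0 := by
    intro x y h
    refine Subtype.ext (hS _ x.2 ?_)
    have h' : (x : Fin n → ℤ) + y = 0 := congrArg Subtype.val h
    rw [neg_eq_of_add_eq_zero_right h']
    exact y.2
  let φ : (G →₀ ℕ) →+ S :=
    Finsupp.liftAddHom fun g : G => (multiplesHom S (g : S))
  have hφ1 : ∀ (g : G), φ (Finsupp.single g 1) = g := fun g => by simp [φ]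
  have hφs : Function.Surjective φ := by
    rw [← AddMonoidHom.mrange_eq_top, eq_top_iff, ← hG, AddSubmonoid.closure_le]
    intro g hg
    exact ⟨Finsupp.single ⟨g, hg⟩ 1, hφ1 ⟨g, hg⟩⟩
  have hG0 : ∀ g ∈ G, ∀ G' : Finset S, G' = G.erase g → g ∉ AddSubmonoid.closure (G' : Set S) := by
    rintro g hg _ rfl h
    have := hmin (G.erase g) (by
      rw [eq_top_iff, ← hG, AddSubmonoid.closure_le]
      intro x hx
      by_cases hxg : x = g
      · exact hxg ▸ h
      · exact AddSubmonoid.subset_closure (by simpa [hxg] using hx))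
    rw [Finset.card_erase_of_mem hg] at this
    have := Finset.card_pos.2 ⟨g, hg⟩
    omega
  have hne : ∀ g : G, (g : S) ≠ 0 := fun g h =>
    hG0 g g.2 _ rfl (h ▸ AddSubmonoid.zero_mem _)
  have hzero : ∀ c, φ c = 0 → c = 0 := by
    intro c hc
    by_contra h0
    obtain ⟨g, hg⟩ := Finsupp.ne_iff.1 h0
    have hc' : c = Finsupp.single g 1 + (c - Finsupp.single g 1) := by
      rw [add_tsub_cancel_of_le]
      rw [Finsupp.single_le_iff]
      exact Nat.one_le_iff_ne_zero.2 hg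
    rw [hc', map_add, hφ1] at hc
    exact hne g (hpos _ _ hc)
  -- An expression of `g` without `g` contradicts minimality. In any other one `g` cancels, and the
  -- rest is 0 because `S` has no units.
  have hirr : ∀ (g : G) c, φ c = g → c = Finsupp.single g 1 := by
    intro g c hc
    by_cases hg : c g = 0
    · exfalso
      refine hG0 g g.2 _ rfl ?_
      have : φ c ∈ AddSubmonoid.closure ((G.erase (g : S) : Finset S) : Set S) := by
        have e : φ c = c.sum fun x r => r • (x : S) := by
          rw [Finsupp.liftAddHom_apply]
          rfl
        rw [e]
        refine AddSubmonoid.sum_mem _ fun x hx => AddSubmonoid.nsmul_mem _ ?_ _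
        refine AddSubmonoid.subset_closure ?_
        have : x ≠ g := fun h => (Finsupp.mem_support_iff.1 hx) (h ▸ hg)
        simp [this]
      rwa [hc] at this
    · have hc' : c = Finsupp.single g 1 + (c - Finsupp.single g 1) := by
        rw [add_tsub_cancel_of_le]
        rw [Finsupp.single_le_iff]
        exact Nat.one_le_iff_ne_zero.2 hg
      have h1 : φ (c - Finsupp.single g 1) = 0 := by
        rw [hc', map_add, hφ1] at hc
        exact add_eq_left.1 hc
      rw [hc', hzero _ h1, add_zero]
  let π : MvPolynomial G k →ₐ[k] AddMonoidAlgebra k S := AddMonoidAlgebra.mapDomainAlgHom k k φ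
  have hπm : ∀ c r, π (MvPolynomial.monomial c r) = single (φ c) r := fun c r =>
    AddMonoidAlgebra.mapDomain_single
  have hπs : Function.Surjective π := by
    intro f
    induction f using AddMonoidAlgebra.induction_linear with
    | zero => exact ⟨0, map_zero _⟩
    | add f g hf hg =>
      obtain ⟨a, rfl⟩ := hf
      obtain ⟨b, rfl⟩ := hg
      exact ⟨a + b, map_add _ _ _⟩
    | single m r =>
      obtain ⟨c, rfl⟩ := hφs m
      exact ⟨MvPolynomial.monomial c r, hπm c r⟩
  have hcoeff : ∀ (c : G →₀ ℕ), (∀ c', φ c' = φ c → c' = c) → ∀ p : MvPolynomial G k,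
      (π p).coeff (φ c) = p.coeff c := by
    intro c hc p
    induction p using MvPolynomial.induction_on' with
    | monomial d r =>
      rw [hπm, coeff_single, Finsupp.single_apply, MvPolynomial.coeff_monomial]
      by_cases h : d = c
      · simp [h]
      · rw [if_neg h, if_neg (fun h' => h (hc _ h'))]
    | add p q hp hq => rw [map_add, coeff_add, Finsupp.add_apply, hp, hq, MvPolynomial.coeff_add]
  -- 0 and the generators have a single expression each, so an element of the kernel has no constant
  -- and no linear term. This is the input of the tangent space argument.
  have hker : RingHom.ker π ≤ RingHom.ker (MvPolynomial.constantCoeff (R := k) (σ := G)) ^ 2 := by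
    intro p hp
    rw [RingHom.mem_ker] at hp
    have h0 : p.coeff 0 = 0 := by
      rw [← hcoeff 0 (fun c' h => hzero _ (by rw [h, map_zero])), hp]; rfl
    have h1 : ∀ g, p.coeff (Finsupp.single g 1) = 0 := by
      intro g
      rw [← hcoeff _ (fun c' h => hirr _ _ (by rw [h, hφ1])), hp]; rfl
    have hX : ∀ g : G, (MvPolynomial.X g : MvPolynomial G k) ∈
        RingHom.ker (MvPolynomial.constantCoeff (R := k) (σ := G)) := fun g => by
      simp [RingHom.mem_ker]
    rw [MvPolynomial.as_sum p]
    refine Ideal.sum_mem _ fun c hc => ?_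
    have hcp := MvPolynomial.mem_support_iff.1 hc
    obtain ⟨g, hg⟩ : ∃ g, c g ≠ 0 := by
      by_contra! h
      exact hcp (by rw [show c = 0 from Finsupp.ext h, h0])
    have e1 : c = Finsupp.single g 1 + (c - Finsupp.single g 1) := by
      rw [add_tsub_cancel_of_le]
      rw [Finsupp.single_le_iff]
      exact Nat.one_le_iff_ne_zero.2 hg
    obtain ⟨g', hg'⟩ : ∃ g' : G, (c - Finsupp.single g 1 : G →₀ ℕ) g' ≠ 0 := by
      by_contra! h
      rw [show c - Finsupp.single g 1 = 0 from Finsupp.ext h, add_zero] at e1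
      exact hcp (by rw [e1, h1])
    have e2 : c - Finsupp.single g 1 = Finsupp.single g' 1 +
        (c - Finsupp.single g 1 - Finsupp.single g' 1) := by
      rw [add_tsub_cancel_of_le]
      rw [Finsupp.single_le_iff]
      exact Nat.one_le_iff_ne_zero.2 hg'
    have e3 : MvPolynomial.monomial c (p.coeff c) = MvPolynomial.monomial
        (c - Finsupp.single g 1 - Finsupp.single g' 1) (p.coeff c) *
        (MvPolynomial.X g * MvPolynomial.X g') := by
      rw [MvPolynomial.X, MvPolynomial.X, MvPolynomial.monomial_mul, MvPolynomial.monomial_mul,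
        mul_one, mul_one]
      congr 2
      conv_lhs => rw [e1, e2]
      rw [← add_assoc]
      exact add_comm _ _
    rw [e3, pow_two]
    exact Ideal.mul_mem_left _ _ (Ideal.mul_mem_mul (hX g) (hX g'))
  have hinj : Function.Injective π := by
    have := ker_eq_bot_of_formallySmooth π hπs hker
    exact (RingHom.injective_iff_ker_eq_bot _).2 this
  have hφi : Function.Injective φ := by
    intro c d h
    have : MvPolynomial.monomial c (1 : k) = MvPolynomial.monomial d 1 :=
      hinj (by rw [hπm, hπm, h])
    exact (MvPolynomial.monomial_left_inj one_ne_zero).1 this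
  have hφc : ∀ c : G →₀ ℕ, (φ c : Fin n → ℤ) = ∑ g : G, (c g : ℤ) • ((g : S) : Fin n → ℤ) := by
    intro c
    have e : φ c = ∑ g : G, c g • (g : S) := by
      rw [Finsupp.liftAddHom_apply, Finsupp.sum_fintype]
      · rfl
      · exact fun _ => map_zero _
    rw [e]
    push_cast
    exact Finset.sum_congr rfl fun g _ => (natCast_zsmul _ _).symm
  -- An integral relation is split into its positive and negative parts, which have the same image
  -- under the injective `φ`.
  have hli : LinearIndependent ℤ (fun g : G => ((g : S) : Fin n → ℤ)) := by
    rw [Fintype.linearIndependent_iff]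
    intro c hc g
    let c1 : G →₀ ℕ := Finsupp.equivFunOnFinite.symm fun g => (c g).toNat
    let c2 : G →₀ ℕ := Finsupp.equivFunOnFinite.symm fun g => (-c g).toNat
    have h12 : φ c1 = φ c2 := by
      apply Subtype.ext
      rw [hφc, hφc, ← sub_eq_zero, ← Finset.sum_sub_distrib, ← hc]
      refine Finset.sum_congr rfl fun g _ => ?_
      rw [← sub_smul]
      congr 1
      exact Int.toNat_sub_toNat_neg (c g)
    have h3 : (c g).toNat = (-c g).toNat := DFunLike.congr_fun (hφi h12) g
    omega
  have hspan : ⊤ ≤ Submodule.span ℤ (Set.range fun g : G => ((g : S) : Fin n → ℤ)) := by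
    have hmem : ∀ a ∈ S, a ∈ Submodule.span ℤ (Set.range fun g : G => ((g : S) : Fin n → ℤ)) := by
      intro a ha
      obtain ⟨c, hc⟩ := hφs ⟨a, ha⟩
      rw [show a = φ c by rw [hc], hφc]
      exact Submodule.sum_mem _ fun g _ => Submodule.smul_mem _ _ (Submodule.subset_span ⟨g, rfl⟩)
    intro m _
    obtain ⟨a, ha, b, hb, rfl⟩ := hgen m
    exact Submodule.sub_mem _ (hmem a ha) (hmem b hb)
  let b0 := Module.Basis.mk hli hspan
  let e := b0.indexEquiv (Pi.basisFun ℤ (Fin n))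
  have hb0 : ∀ g, b0 g = ((g : S) : Fin n → ℤ) := fun g => Module.Basis.mk_apply hli hspan g
  refine ⟨b0.reindex e, fun m => ⟨fun hm i => ?_, fun h => ?_⟩⟩
  · obtain ⟨c, hc⟩ := hφs ⟨m, hm⟩
    have : m = ∑ g : G, (c g : ℤ) • b0 g := by
      simp only [hb0]
      rw [← hφc, hc]
    rw [this, Module.Basis.repr_reindex_apply, Module.Basis.repr_sum_self]
    exact Int.natCast_nonneg _
  · rw [← (b0.reindex e).sum_repr m]
    refine S.sum_mem fun i _ => ?_
    rw [Module.Basis.reindex_apply, hb0, ← Int.toNat_of_nonneg (h i), natCast_zsmul]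
    exact S.nsmul_mem (Subtype.property _) _

/-! ### Invertible fractional ideals of unique factorization domains -/

section Fractions

variable {R K : Type*} [CommRing R] [Field K] (ρ : R →+* K)

/-- The image of the local ring `R_𝔭` in a field `K`. -/
def localFractions (p : PrimeSpectrum R) : Set K :=
  {a | ∃ r s : R, s ∉ p.asIdeal ∧ a * ρ s = ρ r}

variable {ρ}

lemma mem_localFractions_of_mem_range {p : PrimeSpectrum R} {a : K} (h : a ∈ ρ.range) :
    a ∈ localFractions ρ p := by
  obtain ⟨r, rfl⟩ := h
  exact ⟨r, 1, p.isPrime.one_notMem, by simp⟩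

lemma localFractions_mul {p : PrimeSpectrum R} {a b : K}
    (ha : a ∈ localFractions ρ p)
    (hb : b ∈ localFractions ρ p) : a * b ∈ localFractions ρ p := by
  obtain ⟨r, s, hs, h⟩ := ha
  obtain ⟨r', s', hs', h'⟩ := hb
  refine ⟨r * r', s * s', p.isPrime.mul_notMem hs hs', ?_⟩
  rw [map_mul, map_mul, ← h, ← h']
  ring

/-- The denominators of `a` form an ideal. A prime that contains it but not `t` would be a point
where `a` is not a fraction, so `t` lies in its radical. For `t = 1` this says that everywhere
regular functions are global. -/
lemma mem_range_of_forall_localFractions {a : K} {t : R}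
    (h : ∀ p : PrimeSpectrum R, t ∉ p.asIdeal → a ∈ localFractions ρ p) :
    ∃ N : ℕ, a * ρ t ^ N ∈ ρ.range := by
  let I : Ideal R :=
    { carrier := {s | a * ρ s ∈ ρ.range}
      add_mem' := fun {x y} hx hy => by
        change a * ρ (x + y) ∈ ρ.range
        rw [map_add, mul_add]
        exact add_mem hx hy
      zero_mem' := by
        change a * ρ 0 ∈ ρ.range
        rw [map_zero, mul_zero]
        exact zero_mem _
      smul_mem' := fun c x hx => by
        change a * ρ (c • x) ∈ ρ.range
        rw [smul_eq_mul, map_mul, mul_left_comm]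
        exact mul_mem ⟨c, rfl⟩ hx }
  have : t ∈ I.radical := by
    rw [Ideal.radical_eq_sInf, Ideal.mem_sInf]
    rintro J ⟨hIJ, hJ⟩
    by_contra ht
    obtain ⟨r, s, hs, e⟩ := h ⟨J, hJ⟩ ht
    exact hs (hIJ ⟨r, e.symm⟩)
  obtain ⟨N, hN⟩ := this
  exact ⟨N, by rw [← map_pow]; exact hN⟩

/-- A finitely generated, locally principal fractional ideal of a UFD is principal: with a common
denominator, `f` is the gcd of the numerators divided by it. The cofactors `b j` then have gcd 1. If
`g l` generates at `p` and `b l` lay in `p`, a prime factor of `b l` in `p` would divide every `b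
j`. -/
lemma exists_gcd_generator [IsDomain R] [UniqueFactorizationMonoid R]
    (hρ : Function.Injective ρ) (hfrac : ∀ a : K, ∃ r s : R, s ≠ 0 ∧ a * ρ s = ρ r)
    {ι : Type*} [Finite ι] (g : ι → K)
    (hg : ∀ p : PrimeSpectrum R, ∃ l, g l ≠ 0 ∧ ∀ j, g j / g l ∈ localFractions ρ p) :
    ∃ f : K, f ≠ 0 ∧ (∀ j, g j / f ∈ ρ.range) ∧
      ∀ p : PrimeSpectrum R, ∃ l, g l ≠ 0 ∧ f / g l ∈ localFractions ρ p := by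
  classical
  have := Fintype.ofFinite ι
  let := UniqueFactorizationMonoid.strongNormalizationMonoid (α := R)
  let := UniqueFactorizationMonoid.toNormalizedGCDMonoid R
  choose r s hs hrs using fun j => hfrac (g j)
  have hd : ∏ j, s j ≠ 0 := Finset.prod_ne_zero_iff.2 fun j _ => hs j
  let a : ι → R := fun j => r j * ∏ i ∈ Finset.univ.erase j, s i
  have ha : ∀ j, g j * ρ (∏ i, s i) = ρ (a j) := by
    intro j
    rw [← Finset.mul_prod_erase _ _ (Finset.mem_univ j), map_mul, ← mul_assoc, hrs, ← map_mul]
  have hne : (Finset.univ : Finset ι).Nonempty := by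
    obtain ⟨l, -⟩ := hg ⟨⊥, Ideal.isPrime_bot⟩
    exact ⟨l, Finset.mem_univ l⟩
  obtain ⟨b, hb, hb1⟩ := Finset.extract_gcd a hne
  have hρd : ρ (∏ i, s i) ≠ 0 := (map_ne_zero_iff ρ hρ).2 hd
  have hgcd : Finset.univ.gcd a ≠ 0 := by
    intro h0
    obtain ⟨l, hl, -⟩ := hg ⟨⊥, Ideal.isPrime_bot⟩
    have := ha l
    rw [hb l (Finset.mem_univ l), h0, zero_mul, map_zero] at this
    exact mul_ne_zero hl hρd this
  have hρg : ρ (Finset.univ.gcd a) ≠ 0 := (map_ne_zero_iff ρ hρ).2 hgcd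
  have hgb : ∀ j, g j = ρ (b j) * (ρ (Finset.univ.gcd a) / ρ (∏ i, s i)) := by
    intro j
    rw [eq_comm, mul_div_assoc', div_eq_iff hρd, ha, hb j (Finset.mem_univ j), map_mul, mul_comm]
  refine ⟨ρ (Finset.univ.gcd a) / ρ (∏ i, s i), div_ne_zero hρg hρd, fun j => ⟨b j, ?_⟩,
    fun p => ?_⟩
  · rw [hgb j, mul_div_cancel_right₀ _ (div_ne_zero hρg hρd)]
  · obtain ⟨l, hl, h⟩ := hg p
    refine ⟨l, hl, 1, b l, ?_, ?_⟩
    · intro hbl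
      have hbl0 : b l ≠ 0 := by
        intro h0
        rw [hgb l, h0, map_zero, zero_mul] at hl
        exact hl rfl
      obtain ⟨q, hq, hqp⟩ : ∃ q, Prime q ∧ q ∣ b l ∧ q ∈ p.asIdeal := by
        have hprod := UniqueFactorizationMonoid.factors_prod hbl0
        have : (UniqueFactorizationMonoid.factors (b l)).prod ∈ p.asIdeal := by
          obtain ⟨u, hu⟩ := hprod
          have h1 : (UniqueFactorizationMonoid.factors (b l)).prod * u ∈ p.asIdeal := by
            rw [hu]; exact hbl
          exact (p.isPrime.mem_or_mem h1).resolve_right fun h2 =>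
            p.isPrime.ne_top (Ideal.eq_top_of_isUnit_mem _ h2 u.isUnit)
        obtain ⟨q, hq, hqp⟩ := (Ideal.IsPrime.multiset_prod_mem_iff_exists_mem p.isPrime _).1 this
        exact ⟨q, UniqueFactorizationMonoid.prime_of_factor q hq,
          (Multiset.dvd_prod hq).trans hprod.dvd, hqp⟩
      have hall : ∀ j ∈ Finset.univ, q ∣ b j := by
        intro j _
        obtain ⟨r', s', hs', e⟩ := h j
        have e' : b j * s' = r' * b l := by
          apply hρ
          have hbl' : ρ (b l) ≠ 0 := (map_ne_zero_iff ρ hρ).2 hbl0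
          rw [hgb j, hgb l, mul_div_mul_right _ _ (div_ne_zero hρg hρd), div_mul_eq_mul_div,
            div_eq_iff hbl'] at e
          rw [map_mul, map_mul, e]
        have : q ∣ b j * s' := e' ▸ dvd_mul_of_dvd_right hqp.1 r'
        exact (hq.dvd_or_dvd this).resolve_right fun h2 =>
          hs' (Ideal.mem_of_dvd _ h2 hqp.2)
      have := Finset.dvd_gcd hall
      rw [hb1] at this
      exact hq.not_isUnit (isUnit_of_dvd_one this)
    · rw [map_one, div_mul_eq_mul_div, div_eq_iff hl, one_mul, hgb l, mul_comm]

/-- A Cartier divisor on the spectrum of a unique factorization domain is principal. Here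
`E p f` says that the divisor is given by `f` at `p`. -/
lemma exists_global_generator [IsDomain R] [UniqueFactorizationMonoid R]
    (hρ : Function.Injective ρ) (hfrac : ∀ a : K, ∃ r s : R, s ≠ 0 ∧ a * ρ s = ρ r)
    (E : PrimeSpectrum R → K → Prop)
    (hE : ∀ p f g, f ≠ 0 → g ≠ 0 → E p f → (E p g ↔ f / g ∈ localFractions ρ p ∧
      g / f ∈ localFractions ρ p))
    (hloc : ∀ p : PrimeSpectrum R, ∃ s ∉ p.asIdeal, ∃ f ≠ 0, ∀ q : PrimeSpectrum R,
      s ∉ q.asIdeal → E q f) :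
    ∃ f ≠ 0, ∀ p, E p f := by
  classical
  choose s hs f hf0 hf using hloc
  have hspan : Ideal.span (Set.range s) = ⊤ := by
    by_contra h
    obtain ⟨m, hm, hle⟩ := Ideal.exists_le_maximal _ h
    exact hs ⟨m, hm.isPrime⟩ (hle (Ideal.subset_span ⟨_, rfl⟩))
  -- Quasi-compactness: finitely many basic open sets, each with a local equation, suffice.
  obtain ⟨T, hT⟩ : ∃ T : Finset (PrimeSpectrum R), Ideal.span (s '' T) = ⊤ := by
    obtain ⟨T', hT', h⟩ := (Ideal.span_eq_top_iff_finite _).1 hspan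
    obtain ⟨T, -, hT⟩ := Finset.subset_set_image_iff.1 (by simpa using hT' : (T' : Set R) ⊆ s '' Set.univ)
    refine ⟨T, ?_⟩
    rw [← hT, Finset.coe_image] at h
    exact h
  have hcov : ∀ p : PrimeSpectrum R, ∃ i : T, s i ∉ p.asIdeal := by
    intro p
    by_contra! h
    refine p.isPrime.ne_top (top_le_iff.1 (hT ▸ Ideal.span_le.2 ?_))
    rintro _ ⟨i, hi, rfl⟩
    exact h ⟨i, hi⟩
  have hmulne : ∀ i : T, s i ≠ 0 := fun i h => hs i (h ▸ Ideal.zero_mem _)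
  have hN : ∀ i j : T, ∃ N : ℕ, f j / f i * ρ (s i * s j) ^ N ∈ ρ.range := by
    intro i j
    refine mem_range_of_forall_localFractions fun p hp => ?_
    have h1 : s i ∉ p.asIdeal := fun h => hp (Ideal.mul_mem_right _ _ h)
    have h2 : s j ∉ p.asIdeal := fun h => hp (Ideal.mul_mem_left _ _ h)
    exact ((hE p (f i) (f j) (hf0 i) (hf0 j) (hf i p h1)).1 (hf j p h2)).2
  choose N hN using hN
  obtain ⟨n, hn⟩ : ∃ n, ∀ i j, N i j ≤ n := by
    refine ⟨Finset.univ.sup fun x : T × T => N x.1 x.2, fun i j => ?_⟩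
    exact Finset.le_sup (f := fun x : T × T => N x.1 x.2) (Finset.mem_univ (i, j))
  -- A large power of `s j` removes the poles of `f j / f i` on `s i ≠ 0`. Hence the `g j` generate
  -- the fractional ideal of the divisor, with `g i` a generator wherever `s i ≠ 0`.
  let g : T → K := fun j => f j * ρ (s j) ^ n
  have hg0 : ∀ j, g j ≠ 0 := fun j =>
    mul_ne_zero (hf0 j) (pow_ne_zero _ ((map_ne_zero_iff ρ hρ).2 (hmulne j)))
  have hgi : ∀ (p : PrimeSpectrum R) (i : T), s i ∉ p.asIdeal → ∀ j,
      g j / g i ∈ localFractions ρ p := by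
    intro p i hi j
    obtain ⟨r, hr⟩ := hN i j
    refine ⟨r * (s i * s j) ^ (n - N i j), s i ^ (n + n), fun h =>
      hi (p.isPrime.mem_of_pow_mem _ h), ?_⟩
    have h1 : ρ (s i) ≠ 0 := (map_ne_zero_iff ρ hρ).2 (hmulne i)
    rw [map_mul, hr, map_pow, map_pow, mul_assoc, ← pow_add, Nat.add_sub_cancel' (hn i j)]
    simp only [g, map_mul]
    field_simp [hf0 i]
    ring
  obtain ⟨F, hF0, hF, hF'⟩ := exists_gcd_generator hρ hfrac g fun p => by
    obtain ⟨i, hi⟩ := hcov p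
    exact ⟨i, hg0 i, hgi p i hi⟩
  refine ⟨F, hF0, fun p => ?_⟩
  obtain ⟨i, hi⟩ := hcov p
  obtain ⟨l, -, hl⟩ := hF' p
  rw [hE p (f i) F (hf0 i) hF0 (hf i p hi)]
  have h1 : ρ (s i) ≠ 0 := (map_ne_zero_iff ρ hρ).2 (hmulne i)
  have e1 : f i = g i / ρ (s i) ^ n := by
    simp only [g]; field_simp
  constructor
  · obtain ⟨r, hr⟩ := hF i
    refine ⟨r, s i ^ n, fun h => hi (p.isPrime.mem_of_pow_mem _ h), ?_⟩
    rw [hr, e1, map_pow]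
    field_simp
  · have h2 := localFractions_mul hl (hgi p i hi l)
    rw [div_mul_div_cancel₀ (hg0 l)] at h2
    have h3 : ρ (s i) ^ n ∈ localFractions ρ p :=
      mem_localFractions_of_mem_range ⟨s i ^ n, map_pow _ _ _⟩
    have := localFractions_mul h2 h3
    rw [e1]
    convert this using 1
    field_simp

end Fractions

/-! ### Affine spaces as partial compactifications of a torus -/

section Poly

variable (k : Type u) [Field k] {n : ℕ} (b : Module.Basis (Fin n) ℤ (Fin n → ℤ))

/-- The inclusion `ℕⁿ → ℤⁿ` given by a basis of `ℤⁿ`. -/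
def expHom : (Fin n →₀ ℕ) →+ (Fin n → ℤ) :=
  b.repr.symm.toAddEquiv.toAddMonoidHom.comp
    (Finsupp.mapRange.addMonoidHom (Nat.castAddMonoidHom ℤ))

lemma repr_expHom (c : Fin n →₀ ℕ) (i : Fin n) : b.repr (expHom b c) i = c i := by
  simp [expHom]

lemma expHom_injective : Function.Injective (expHom b) := by
  intro c d h
  ext i
  have := congrArg (fun m => b.repr m i) h
  simpa [repr_expHom] using this

lemma expHom_single (i : Fin n) : expHom b (Finsupp.single i 1) = b i := by
  apply b.repr.injective
  ext j
  rw [repr_expHom, Module.Basis.repr_self, Finsupp.single_apply, Finsupp.single_apply]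
  split_ifs <;> rfl

lemma exists_expHom {m : Fin n → ℤ} (h : ∀ i, 0 ≤ b.repr m i) : ∃ c, expHom b c = m := by
  refine ⟨Finsupp.equivFunOnFinite.symm fun i => (b.repr m i).toNat, ?_⟩
  apply b.repr.injective
  ext i
  rw [repr_expHom]
  exact Int.toNat_of_nonneg (h i)

lemma exists_sub_expHom (m : Fin n → ℤ) : ∃ c d, m = expHom b c - expHom b d ∧
    (∀ i, 0 ≤ b.repr m i → d i = 0) ∧ (∀ i, b.repr m i < 0 → c i = 0 ∧ d i ≠ 0) := by
  refine ⟨Finsupp.equivFunOnFinite.symm fun i => (b.repr m i).toNat,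
    Finsupp.equivFunOnFinite.symm fun i => (-b.repr m i).toNat, ?_, fun i h => ?_, fun i h => ?_⟩
  · apply b.repr.injective
    ext i
    rw [map_sub, Finsupp.sub_apply, repr_expHom, repr_expHom]
    exact (Int.toNat_sub_toNat_neg _).symm
  · simp [h]
  · simp [h, h.le]

/-- The inclusion of a polynomial ring into the Laurent polynomial ring, given by a basis of the
group of exponents. -/
def polyToTorus : MvPolynomial (Fin n) k →ₐ[k] AddMonoidAlgebra k (Fin n → ℤ) :=
  AddMonoidAlgebra.mapDomainAlgHom k k (expHom b)

lemma polyToTorus_monomial (c : Fin n →₀ ℕ) (r : k) :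
    polyToTorus k b (MvPolynomial.monomial c r) = AddMonoidAlgebra.single (expHom b c) r :=
  AddMonoidAlgebra.mapDomain_single

lemma polyToTorus_X (i : Fin n) :
    polyToTorus k b (MvPolynomial.X i) = AddMonoidAlgebra.single (b i) 1 := by
  rw [MvPolynomial.X, polyToTorus_monomial, expHom_single]

lemma polyToTorus_injective : Function.Injective (polyToTorus k b) :=
  AddMonoidAlgebra.mapDomain_injective (expHom_injective b)

lemma coeff_polyToTorus (f : MvPolynomial (Fin n) k) (c : Fin n →₀ ℕ) :
    (polyToTorus k b f).coeff (expHom b c) = f.coeff c := by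
  classical
  induction f using MvPolynomial.induction_on' with
  | monomial d r =>
    rw [polyToTorus_monomial, AddMonoidAlgebra.coeff_single, MvPolynomial.coeff_monomial]
    by_cases h : d = c
    · rw [h, Finsupp.single_eq_same, if_pos rfl]
    · rw [if_neg h, Finsupp.single_eq_of_ne fun e => h (expHom_injective b e.symm)]
  | add p q hp hq =>
    rw [map_add, AddMonoidAlgebra.coeff_add, Finsupp.add_apply, hp, hq, MvPolynomial.coeff_add]

lemma coeff_polyToTorus_eq_zero (f : MvPolynomial (Fin n) k) {m : Fin n → ℤ} {i : Fin n}
    (h : b.repr m i < 0) : (polyToTorus k b f).coeff m = 0 := by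
  classical
  induction f using MvPolynomial.induction_on' with
  | monomial d r =>
    rw [polyToTorus_monomial, AddMonoidAlgebra.coeff_single, Finsupp.single_apply, if_neg]
    rintro rfl
    rw [repr_expHom] at h
    exact absurd h (not_lt.2 (Int.natCast_nonneg _))
  | add p q hp hq => rw [map_add, AddMonoidAlgebra.coeff_add, Finsupp.add_apply, hp, hq, add_zero]

lemma exists_mul_mem_range_polyToTorus (a : AddMonoidAlgebra k (Fin n → ℤ)) :
    ∃ c f, a * AddMonoidAlgebra.single (expHom b c) 1 = polyToTorus k b f := by
  induction a using AddMonoidAlgebra.induction_linear with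
  | zero => exact ⟨0, 0, by simp⟩
  | add f g hf hg =>
    obtain ⟨c, f', hf⟩ := hf
    obtain ⟨d, g', hg⟩ := hg
    refine ⟨c + d, f' * MvPolynomial.monomial d 1 + g' * MvPolynomial.monomial c 1, ?_⟩
    rw [map_add (polyToTorus k b), map_mul (polyToTorus k b), map_mul (polyToTorus k b), ← hf, ← hg,
      polyToTorus_monomial, polyToTorus_monomial, mul_assoc, mul_assoc,
      AddMonoidAlgebra.single_mul_single, AddMonoidAlgebra.single_mul_single,
      mul_one, map_add (expHom b), add_comm (expHom b d), add_mul]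
  | single m r =>
    obtain ⟨c, d, hm, -⟩ := exists_sub_expHom b m
    refine ⟨d, MvPolynomial.monomial c r, ?_⟩
    rw [polyToTorus_monomial, AddMonoidAlgebra.single_mul_single, mul_one, hm, sub_add_cancel]

variable {k} {K : Type*} [Field K] {ι : AddMonoidAlgebra k (Fin n → ℤ) →+* K}

/-- The monomial `χ^m`, in a field that contains the Laurent polynomial ring. -/
def chi (ι : AddMonoidAlgebra k (Fin n → ℤ) →+* K) (m : Fin n → ℤ) : K :=
  ι (AddMonoidAlgebra.single m 1)

lemma chi_add (m m' : Fin n → ℤ) : chi ι (m + m') = chi ι m * chi ι m' := by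
  rw [chi, chi, chi, ← map_mul, AddMonoidAlgebra.single_mul_single, mul_one]

lemma chi_zero : chi ι 0 = 1 := by
  rw [chi, ← AddMonoidAlgebra.one_def, map_one]

lemma chi_ne_zero (m : Fin n → ℤ) : chi ι m ≠ 0 := by
  intro h
  have := chi_add (ι := ι) m (-m)
  rw [add_neg_cancel, chi_zero, h, zero_mul] at this
  exact one_ne_zero this

lemma chi_sub (m m' : Fin n → ℤ) : chi ι (m - m') = chi ι m / chi ι m' := by
  rw [eq_div_iff (chi_ne_zero m'), ← chi_add, sub_add_cancel]

variable (ι)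

/-- The inclusion of a polynomial ring into a field that contains the Laurent polynomial ring. -/
def polyToField : MvPolynomial (Fin n) k →+* K := ι.comp (polyToTorus k b : _ →+* _)

variable {ι}

lemma polyToField_apply (f : MvPolynomial (Fin n) k) :
    polyToField b ι f = ι (polyToTorus k b f) := rfl

lemma polyToField_monomial_one (c : Fin n →₀ ℕ) :
    polyToField b ι (MvPolynomial.monomial c 1) = chi ι (expHom b c) := by
  rw [polyToField_apply, polyToTorus_monomial, chi]

lemma polyToField_injective (hι : Function.Injective ι) :
    Function.Injective (polyToField b ι) := hι.comp (polyToTorus_injective k b)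

lemma polyToField_exists_frac (hfrac : ∀ a : K, ∃ r s, s ≠ 0 ∧ a * ι s = ι r) (a : K) :
    ∃ r s, s ≠ 0 ∧ a * polyToField b ι s = polyToField b ι r := by
  obtain ⟨r, s, hs, h⟩ := hfrac a
  obtain ⟨c, f, hf⟩ := exists_mul_mem_range_polyToTorus k b r
  obtain ⟨d, g, hg⟩ := exists_mul_mem_range_polyToTorus k b s
  refine ⟨f * MvPolynomial.monomial d 1, g * MvPolynomial.monomial c 1, ?_, ?_⟩
  · refine mul_ne_zero ?_ (by simp)
    rintro rfl
    rw [map_zero] at hg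
    exact mul_ne_zero hs (by simp) hg
  · have e1 : polyToField b ι f = ι r * chi ι (expHom b c) := by
      rw [polyToField_apply, ← hf, map_mul, chi]
    have e2 : polyToField b ι g = ι s * chi ι (expHom b d) := by
      rw [polyToField_apply, ← hg, map_mul, chi]
    rw [map_mul (polyToField b ι), map_mul (polyToField b ι), e1, e2, polyToField_monomial_one,
      polyToField_monomial_one, ← h]
    ring

lemma X_dvd_monomial_iff {c : Fin n →₀ ℕ} {i : Fin n} :
    (MvPolynomial.X i : MvPolynomial (Fin n) k) ∣ MvPolynomial.monomial c 1 ↔ c i ≠ 0 := by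
  rw [MvPolynomial.X_dvd_monomial]
  simp

lemma monomial_notMem {p : PrimeSpectrum (MvPolynomial (Fin n) k)} {c : Fin n →₀ ℕ}
    (h : ∀ i, MvPolynomial.X i ∈ p.asIdeal → c i = 0) :
    MvPolynomial.monomial c (1 : k) ∉ p.asIdeal := by
  intro hc
  rw [MvPolynomial.monomial_eq, map_one, one_mul, Finsupp.prod_fintype _ _ (fun _ => pow_zero _),
    p.isPrime.prod_mem_iff] at hc
  obtain ⟨i, -, hi⟩ := hc
  by_cases h0 : c i = 0
  · rw [h0, pow_zero] at hi
    exact p.isPrime.one_notMem hi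
  · exact h0 (h i (p.isPrime.mem_of_pow_mem _ hi))

/-- The monomials that are regular at a point of affine space. -/
lemma chi_mem_localFractions (hι : Function.Injective ι)
    (p : PrimeSpectrum (MvPolynomial (Fin n) k)) (m : Fin n → ℤ) :
    chi ι m ∈ localFractions (polyToField b ι) p ↔
      ∀ i, MvPolynomial.X i ∈ p.asIdeal → 0 ≤ b.repr m i := by
  obtain ⟨c, d, hm, hd, hcd⟩ := exists_sub_expHom b m
  constructor
  · rintro ⟨r, s, hs, h⟩ i hi
    by_contra! hneg
    have hX : Prime (MvPolynomial.X i : MvPolynomial (Fin n) k) := MvPolynomial.X_prime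
    have e : s * MvPolynomial.monomial c 1 = r * MvPolynomial.monomial d 1 := by
      apply polyToField_injective b hι
      rw [map_mul, map_mul, polyToField_monomial_one, polyToField_monomial_one, ← h, hm, chi_sub,
        div_mul_eq_mul_div, div_mul_cancel₀ _ (chi_ne_zero _), mul_comm]
    have h1 : MvPolynomial.X i ∣ s * MvPolynomial.monomial c (1 : k) := by
      rw [e]
      exact dvd_mul_of_dvd_right (X_dvd_monomial_iff.2 (hcd i hneg).2) _
    rcases hX.dvd_or_dvd h1 with h2 | h2
    · exact hs (Ideal.mem_of_dvd _ h2 hi)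
    · exact X_dvd_monomial_iff.1 h2 (hcd i hneg).1
  · intro h
    refine ⟨MvPolynomial.monomial c 1, MvPolynomial.monomial d 1,
      monomial_notMem fun i hi => hd i (h i hi), ?_⟩
    rw [polyToField_monomial_one, polyToField_monomial_one, hm, chi_sub,
      div_mul_cancel₀ _ (chi_ne_zero _)]

/-- If the monomials that are regular at a point of affine space form a half space, then the point
is the generic point of a coordinate hyperplane. -/
lemma exists_dual_eq (hι : Function.Injective ι)
    (p : PrimeSpectrum (MvPolynomial (Fin n) k)) (u : (Fin n → ℤ) →+ ℤ)
    (hu : ∃ m, u m = 1)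
    (h : ∀ m, chi ι m ∈ localFractions (polyToField b ι) p ↔ 0 ≤ u m) :
    ∃ i, ∀ m, b.repr m i = u m := by
  simp only [chi_mem_localFractions b hι] at h
  have hrepr : ∀ i j, b.repr (b i) j = if i = j then 1 else 0 := fun i j => by
    rw [Module.Basis.repr_self, Finsupp.single_apply]
  have hnn : ∀ i, 0 ≤ u (b i) := fun i => (h (b i)).1 fun j _ => by
    rw [hrepr]; split_ifs <;> norm_num
  have hiff : ∀ i, MvPolynomial.X i ∈ p.asIdeal ↔ 0 < u (b i) := by
    intro i
    rw [← not_iff_not, not_lt]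
    have := h (-(b i))
    rw [map_neg u, neg_nonneg] at this
    rw [← this]
    constructor
    · intro hi j hj
      rw [map_neg, Finsupp.neg_apply, hrepr, if_neg, neg_zero]
      rintro rfl
      exact hi hj
    · intro h' hi
      have := h' i hi
      rw [map_neg, Finsupp.neg_apply, hrepr, if_pos rfl] at this
      norm_num at this
  have hsum : ∀ m, u m = ∑ i, b.repr m i * u (b i) := by
    intro m
    conv_lhs => rw [← b.sum_repr m]
    rw [map_sum]
    exact Finset.sum_congr rfl fun i _ => by rw [map_zsmul, smul_eq_mul]
  obtain ⟨m0, hm0⟩ := hu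
  obtain ⟨i, hi⟩ : ∃ i, 0 < u (b i) := by
    by_contra! hall
    rw [hsum] at hm0
    rw [Finset.sum_eq_zero] at hm0
    · norm_num at hm0
    · intro i _
      rw [le_antisymm (hall i) (hnn i), mul_zero]
  have huniq : ∀ j, j ≠ i → u (b j) = 0 := by
    intro j hji
    by_contra hj
    have hj' : 0 < u (b j) := lt_of_le_of_ne (hnn j) (Ne.symm hj)
    -- If `u` were positive on both `b i` and `b j`, this vector would have `u = 0`, yet its
    -- monomial has a pole along `X j = 0`, which contains the point.
    have := (h (u (b j) • b i - u (b i) • b j)).2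
      (by rw [map_sub, map_zsmul, map_zsmul, smul_eq_mul, smul_eq_mul]; nlinarith) j
      ((hiff j).2 hj')
    rw [map_sub, map_smul, map_smul, Finsupp.sub_apply, Finsupp.smul_apply, Finsupp.smul_apply,
      hrepr, hrepr, if_neg hji.symm, if_pos rfl] at this
    simp at this
    omega
  have hsum' : ∀ m, u m = b.repr m i * u (b i) := by
    intro m
    rw [hsum, Finset.sum_eq_single i]
    · intro j _ hj
      rw [huniq j hj, mul_zero]
    · simp
  -- The functional is primitive, since it takes the value 1.
  have h1 : u (b i) = 1 := by
    have := hsum' m0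
    rw [hm0] at this
    exact Int.eq_one_of_dvd_one (hnn i) ⟨_, this.trans (mul_comm _ _)⟩
  exact ⟨i, fun m => by rw [hsum', h1, mul_one]⟩

end Poly

/-! ### Local rings as subrings of a field -/

section LocalRing

/-- A field-valued point is generic if its image specializes to every point. -/
class IsGeneric {X : Scheme.{u}} {K : Type u} [Field K] (γ : Spec (.of K) ⟶ X) : Prop where
  specializes : ∀ x, γ (IsLocalRing.closedPoint K) ⤳ x

variable {X Y : Scheme.{u}} {K : Type u} [Field K]

/-- The evaluation of a germ at a generic field-valued point. -/
def localHom (γ : Spec (.of K) ⟶ X) [IsGeneric γ] (x : X) : X.presheaf.stalk x ⟶ .of K :=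
  X.presheaf.stalkSpecializes (IsGeneric.specializes x) ≫ Scheme.stalkClosedPointTo (R := .of K) γ

/-- The image of a local ring of a scheme in a field `K`, at a generic `K`-valued point. -/
def localRing (γ : Spec (.of K) ⟶ X) [IsGeneric γ] (x : X) : Subring K :=
  (localHom γ x).hom.range

lemma mem_localRing {γ : Spec (.of K) ⟶ X} [IsGeneric γ] {x : X} {a : K} :
    a ∈ localRing γ x ↔ ∃ s, (localHom γ x).hom s = a := Iff.rfl

lemma localHom_comp (γ : Spec (.of K) ⟶ X) [IsGeneric γ] (e : X ⟶ Y) [IsGeneric (γ ≫ e)] (x : X) :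
    localHom (γ ≫ e) (e x) = e.stalkMap x ≫ localHom γ x := by
  calc
    _ = Y.presheaf.stalkSpecializes (IsGeneric.specializes (γ := γ ≫ e) (e x)) ≫
          (e.stalkMap _ ≫ Scheme.stalkClosedPointTo (R := .of K) γ) :=
        congrArg _ (Scheme.stalkClosedPointTo_comp (R := .of K) γ e)
    _ = (Y.presheaf.stalkSpecializes (e.base.hom.map_specializes (IsGeneric.specializes x)) ≫
          e.stalkMap _) ≫ Scheme.stalkClosedPointTo (R := .of K) γ := (Category.assoc _ _ _).symm
    _ = (e.stalkMap x ≫ X.presheaf.stalkSpecializes (IsGeneric.specializes x)) ≫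
          Scheme.stalkClosedPointTo (R := .of K) γ :=
        congrArg (· ≫ Scheme.stalkClosedPointTo (R := .of K) γ)
          (Scheme.Hom.stalkSpecializes_stalkMap e _ _ (IsGeneric.specializes x))
    _ = _ := Category.assoc _ _ _

lemma localRing_comp (γ : Spec (.of K) ⟶ X) [IsGeneric γ] (e : X ⟶ Y) [IsOpenImmersion e]
    [IsGeneric (γ ≫ e)] (x : X) : localRing (γ ≫ e) (e x) = localRing γ x := by
  ext a
  rw [mem_localRing, mem_localRing, localHom_comp]
  constructor
  · rintro ⟨s, rfl⟩
    exact ⟨_, rfl⟩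
  · rintro ⟨s, rfl⟩
    obtain ⟨s, rfl⟩ := (ConcreteCategory.bijective_of_isIso (e.stalkMap x)).2 s
    exact ⟨s, rfl⟩

lemma IsGeneric.of_comp (γ : Spec (.of K) ⟶ X) (e : X ⟶ Y) [IsOpenImmersion e]
    [h : IsGeneric (γ ≫ e)] : IsGeneric γ :=
  ⟨fun x => e.isOpenEmbedding.isInducing.specializes_iff.1 (h.specializes (e x))⟩

/-- A prime ideal, as a point of the spectrum. -/
def specPt {R : Type u} [CommRing R] (p : PrimeSpectrum R) : Spec (.of R) := p

lemma exists_specPt {R : Type u} [CommRing R] (x : Spec (.of R)) : ∃ p, specPt p = x := ⟨x, rfl⟩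

/-- The localization map from a ring to a local ring of its spectrum. -/
def specStalk (R : Type u) [CommRing R] (p : PrimeSpectrum R) :
    CommRingCat.of R ⟶ (Spec (.of R)).presheaf.stalk (specPt p) :=
  (Scheme.ΓSpecIso (.of R)).inv ≫ (Spec (.of R)).presheaf.germ ⊤ (specPt p) trivial

lemma specStalk_surj {R : Type u} [CommRing R] (p : PrimeSpectrum R)
    (z : (Spec (.of R)).presheaf.stalk (specPt p)) :
    ∃ r s, s ∉ p.asIdeal ∧ z * (specStalk R p).hom s = (specStalk R p).hom r := by
  have h : IsLocalization p.asIdeal.primeCompl ((Spec.structureSheaf R).presheaf.stalk p) :=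
    StructureSheaf.IsLocalization.to_stalk R p
  obtain ⟨⟨r, s⟩, h⟩ := IsLocalization.surj (S := (Spec.structureSheaf R).presheaf.stalk p)
    p.asIdeal.primeCompl z
  exact ⟨r, s, s.2, h⟩

lemma specStalk_isUnit {R : Type u} [CommRing R] (p : PrimeSpectrum R) {s : R}
    (hs : s ∉ p.asIdeal) : IsUnit ((specStalk R p).hom s) := by
  have h : IsLocalization p.asIdeal.primeCompl ((Spec.structureSheaf R).presheaf.stalk p) :=
    StructureSheaf.IsLocalization.to_stalk R p
  exact IsLocalization.map_units ((Spec.structureSheaf R).presheaf.stalk p)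
    (⟨s, hs⟩ : p.asIdeal.primeCompl)

lemma localHom_specStalk {R : Type u} [CommRing R] (ρ : R →+* K)
    [IsGeneric (Spec.map (CommRingCat.ofHom ρ))] (p : PrimeSpectrum R) (r : R) :
    (localHom (Spec.map (CommRingCat.ofHom ρ)) (specPt p)).hom ((specStalk R p).hom r) = ρ r := by
  have h2 : (Spec (.of R)).presheaf.germ ⊤ (specPt p) trivial ≫
      localHom (Spec.map (CommRingCat.ofHom ρ)) (specPt p) = (Scheme.ΓSpecIso (.of R)).hom ≫
        CommRingCat.ofHom ρ := by
    refine Eq.trans ?_ (Scheme.germ_stalkClosedPointTo_Spec (S := .of K) (CommRingCat.ofHom ρ))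
    exact TopCat.Presheaf.germ_stalkSpecializes_assoc _ _ _ _
  have h3 : specStalk R p ≫ localHom (Spec.map (CommRingCat.ofHom ρ)) (specPt p) =
      CommRingCat.ofHom ρ := by
    rw [specStalk]
    exact (Category.assoc _ _ _).trans ((congrArg _ h2).trans (Iso.inv_hom_id_assoc _ _))
  exact congrArg (fun f => f.hom r) h3

lemma mem_localRing_Spec {R : Type u} [CommRing R] (ρ : R →+* K)
    [IsGeneric (Spec.map (CommRingCat.ofHom ρ))] (p : PrimeSpectrum R) (a : K) :
    a ∈ localRing (Spec.map (CommRingCat.ofHom ρ)) (specPt p) ↔ a ∈ localFractions ρ p := by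
  rw [mem_localRing]
  constructor
  · rintro ⟨z, rfl⟩
    obtain ⟨r, s, hs, h⟩ := specStalk_surj p z
    refine ⟨r, s, hs, ?_⟩
    rw [← localHom_specStalk ρ p, ← localHom_specStalk ρ p, ← map_mul, h]
  · rintro ⟨r, s, hs, h⟩
    obtain ⟨t, ht⟩ := (specStalk_isUnit p hs).exists_right_inv
    have h1 := congrArg (localHom (Spec.map (CommRingCat.ofHom ρ)) (specPt p)).hom ht
    rw [map_mul, localHom_specStalk, map_one] at h1
    refine ⟨(specStalk R p).hom r * t, ?_⟩
    rw [map_mul, localHom_specStalk, ← h, mul_assoc, h1, mul_one]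

/-- An open immersion does not change local rings, so questions about points of `X` become questions
about fractions inside `K`. -/
lemma mem_localRing_chart {R : Type u} [CommRing R] (ρ : R →+* K) (e : Spec (.of R) ⟶ X)
    [IsOpenImmersion e] (γ : Spec (.of K) ⟶ X) [hg : IsGeneric γ]
    (h : Spec.map (CommRingCat.ofHom ρ) ≫ e = γ) (p : PrimeSpectrum R) (a : K) :
    a ∈ localRing γ (e (specPt p)) ↔ a ∈ localFractions ρ p := by
  subst h
  have := IsGeneric.of_comp (Spec.map (CommRingCat.ofHom ρ)) e
  rw [localRing_comp, mem_localRing_Spec]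

lemma localHom_fromSpecStalk (γ : Spec (.of K) ⟶ X) [IsGeneric γ] (x : X) :
    Spec.map (localHom γ x) ≫ X.fromSpecStalk x = γ := by
  calc
    _ = (Spec.map (Scheme.stalkClosedPointTo (R := .of K) γ) ≫
          Spec.map (X.presheaf.stalkSpecializes (IsGeneric.specializes x))) ≫
            X.fromSpecStalk x := congrArg (· ≫ X.fromSpecStalk x) (Spec.map_comp _ _)
    _ = Spec.map (Scheme.stalkClosedPointTo (R := .of K) γ) ≫
          (Spec.map (X.presheaf.stalkSpecializes (IsGeneric.specializes x)) ≫
            X.fromSpecStalk x) := Category.assoc _ _ _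
    _ = Spec.map (Scheme.stalkClosedPointTo (R := .of K) γ) ≫ X.fromSpecStalk _ :=
      congrArg _ (Scheme.SpecMap_stalkSpecializes_fromSpecStalk _)
    _ = γ := Scheme.Spec_stalkClosedPointTo_fromSpecStalk (R := .of K) γ

/-- A point of a separated scheme at which all functions of an affine chart are regular lies in the
chart. -/
lemma mem_range_of_range_le_localRing [X.IsSeparated] {R : Type u} [CommRing R] (ρ : R →+* K)
    (e : Spec (.of R) ⟶ X) (γ : Spec (.of K) ⟶ X) [hg : IsGeneric γ]
    (h : Spec.map (CommRingCat.ofHom ρ) ≫ e = γ) (x : X) (hx : ρ.range ≤ localRing γ x) :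
    x ∈ Set.range e := by
  let B := localRing γ x
  let toB : X.presheaf.stalk x →+* B := (localHom γ x).hom.rangeRestrict
  have htoB : Function.Surjective toB := (localHom γ x).hom.rangeRestrict_surjective
  have : IsLocalRing B := IsLocalRing.of_surjective' toB htoB
  have : IsLocalHom toB := IsLocalHom.of_surjective toB htoB
  let fromR : R →+* B := ρ.codRestrict B fun r => hx ⟨r, rfl⟩
  let j : Spec (.of K) ⟶ Spec (.of B) := Spec.map (CommRingCat.ofHom B.subtype)
  have : IsDominant j := by
    refine ⟨?_⟩
    refine (PrimeSpectrum.denseRange_comap_iff_ker_le_nilRadical _).2 ?_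
    intro a ha
    rw [show a = 0 from Subtype.ext ha]
    exact zero_mem _
  have h1 : j ≫ Spec.map (CommRingCat.ofHom toB) ≫ X.fromSpecStalk x = γ := by
    rw [← Spec.map_comp_assoc]
    exact localHom_fromSpecStalk γ x
  have h2 : j ≫ Spec.map (CommRingCat.ofHom fromR) ≫ e = γ := by
    rw [← Spec.map_comp_assoc]
    exact h
  -- The local ring `B` at `x` gives two morphisms from its spectrum to `X`, one through the stalk
  -- and one through the chart. They agree on the dominant point `Spec K`, hence everywhere by
  -- separatedness, and the first sends the closed point to `x`.
  have key := ext_of_isDominant j (h1.trans h2.symm)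
  have h3 : Spec.map (CommRingCat.ofHom toB) (specPt (IsLocalRing.closedPoint B)) =
      IsLocalRing.closedPoint (X.presheaf.stalk x) := IsLocalRing.comap_closedPoint toB
  refine ⟨Spec.map (CommRingCat.ofHom fromR) (specPt (IsLocalRing.closedPoint B)), ?_⟩
  rw [← Scheme.Hom.comp_apply, ← key, Scheme.Hom.comp_apply, h3]
  exact Scheme.fromSpecStalk_closedPoint

end LocalRing

/-! ### Points with values in fields, local rings and valuation rings. -/

lemma isGeneric_Spec_map {R K : Type u} [CommRing R] [Field K] {ρ : R →+* K}
    (hρ : Function.Injective ρ) : IsGeneric (Spec.map (CommRingCat.ofHom ρ)) := by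
  refine ⟨fun x => ?_⟩
  obtain ⟨p, rfl⟩ := exists_specPt x
  refine (PrimeSpectrum.le_iff_specializes (PrimeSpectrum.comap ρ (IsLocalRing.closedPoint K)) p).1
    fun r hr => ?_
  have h : ρ r ∈ IsLocalRing.maximalIdeal K := hr
  rw [IsLocalRing.maximalIdeal_eq_bot, Ideal.mem_bot, map_eq_zero_iff ρ hρ] at h
  rw [h]
  exact zero_mem _

/-- A morphism from the spectrum of a local ring that sends the closed point into an affine chart
factors through the chart. -/
lemma exists_factor_chart {X : Scheme.{u}} {R B : Type u} [CommRing R] [CommRing B] [IsLocalRing B]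
    (f : Spec (.of B) ⟶ X) (e : Spec (.of R) ⟶ X) [IsOpenImmersion e]
    (h : f (specPt (IsLocalRing.closedPoint B)) ∈ Set.range e) :
    ∃ g : R →+* B, Spec.map (CommRingCat.ofHom g) ≫ e = f := by
  have h1 : f ⁻¹ᵁ e.opensRange = ⊤ :=
    Scheme.preimage_eq_top_of_closedPoint_mem (R := .of B) f h
  have h2 : Set.range f ⊆ Set.range e := by
    rintro _ ⟨x, rfl⟩
    have : x ∈ f ⁻¹ᵁ e.opensRange := by rw [h1]; trivial
    exact this
  obtain ⟨g, hg⟩ := Spec.map_surjective (IsOpenImmersion.lift e f h2)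
  refine ⟨g.hom, ?_⟩
  rw [CommRingCat.ofHom_hom, hg, IsOpenImmersion.lift_fac]

lemma Spec_map_comp_chart_injective {X : Scheme.{u}} {R B : Type u} [CommRing R] [CommRing B]
    (e : Spec (.of R) ⟶ X) [Mono e] {g g' : R →+* B}
    (h : Spec.map (CommRingCat.ofHom g) ≫ e = Spec.map (CommRingCat.ofHom g') ≫ e) : g = g' := by
  rw [cancel_mono] at h
  exact congrArg CommRingCat.Hom.hom (Spec.map_injective h)

lemma exists_lift_valuationSubring {X S : Scheme.{u}} (f : X ⟶ S) [UniversallyClosed f]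
    {L : Type u} [Field L] (O : ValuationSubring L) (i : Spec (.of L) ⟶ X) (j : Spec (.of O) ⟶ S)
    (h : i ≫ f = Spec.map (CommRingCat.ofHom (algebraMap O L)) ≫ j) :
    ∃ l : Spec (.of O) ⟶ X, Spec.map (CommRingCat.ofHom (algebraMap O L)) ≫ l = i ∧ l ≫ f = j := by
  have hf : (ValuativeCriterion.Existence ⊓ @QuasiCompact) f := by
    rw [← UniversallyClosed.eq_valuativeCriterion]
    infer_instance
  obtain ⟨⟨l⟩⟩ := hf.1 ⟨O, L, i, j, ⟨h⟩⟩
  exact ⟨l.l, l.fac_left, l.fac_right⟩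

/-! ### Field-valued points and charts of general toric varieties. -/

section Fan

variable (k : Type u) [Field k] {n : ℕ} (F : Fan n)

/-- The inclusion of the coordinate ring of an affine toric variety into that of the torus. -/
def coneToTorus (σ : PointedCone ℝ (Fin n → ℝ)) :
    coneRing k σ →+* AddMonoidAlgebra k (Fin n → ℤ) :=
  AddMonoidAlgebra.mapDomainRingHom k (dualMonoid σ).subtype

lemma coneToTorus_single (σ : PointedCone ℝ (Fin n → ℝ)) (m : dualMonoid σ) (r : k) :
    coneToTorus k σ (AddMonoidAlgebra.single m r) = AddMonoidAlgebra.single (m : Fin n → ℤ) r :=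
  AddMonoidAlgebra.mapDomain_single

lemma coneToTorus_injective (σ : PointedCone ℝ (Fin n → ℝ)) :
    Function.Injective (coneToTorus k σ) :=
  AddMonoidAlgebra.mapDomain_injective Subtype.val_injective

lemma coneToTorus_algebraMap (σ : PointedCone ℝ (Fin n → ℝ)) :
    (coneToTorus k σ).comp (algebraMap k (coneRing k σ)) = algebraMap k _ := by
  ext r
  simp [coneToTorus_single]

instance (σ : F.cones) : IsOpenImmersion (F.chart k σ) :=
  inferInstanceAs (IsOpenImmersion (colimit.ι (F.diagram k) σ))

lemma Fan.exists_chart (x : F.variety k) : ∃ σ p, F.chart k σ (specPt p) = x := by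
  obtain ⟨σ, p, h⟩ := Scheme.IsLocallyDirected.ι_jointly_surjective (F.diagram k) x
  exact ⟨σ, p, h⟩

lemma Fan.map_chart {σ τ : F.cones} (h : σ.1 ≤ τ.1) :
    Spec.map (CommRingCat.ofHom (coneRingMap k h)) ≫ F.chart k τ = F.chart k σ :=
  colimit.w (F.diagram k) (homOfLE h : σ ⟶ τ)

lemma coneToTorus_comp_coneRingMap {σ τ : PointedCone ℝ (Fin n → ℝ)} (h : τ ≤ σ) :
    (coneToTorus k τ).comp (coneRingMap k h) = coneToTorus k σ :=
  (AddMonoidAlgebra.mapDomainRingHom_comp (R := k) _ _).symm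

lemma Fan.torusι_eq (σ : F.cones) :
    Spec.map (CommRingCat.ofHom (coneToTorus k σ.1)) ≫ F.chart k σ = F.torusι k := by
  have h : (⊥ : PointedCone ℝ (Fin n → ℝ)) ≤ σ.1 := bot_le
  rw [← coneToTorus_comp_coneRingMap k h, CommRingCat.ofHom_comp, Spec.map_comp, Category.assoc]
  exact congrArg _ (F.map_chart k (σ := ⟨⊥, F.bot_mem⟩) h)

lemma Fan.chart_toSpec (σ : F.cones) :
    F.chart k σ ≫ F.toSpec k = Spec.map (CommRingCat.ofHom (algebraMap k (coneRing k σ.1))) :=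
  colimit.ι_desc _ _

lemma Fan.torusι_toSpec :
    F.torusι k ≫ F.toSpec k =
      Spec.map (CommRingCat.ofHom (algebraMap k (AddMonoidAlgebra k (Fin n → ℤ)))) := by
  rw [← F.torusι_eq k ⟨⊥, F.bot_mem⟩, Category.assoc, F.chart_toSpec k, ← Spec.map_comp,
    ← CommRingCat.ofHom_comp]
  congr 2
  exact coneToTorus_algebraMap k _

variable {k} {K : Type u} [Field K] (ι : AddMonoidAlgebra k (Fin n → ℤ) →+* K)

/-- The field-valued point of a toric variety given by a map from the coordinate ring of the torus
to a field. -/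
def Fan.point : Spec (.of K) ⟶ F.variety k := Spec.map (CommRingCat.ofHom ι) ≫ F.torusι k

lemma Fan.point_eq (σ : F.cones) :
    Spec.map (CommRingCat.ofHom (ι.comp (coneToTorus k σ.1))) ≫ F.chart k σ =
      F.point ι := by
  rw [CommRingCat.ofHom_comp, Spec.map_comp, Category.assoc, F.torusι_eq k]
  rfl

variable {ι}

lemma Fan.isGeneric_point (hι : Function.Injective ι) : IsGeneric (F.point ι) := by
  refine ⟨fun x => ?_⟩
  obtain ⟨σ, p, rfl⟩ := F.exists_chart k x
  have := isGeneric_Spec_map (ρ := ι.comp (coneToTorus k σ.1))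
    (hι.comp (coneToTorus_injective k σ.1))
  rw [← F.point_eq ι σ]
  exact (this.specializes (specPt p)).map (F.chart k σ).continuous

variable (ι)

/-- `e` is an open chart `𝔸ⁿ → X` of a scheme with a field-valued point, such that the coordinate
functions are the characters `χ^{b i}`. -/
structure IsBasisChart {X : Scheme.{u}} (γ : Spec (.of K) ⟶ X)
    (b : Module.Basis (Fin n) ℤ (Fin n → ℤ)) (e : Spec (.of (MvPolynomial (Fin n) k)) ⟶ X) :
    Prop where
  isOpenImmersion : IsOpenImmersion e
  map_comp : Spec.map (CommRingCat.ofHom (polyToField b ι)) ≫ e = γ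

variable (k)

/-- If `S_σ` is free on a basis of the lattice then `k[S_σ]` is a polynomial ring. -/
def polyEquivCone {σ : PointedCone ℝ (Fin n → ℝ)} (b : Module.Basis (Fin n) ℤ (Fin n → ℤ))
    (hb : ∀ m, m ∈ dualMonoid σ ↔ ∀ i, 0 ≤ b.repr m i) :
    MvPolynomial (Fin n) k ≃ₐ[k] coneRing k σ :=
  AddMonoidAlgebra.domCongr k k (AddEquiv.ofBijective
    ((expHom b).codRestrict (dualMonoid σ) fun c => (hb _).2 fun i => by
      rw [repr_expHom]; exact Int.natCast_nonneg _)
    ⟨fun c d h => expHom_injective b (congrArg Subtype.val h), fun m => by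
      obtain ⟨c, hc⟩ := exists_expHom b ((hb _).1 m.2)
      exact ⟨c, Subtype.ext hc⟩⟩)

lemma coneToTorus_polyEquivCone {σ : PointedCone ℝ (Fin n → ℝ)}
    (b : Module.Basis (Fin n) ℤ (Fin n → ℤ)) (hb : ∀ m, m ∈ dualMonoid σ ↔ ∀ i, 0 ≤ b.repr m i) :
    (coneToTorus k σ).comp (polyEquivCone k b hb : _ →+* _) = (polyToTorus k b : MvPolynomial (Fin n) k →+* _) := by
  apply MvPolynomial.ringHom_ext
  · intro r
    simp only [RingHom.comp_apply, RingHom.coe_coe, MvPolynomial.C_eq_algebraMap, AlgEquiv.commutes]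
    rw [AlgHom.commutes]
    exact RingHom.congr_fun (coneToTorus_algebraMap k σ) r
  · intro i
    rw [RingHom.comp_apply, RingHom.coe_coe, RingHom.coe_coe, polyToTorus_X]
    change coneToTorus k σ (AddMonoidAlgebra.domCongr k k _
      (AddMonoidAlgebra.single (Finsupp.single i 1) 1)) = _
    rw [AddMonoidAlgebra.domCongr_single, coneToTorus_single, ← expHom_single]
    rfl

/-- The chart of a cone whose dual semigroup is free on a basis of the lattice. -/
def Fan.basisChart (σ : F.cones) (b : Module.Basis (Fin n) ℤ (Fin n → ℤ))
    (hb : ∀ m, m ∈ dualMonoid σ.1 ↔ ∀ i, 0 ≤ b.repr m i) :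
    Spec (.of (MvPolynomial (Fin n) k)) ⟶ F.variety k :=
  Spec.map (polyEquivCone k b hb).symm.toRingEquiv.toCommRingCatIso.hom ≫ F.chart k σ

instance (σ : F.cones) (b : Module.Basis (Fin n) ℤ (Fin n → ℤ))
    (hb : ∀ m, m ∈ dualMonoid σ.1 ↔ ∀ i, 0 ≤ b.repr m i) : IsOpenImmersion (F.basisChart k σ b hb) :=
  inferInstanceAs (IsOpenImmersion (_ ≫ F.chart k σ))

lemma Fan.range_basisChart (σ : F.cones) (b : Module.Basis (Fin n) ℤ (Fin n → ℤ))
    (hb : ∀ m, m ∈ dualMonoid σ.1 ↔ ∀ i, 0 ≤ b.repr m i) :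
    Set.range (F.basisChart k σ b hb) = Set.range (F.chart k σ) := by
  rw [Fan.basisChart, Scheme.Hom.comp_base, TopCat.coe_comp, Set.range_comp, Set.range_eq_univ.2,
    Set.image_univ]
  exact (Spec.map _).surjective

lemma Fan.map_basisChart (σ : F.cones) (b : Module.Basis (Fin n) ℤ (Fin n → ℤ))
    (hb : ∀ m, m ∈ dualMonoid σ.1 ↔ ∀ i, 0 ≤ b.repr m i) :
    Spec.map (CommRingCat.ofHom (polyToTorus k b : _ →+* _)) ≫ F.basisChart k σ b hb =
      F.torusι k := by
  rw [Fan.basisChart, ← Spec.map_comp_assoc, ← F.torusι_eq k σ]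
  congr 2
  refine CommRingCat.hom_ext <| RingHom.ext fun x => ?_
  change polyToTorus k b ((polyEquivCone k b hb).symm x) = coneToTorus k σ.1 x
  conv_rhs => rw [← (polyEquivCone k b hb).apply_symm_apply x]
  exact (RingHom.congr_fun (coneToTorus_polyEquivCone k b hb) _).symm

variable {k}

lemma Fan.isBasisChart (σ : F.cones) (b : Module.Basis (Fin n) ℤ (Fin n → ℤ))
    (hb : ∀ m, m ∈ dualMonoid σ.1 ↔ ∀ i, 0 ≤ b.repr m i) :
    IsBasisChart ι (F.point ι) b (F.basisChart k σ b hb) where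
  isOpenImmersion := inferInstance
  map_comp := by
    rw [polyToField, CommRingCat.ofHom_comp, Spec.map_comp, Category.assoc, F.map_basisChart k]
    rfl

/-- On a complete toric variety every monomial valuation of the torus has a centre. -/
lemma Fan.exists_cone_nonneg [IsProper (F.toSpec k)] {Γ : Type} [AddCommGroup Γ] [LinearOrder Γ]
    [IsOrderedAddMonoid Γ] (φ : (Fin n → ℤ) →+ Γ) :
    ∃ σ ∈ F.cones, ∀ m ∈ dualMonoid σ, 0 ≤ φ m := by
  -- In this field the character `χ^m` can be sent to a monomial of order exactly `φ m`. Since `Γ`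
  -- lies in the lowest universe, the field stays in the universe of `k`, as the valuative criterion
  -- requires.
  let L := HahnSeries Γ k
  let v : Valuation L (Multiplicative (WithTop Γ)ᵒᵈ) := HahnSeries.addVal Γ k
  let O := v.valuationSubring
  have hO : ∀ x : L, x ∈ O ↔ 0 ≤ x.orderTop := fun x => by
    rw [Valuation.mem_valuationSubring_iff]
    rw [← HahnSeries.addVal_apply]
    rfl
  have hchi : ∀ g : Γ, 0 ≤ g ↔ HahnSeries.single g (1 : k) ∈ O := fun g => by
    rw [hO, HahnSeries.orderTop_single one_ne_zero, WithTop.coe_nonneg]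
  let ι : AddMonoidAlgebra k (Fin n → ℤ) →ₐ[k] L := AddMonoidAlgebra.lift k L (Fin n → ℤ)
    { toFun := fun m => HahnSeries.single (φ m.toAdd) 1
      map_one' := by simp
      map_mul' := fun a b => by
        rw [HahnSeries.single_mul_single, mul_one, toAdd_mul, map_add] }
  have hι : ∀ m, ι (AddMonoidAlgebra.single m 1) = HahnSeries.single (φ m) 1 := fun m => by
    simp [ι]
  let c : k →+* O := (algebraMap k L).codRestrict O.toSubring fun r => by
    change algebraMap k L r ∈ O
    rw [hO, ← HahnSeries.C_eq_algebraMap]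
    exact HahnSeries.orderTop_single_le
  obtain ⟨l, hl, -⟩ := exists_lift_valuationSubring (F.toSpec k) O (F.point ι)
    (Spec.map (CommRingCat.ofHom c)) (by
      rw [Fan.point, Category.assoc, F.torusι_toSpec k, ← Spec.map_comp, ← Spec.map_comp,
        ← CommRingCat.ofHom_comp, ← CommRingCat.ofHom_comp]
      congr 2
      exact ι.comp_algebraMap)
  -- The chart containing the limit gives the cone: its regular characters land in the valuation
  -- ring, that is, have nonnegative order.
  obtain ⟨σ, p, hp⟩ := F.exists_chart k (l (specPt (IsLocalRing.closedPoint O)))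
  obtain ⟨g, rfl⟩ := exists_factor_chart l (F.chart k σ) ⟨_, hp⟩
  rw [← F.point_eq _ σ, ← Spec.map_comp_assoc, ← CommRingCat.ofHom_comp] at hl
  have hg := Spec_map_comp_chart_injective _ hl
  refine ⟨σ.1, σ.2, fun m hm => ?_⟩
  have := RingHom.congr_fun hg (AddMonoidAlgebra.single ⟨m, hm⟩ 1)
  rw [RingHom.comp_apply, RingHom.comp_apply, coneToTorus_single] at this
  rw [hchi, ← hι]
  change (ι : AddMonoidAlgebra k (Fin n → ℤ) →+* L) _ ∈ O
  rw [← this]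
  exact Subtype.property _

end Fan

/-! ### Affine-space charts of smooth complete toric varieties. -/

section Smooth

variable {k : Type u} [Field k] {n : ℕ} (F : Fan n)

lemma Fan.smooth_coneRing [Smooth (F.toSpec k)] (σ : F.cones) :
    Algebra.Smooth k (coneRing k σ.1) := by
  have h : Smooth (F.chart k σ ≫ F.toSpec k) := inferInstance
  rw [F.chart_toSpec k] at h
  have h1 := (HasRingHomProperty.Spec_iff (P := @Smooth)).1 h
  exact RingHom.smooth_algebraMap.1 h1

/-- The hypothesis on `σ` means that it is full-dimensional. Since the zero cone is a face of `σ`,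
cut out by some `m0`, adding a multiple of `m0` moves any character into the dual semigroup; thus
the semigroup generates the lattice and `exists_basis_of_smooth` applies. -/
lemma Fan.exists_basis_of_pointed [Smooth (F.toSpec k)] (σ : F.cones)
    (hσ : ∀ m ∈ dualMonoid σ.1, -m ∈ dualMonoid σ.1 → m = 0) :
    ∃ b : Module.Basis (Fin n) ℤ (Fin n → ℤ), ∀ m, m ∈ dualMonoid σ.1 ↔ ∀ i, 0 ≤ b.repr m i := by
  have := F.smooth_coneRing (k := k) σ
  refine exists_basis_of_smooth (k := k) _ hσ fun m => ?_
  obtain ⟨S, hS, hσS⟩ := F.rational σ.1 σ.2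
  obtain ⟨m0, hm0, h⟩ := (F.inter_face σ.1 σ.2 ⊥ F.bot_mem).1
  rw [inf_bot_eq] at h
  obtain ⟨N, hN⟩ := exists_nat_dual hS hσS hm0 h (a := m) fun v hv => by
    rw [(Submodule.mem_bot _).1 hv, pairing_zero_right]
  exact ⟨m + N • m0, hN, N • m0,
    AddSubmonoid.nsmul_mem (dualMonoid σ.1) (x := m0) hm0 N, (add_sub_cancel_right _ _).symm⟩

/-- On a smooth complete toric variety, every integral functional on the character group is
nonnegative on the coordinates of some fixed point. -/
lemma Fan.exists_basisChart_nonneg [IsProper (F.toSpec k)] [Smooth (F.toSpec k)]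
    {K : Type u} [Field K] (ι : AddMonoidAlgebra k (Fin n → ℤ) →+* K) (W : (Fin n → ℤ) →+ ℤ) :
    ∃ b e, IsBasisChart ι (F.point ι) b e ∧ ∀ i, 0 ≤ W (b i) := by
  -- `W` is perturbed infinitesimally to an injective map to an ordered group. The cone found for it
  -- has a dual semigroup without units, which rules out cones of lower dimension.
  let φ : (Fin n → ℤ) →+ Lex (ℤ × Lex (Fin n → ℤ)) :=
    { toFun := fun m => toLex (W m, toLex m)
      map_zero' := by rw [map_zero]; rfl
      map_add' := fun a b => by rw [map_add]; rfl }
  obtain ⟨σ, hσ, h⟩ := F.exists_cone_nonneg (k := k) φ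
  obtain ⟨b, hb⟩ := F.exists_basis_of_pointed (k := k) ⟨σ, hσ⟩ fun m hm hm' => by
    have h1 := h m hm
    have h2 := h _ hm'
    rw [map_neg, neg_nonneg] at h2
    have h3 : φ m = 0 := le_antisymm h2 h1
    exact congrArg (fun x => ofLex (ofLex x).2) h3
  refine ⟨b, _, F.isBasisChart ι ⟨σ, hσ⟩ b hb, fun i => ?_⟩
  have hi : b i ∈ dualMonoid σ := (hb _).2 fun j => by
    rw [Module.Basis.repr_self, Finsupp.single_apply]; split_ifs <;> norm_num
  have h1 := h _ hi
  rw [Prod.Lex.le_iff] at h1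
  rcases h1 with h1 | h1
  · exact le_of_lt h1
  · exact le_of_eq h1.1

end Smooth

/-! ### Transport of local rings and charts along toric birational maps. -/

section PartialIso

variable {X Y : Scheme.{u}} {K : Type u} [Field K] (f : X.PartialIso Y) {γ : Spec (.of K) ⟶ X}
  {γ' : Spec (.of K) ⟶ Y} [IsGeneric γ] [IsGeneric γ'] {γ₀ : Spec (.of K) ⟶ f.source.toScheme}

lemma exists_localRing_eq_of_mem_source (h : γ₀ ≫ f.source.ι = γ)
    (h' : γ₀ ≫ f.iso.hom ≫ f.target.ι = γ') {x : X} (hx : x ∈ f.source) :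
    ∃ y, localRing γ x = localRing γ' y := by
  subst h h'
  have := IsGeneric.of_comp γ₀ f.source.ι
  obtain ⟨x, rfl⟩ : ∃ y, f.source.ι y = x := ⟨⟨x, hx⟩, rfl⟩
  exact ⟨(f.iso.hom ≫ f.target.ι) x, by rw [localRing_comp γ₀, localRing_comp γ₀]⟩

lemma exists_localRing_eq_of_mem_target (h : γ₀ ≫ f.source.ι = γ)
    (h' : γ₀ ≫ f.iso.hom ≫ f.target.ι = γ') {y : Y} (hy : y ∈ f.target) :
    ∃ x, localRing γ x = localRing γ' y := by
  subst h h'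
  have := IsGeneric.of_comp γ₀ f.source.ι
  obtain ⟨x, hx⟩ : ∃ x, f.iso.hom x = ⟨y, hy⟩ := f.iso.hom.surjective _
  refine ⟨f.source.ι x, ?_⟩
  have : y = (f.iso.hom ≫ f.target.ι) x := by
    rw [Scheme.Hom.comp_apply, hx]
    rfl
  rw [localRing_comp γ₀, this, localRing_comp γ₀]

end PartialIso

section IsToric

variable {k : Type u} [Field k] {n n' : ℕ}

/-- The isomorphism of character groups given by an isomorphism of tori. -/
lemma exists_addEquiv_of_bialgEquiv
    (ψ : AddMonoidAlgebra k (Fin n' → ℤ) ≃ₐc[k] AddMonoidAlgebra k (Fin n → ℤ)) :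
    ∃ L : (Fin n' → ℤ) ≃+ (Fin n → ℤ),
      ∀ m, ψ (AddMonoidAlgebra.single m 1) = AddMonoidAlgebra.single (L m) 1 := by
  -- The characters are exactly the group-like elements, which bialgebra maps preserve.
  have h1 : ∀ m, ∃ m', ψ (AddMonoidAlgebra.single m 1) = AddMonoidAlgebra.single m' 1 := by
    intro m
    have := (AddMonoidAlgebra.isGroupLikeElem_of (R := k) (A := k) m).map ψ
    obtain ⟨m', h⟩ := AddMonoidAlgebra.isGroupLikeElem_iff_mem_range_single_one.1 this
    exact ⟨m', h.symm⟩
  have h2 : ∀ m, ∃ m', ψ.symm (AddMonoidAlgebra.single m 1) = AddMonoidAlgebra.single m' 1 := by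
    intro m
    have := (AddMonoidAlgebra.isGroupLikeElem_of (R := k) (A := k) m).map ψ.symm
    obtain ⟨m', h⟩ := AddMonoidAlgebra.isGroupLikeElem_iff_mem_range_single_one.1 this
    exact ⟨m', h.symm⟩
  choose L hL using h1
  choose L' hL' using h2
  have hinj : ∀ {j : ℕ} {a b : Fin j → ℤ},
      (AddMonoidAlgebra.single a (1 : k)) = AddMonoidAlgebra.single b 1 → a = b := fun h =>
    AddMonoidAlgebra.of_injective (R := k) h
  have hadd : ∀ a b, L (a + b) = L a + L b := fun a b => hinj <| by
    have h1 : ∀ {j : ℕ} (a b : Fin j → ℤ), (AddMonoidAlgebra.single (a + b) (1 : k)) =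
        AddMonoidAlgebra.single a 1 * AddMonoidAlgebra.single b 1 := fun a b => by
      rw [AddMonoidAlgebra.single_mul_single, mul_one]
    rw [← hL, h1, map_mul, hL, hL, h1]
  refine ⟨⟨⟨L, L', fun m => hinj ?_, fun m => hinj ?_⟩, hadd⟩, hL⟩
  · rw [← hL', ← hL, BialgEquiv.symm_apply_apply]
  · rw [← hL, ← hL', BialgEquiv.apply_symm_apply]

/-- A toric birational map identifies the generic points. -/
lemma IsToric.exists_point {F : Fan n} {F' : Fan n'}
    {f : (F.variety k).PartialIso (F'.variety k)} (hf : IsToric f) {K : Type u} [Field K]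
    {ι : AddMonoidAlgebra k (Fin n → ℤ) →+* K} (hι : Function.Injective ι) :
    ∃ (L : (Fin n' → ℤ) ≃+ (Fin n → ℤ)) (ι' : AddMonoidAlgebra k (Fin n' → ℤ) →+* K)
      (γ₀ : Spec (.of K) ⟶ f.source.toScheme), Function.Injective ι' ∧
      (∀ m r, ι' (AddMonoidAlgebra.single m r) = ι (AddMonoidAlgebra.single (L m) r)) ∧
      γ₀ ≫ f.source.ι = F.point ι ∧ γ₀ ≫ f.iso.hom ≫ f.target.ι = F'.point ι' := by
  obtain ⟨-, ψ, hψ⟩ := hf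
  obtain ⟨L, hL⟩ := exists_addEquiv_of_bialgEquiv ψ
  have hgen := F.isGeneric_point hι
  have hne : (f.source : Set (F.variety k)).Nonempty := by
    have : Nonempty (F.variety k) := ⟨F.point ι (specPt (IsLocalRing.closedPoint K))⟩
    exact f.dense_source.nonempty
  obtain ⟨x, hx⟩ := hne
  have hmem : F.point ι (specPt (IsLocalRing.closedPoint K)) ∈ f.source :=
    (hgen.specializes x).mem_open f.source.isOpen hx
  let U := F.torusι k ⁻¹ᵁ f.source
  have hU : Set.range (Spec.map (CommRingCat.ofHom ι)) ⊆ Set.range U.ι := by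
    rintro _ ⟨y, rfl⟩
    rw [Scheme.Opens.range_ι]
    obtain rfl : y = specPt (IsLocalRing.closedPoint K) := Subsingleton.elim (α := PrimeSpectrum K) _ _
    exact hmem
  let δ := IsOpenImmersion.lift U.ι (Spec.map (CommRingCat.ofHom ι)) hU
  have hδ : δ ≫ U.ι = Spec.map (CommRingCat.ofHom ι) := IsOpenImmersion.lift_fac _ _ _
  refine ⟨L, ι.comp (ψ : AddMonoidAlgebra k (Fin n' → ℤ) →+* _), δ ≫ (F.torusι k ∣_ f.source),
    hι.comp ψ.injective, fun m r => ?_, ?_, ?_⟩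
  · have h1 : (AddMonoidAlgebra.single m r : AddMonoidAlgebra k (Fin n' → ℤ)) =
        r • AddMonoidAlgebra.single m 1 := by
      rw [AddMonoidAlgebra.smul_single, smul_eq_mul, mul_one]
    have h2 : (ψ (AddMonoidAlgebra.single m r)) = AddMonoidAlgebra.single (L m) r := by
      rw [h1, map_smul, hL, AddMonoidAlgebra.smul_single, smul_eq_mul, mul_one]
    exact congrArg ι h2
  · rw [Category.assoc, morphismRestrict_ι, ← Category.assoc, hδ]
    rfl
  · rw [Category.assoc, hψ, ← Category.assoc, hδ, ← Category.assoc, ← Spec.map_comp]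
    rfl

/-- Rewrites charts of the target of a toric map in terms of the characters of its source. -/
lemma IsBasisChart.map {K : Type u} [Field K] {ι ι' : AddMonoidAlgebra k (Fin n → ℤ) →+* K}
    {L : (Fin n → ℤ) ≃+ (Fin n → ℤ)}
    (h : ∀ m r, ι' (AddMonoidAlgebra.single m r) = ι (AddMonoidAlgebra.single (L m) r))
    {X : Scheme.{u}} {γ : Spec (.of K) ⟶ X} {b : Module.Basis (Fin n) ℤ (Fin n → ℤ)}
    {e : Spec (.of (MvPolynomial (Fin n) k)) ⟶ X} (hb : IsBasisChart ι' γ b e) :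
    IsBasisChart ι γ (b.map L.toIntLinearEquiv) e := by
  refine ⟨hb.1, ?_⟩
  rw [← hb.2]
  congr 3
  apply MvPolynomial.ringHom_ext
  · intro r
    rw [MvPolynomial.C_apply, polyToField_apply, polyToField_apply, polyToTorus_monomial,
      polyToTorus_monomial, h, map_zero, map_zero, map_zero]
  · intro i
    rw [polyToField_apply, polyToField_apply, polyToTorus_X, polyToTorus_X, h]
    rfl

end IsToric

/-- A polynomial algebra, presented by its variables and no relations. -/
def submersivePresentationMvPolynomial (R : Type*) [CommRing R] (ι : Type) [Finite ι] :
    Algebra.SubmersivePresentation R (MvPolynomial ι R) ι PEmpty.{1} where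
  __ := Algebra.Generators.mvPolynomial R ι
  relation := PEmpty.elim
  span_range_relation_eq_ker := by
    rw [Set.range_eq_empty, Ideal.span_empty, Algebra.Generators.ker_mvPolynomial]
  map := PEmpty.elim
  map_inj a := a.elim
  jacobian_isUnit := by
    rw [Algebra.PreSubmersivePresentation.jacobian_eq_jacobiMatrix_det, Matrix.det_isEmpty, map_one]
    exact isUnit_one

lemma isStandardSmooth_mvPolynomial (R : Type*) [CommRing R] (n : ℕ) :
    Algebra.IsStandardSmoothOfRelativeDimension n R (MvPolynomial (Fin n) R) :=
  (submersivePresentationMvPolynomial R (Fin n)).isStandardSmoothOfRelativeDimension (by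
    simp [Algebra.Presentation.dimension])

/-! ### Charts, integrality and smoothness of the variety of `zFan`. -/

section ZFan

variable (k : Type u) [Field k]

lemma mem_dualMonoid_simplexCone {n r : ℕ} {v : Fin r → Fin n → ℤ} {A : Finset (Fin r)}
    {m : Fin n → ℤ} : m ∈ dualMonoid (simplexCone v A) ↔ ∀ i ∈ A, 0 ≤ intPairing m (v i) := by
  constructor
  · intro h i hi
    have := h _ (mem_coneOf ⟨i, hi, rfl⟩)
    rw [pairing_intCast] at this
    exact_mod_cast this
  · intro h x hx
    refine pairing_coneOf_nonneg ?_ hx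
    rintro _ ⟨i, hi, rfl⟩
    rw [pairing_intCast]
    exact_mod_cast h i hi

/-- The maximal cones of the fan. -/
def zCone (t : Fin 12) : zFan.cones :=
  ⟨simplexCone zRay (Finset.univ.image (triple t)), _, triple_mem t, _, subset_rfl, rfl⟩

lemma mem_dualMonoid_zCone {t : Fin 12} {m : Fin 3 → ℤ} :
    m ∈ dualMonoid (zCone t).1 ↔ ∀ i, 0 ≤ (zBasis t).repr m i := by
  simp only [zCone, mem_dualMonoid_simplexCone, zBasis_repr, Finset.mem_image, Finset.mem_univ,
    true_and, forall_exists_index, forall_apply_eq_imp_iff]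

/-- The charts of the maximal cones of the fan, as affine spaces. -/
def zChart (t : Fin 12) : Spec (.of (MvPolynomial (Fin 3) k)) ⟶ zFan.variety k :=
  zFan.basisChart k (zCone t) (zBasis t) fun _ => mem_dualMonoid_zCone

instance (t : Fin 12) : IsOpenImmersion (zChart k t) :=
  inferInstanceAs (IsOpenImmersion (zFan.basisChart k _ _ _))

lemma isBasisChart_zChart {K : Type u} [Field K]
    (ι : AddMonoidAlgebra k (Fin 3 → ℤ) →+* K) (t : Fin 12) :
    IsBasisChart ι (zFan.point ι) (zBasis t) (zChart k t) :=
  zFan.isBasisChart ι _ _ _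

/-- Each cone is a face of one of the twelve maximal ones, so its chart lies in theirs. -/
lemma exists_zChart (x : zFan.variety k) : ∃ t p, zChart k t (specPt p) = x := by
  obtain ⟨⟨_, B, hB, A, hA, rfl⟩, p, rfl⟩ := zFan.exists_chart k x
  obtain ⟨t, rfl⟩ := exists_triple hB
  have hle : simplexCone zRay A ≤ (zCone t).1 := by
    refine Submodule.span_mono (Set.image_mono (Set.image_mono ?_))
    exact_mod_cast hA
  have hx : zFan.chart k ⟨simplexCone zRay A, _, hB, A, hA, rfl⟩ (specPt p) ∈
      Set.range (zChart k t) := by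
    rw [zChart, Fan.range_basisChart, ← zFan.map_chart k (σ := ⟨_, _, hB, A, hA, rfl⟩)
      (τ := zCone t) hle, Scheme.Hom.comp_apply]
    exact ⟨_, rfl⟩
  obtain ⟨y, hy⟩ := hx
  obtain ⟨q, rfl⟩ := exists_specPt y
  exact ⟨t, q, hy⟩

/-- The open cover by the charts of the maximal cones. -/
def zCover : (zFan.variety k).OpenCover :=
  Scheme.Cover.mkOfCovers (Fin 12) (fun _ => Spec (.of (MvPolynomial (Fin 3) k))) (zChart k)
    fun x => by
      obtain ⟨t, p, h⟩ := exists_zChart k x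
      exact ⟨t, specPt p, h⟩

lemma basisChart_toSpec {n : ℕ} (F : Fan n) (σ : F.cones) (b : Module.Basis (Fin n) ℤ (Fin n → ℤ))
    (hb : ∀ m, m ∈ dualMonoid σ.1 ↔ ∀ i, 0 ≤ b.repr m i) :
    F.basisChart k σ b hb ≫ F.toSpec k =
      Spec.map (CommRingCat.ofHom (algebraMap k (MvPolynomial (Fin n) k))) := by
  rw [Fan.basisChart, Category.assoc, F.chart_toSpec k, ← Spec.map_comp]
  congr 1
  refine CommRingCat.hom_ext (RingHom.ext fun x => ?_)
  exact (polyEquivCone k b hb).symm.commutes x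

lemma zChart_toSpec (t : Fin 12) : zChart k t ≫ zFan.toSpec k =
    Spec.map (CommRingCat.ofHom (algebraMap k (MvPolynomial (Fin 3) k))) :=
  basisChart_toSpec k _ _ _ _

/-- Reducedness is local, and the generic point of the torus specializes to every point. -/
lemma isIntegral_zFan : IsIntegral (zFan.variety k) := by
  have : IsReduced (zFan.variety k) := by
    have : ∀ i, IsReduced ((zCover k).X i) := fun i =>
      inferInstanceAs (IsReduced (Spec (.of (MvPolynomial (Fin 3) k))))
    exact IsReduced.of_openCover _ (zCover k)
  let ι := algebraMap (AddMonoidAlgebra k (Fin 3 → ℤ)) (FractionRing (AddMonoidAlgebra k (Fin 3 → ℤ)))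
  have hgen := zFan.isGeneric_point (ι := ι) (IsFractionRing.injective _ _)
  let x : zFan.variety k := zFan.point ι (specPt (IsLocalRing.closedPoint _))
  have : IrreducibleSpace (zFan.variety k) := by
    have h : closure {x} = Set.univ :=
      Set.eq_univ_of_forall fun y => (hgen.specializes y).mem_closure
    have h1 := (isIrreducible_singleton (x := x)).closure
    rw [h] at h1
    exact (irreducibleSpace_def _).2 h1
  exact isIntegral_of_irreducibleSpace_of_isReduced _

lemma smooth_zFan : SmoothOfRelativeDimension 3 (zFan.toSpec k) := by
  have key : ∀ t : Fin 12, SmoothOfRelativeDimension 3 (zChart k t ≫ zFan.toSpec k) := by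
    intro t
    rw [zChart_toSpec]
    refine (HasRingHomProperty.Spec_iff (P := @SmoothOfRelativeDimension 3)).2 ?_
    refine RingHom.locally_of RingHom.isStandardSmoothOfRelativeDimension_respectsIso _ ?_
    have := isStandardSmooth_mvPolynomial k 3
    exact (RingHom.isStandardSmoothOfRelativeDimension_algebraMap 3).2 this
  have h : HasRingHomProperty (@SmoothOfRelativeDimension.{u} 3)
    (RingHom.Locally (RingHom.IsStandardSmoothOfRelativeDimension 3)) := inferInstance
  have : IsZariskiLocalAtSource (@SmoothOfRelativeDimension.{u} 3) :=
    HasRingHomProperty.instIsZariskiLocalAtSource (Q :=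
      RingHom.Locally (RingHom.IsStandardSmoothOfRelativeDimension 3))
  exact IsZariskiLocalAtSource.of_openCover (P := @SmoothOfRelativeDimension 3) (zCover k) key

end ZFan

/-! ### Homogeneous coordinates of a field-valued point. -/

section Projective

attribute [local instance] MvPolynomial.gradedAlgebra

open HomogeneousLocalization

variable (k : Type u) [Field k] {r : ℕ}

variable (r) in
/-- The grading of the polynomial ring by the degree. -/
abbrev polyGrading : ℕ → Submodule k (MvPolynomial (Fin (r + 1)) k) :=
  MvPolynomial.homogeneousSubmodule (Fin (r + 1)) k

lemma X_mem_homogeneousSubmodule (j : Fin (r + 1)) : (MvPolynomial.X j : MvPolynomial _ k) ∈ polyGrading k r 1 :=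
  MvPolynomial.isHomogeneous_X k j

/-- The affine coordinate `x_j / x_l`. -/
def affineCoord (l j : Fin (r + 1)) : Away (polyGrading k r) (MvPolynomial.X l) :=
  Away.mk (polyGrading k r) (X_mem_homogeneousSubmodule k l) 1 (MvPolynomial.X j)
    (X_mem_homogeneousSubmodule k j)

/-- The inclusion of the constants in the coordinate ring of a standard affine chart. -/
def constAway (l : Fin (r + 1)) : k →+* Away (polyGrading k r) (MvPolynomial.X l) :=
  (fromZeroRingHom (polyGrading k r) _).comp (algebraMap k (polyGrading k r 0))

/-- The standard affine chart of projective space. -/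
def projChart (l : Fin (r + 1)) : Spec (.of (Away (polyGrading k r) (MvPolynomial.X l))) ⟶ projSpace k r :=
  Proj.awayι (polyGrading k r) (MvPolynomial.X l) (X_mem_homogeneousSubmodule k l) one_pos

instance (l : Fin (r + 1)) : IsOpenImmersion (projChart k l) :=
  inferInstanceAs (IsOpenImmersion (Proj.awayι (polyGrading k r) _ _ _))

lemma projChart_toSpec (l : Fin (r + 1)) : projChart k l ≫ projSpaceToSpec k r =
    Spec.map (CommRingCat.ofHom (constAway k l)) := by
  refine (Proj.awayι_toSpecZero_assoc (polyGrading k r) _ _ _ _).trans ?_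
  rw [← Spec.map_comp]
  rfl

lemma exists_projChart (x : projSpace k r) : ∃ l, x ∈ Set.range (projChart k l) := by
  have h := Proj.iSup_basicOpen_eq_top' (polyGrading k r) (fun l : Fin (r + 1) => MvPolynomial.X l)
    (fun l => ⟨1, X_mem_homogeneousSubmodule k l⟩) (by
      refine eq_top_iff.2 fun p _ => ?_
      induction p using MvPolynomial.induction_on with
      | C a =>
        exact Subalgebra.algebraMap_mem _ (⟨MvPolynomial.C a, MvPolynomial.isHomogeneous_C _ a⟩ :
          polyGrading k r 0)
      | add p q hp hq => exact add_mem (hp trivial) (hq trivial)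
      | mul_X p i hp => exact mul_mem (hp trivial) (Algebra.subset_adjoin ⟨i, rfl⟩))
  have hx : x ∈ (⨆ l : Fin (r + 1), Proj.basicOpen (polyGrading k r) (MvPolynomial.X l)) := by
    rw [h]; trivial
  obtain ⟨l, hl⟩ := TopologicalSpace.Opens.mem_iSup.1 hx
  rw [← Proj.opensRange_awayι (polyGrading k r) _ (X_mem_homogeneousSubmodule k l) one_pos] at hl
  exact ⟨l, hl⟩

/-- Dehomogenization: a fraction `a / x_l ^ n` with `a` homogeneous of degree `n` is `a` itself
evaluated at the affine coordinates. -/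
lemma exists_eval₂_affineCoord (l : Fin (r + 1)) (z : Away (polyGrading k r) (MvPolynomial.X l)) :
    ∃ P : MvPolynomial (Fin (r + 1)) k, z = P.eval₂ (constAway k l) (affineCoord k l) := by
  obtain ⟨n, a, ha, rfl⟩ := Away.mk_surjective (polyGrading k r) (X_mem_homogeneousSubmodule k l) z
  refine ⟨a, ?_⟩
  let φ := algebraMap (Away (polyGrading k r) (MvPolynomial.X l))
    (Localization.Away (MvPolynomial.X l : MvPolynomial (Fin (r + 1)) k))
  have hφ : ∀ z, φ z = z.val := fun _ => rfl
  let α := algebraMap (MvPolynomial (Fin (r + 1)) k)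
    (Localization.Away (MvPolynomial.X l : MvPolynomial (Fin (r + 1)) k))
  have hX : ∀ j, α (MvPolynomial.X j) = φ (affineCoord k l j) * α (MvPolynomial.X l) := by
    intro j
    rw [hφ, affineCoord, Away.val_mk, ← Localization.mk_one_eq_algebraMap,
      ← Localization.mk_one_eq_algebraMap, Localization.mk_mul, Localization.mk_eq_mk_iff,
      Localization.r_iff_exists]
    refine ⟨1, ?_⟩
    simp only [pow_one, OneMemClass.coe_one, Submonoid.coe_mul]
    ring
  have hC : ∀ c, α (MvPolynomial.C c) = φ (constAway k l c) := fun c => rfl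
  have hu : IsUnit (α (MvPolynomial.X l)) :=
    IsLocalization.Away.algebraMap_isUnit (MvPolynomial.X l)
  have ha' : α a = φ (a.eval₂ (constAway k l) (affineCoord k l)) * α (MvPolynomial.X l) ^ n := by
    have ha1 : a = MvPolynomial.eval₂ MvPolynomial.C MvPolynomial.X a := by simp
    conv_lhs => rw [ha1]
    rw [MvPolynomial.hom_eval₂, MvPolynomial.hom_eval₂, MvPolynomial.eval₂_eq',
      MvPolynomial.eval₂_eq', Finset.sum_mul]
    refine Finset.sum_congr rfl fun d hd => ?_
    have hdn : ∑ i, d i = n := by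
      have := (MvPolynomial.mem_homogeneousSubmodule _ _).1 ha (MvPolynomial.mem_support_iff.1 hd)
      rw [Finsupp.weight_apply, Finsupp.sum_fintype _ _ (by simp)] at this
      simpa using this
    rw [← hdn, ← Finset.prod_pow_eq_pow_sum, mul_assoc, ← Finset.prod_mul_distrib,
      RingHom.comp_apply, RingHom.comp_apply, hC]
    congr 1
    refine Finset.prod_congr rfl fun i _ => ?_
    rw [← mul_pow, hX]
  apply HomogeneousLocalization.val_injective
  rw [Away.val_mk, ← hφ, ← (hu.pow n).mul_left_inj, ← ha', ← map_pow,
    ← Localization.mk_one_eq_algebraMap, ← Localization.mk_one_eq_algebraMap, Localization.mk_mul,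
    Localization.mk_eq_mk_iff, Localization.r_iff_exists]
  refine ⟨1, ?_⟩
  simp only [OneMemClass.coe_one, Submonoid.coe_mul]
  ring

variable {k} {K : Type u} [Field K]

/-- The affine coordinates in one chart `l₀` through the point serve as homogeneous coordinates. For
another chart `l`, the map factors through the overlap, where `x_j / x_l * (x_l / x_l₀) = x_j /
x_l₀`. -/
lemma exists_affineCoord_values (γ : Spec (.of K) ⟶ projSpace k r) :
    ∃ g : Fin (r + 1) → K, ∀ l (Θ : Away (polyGrading k r) (MvPolynomial.X l) →+* K),
      Spec.map (CommRingCat.ofHom Θ) ≫ projChart k l = γ →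
      g l ≠ 0 ∧ ∀ j, Θ (affineCoord k l j) = g j / g l := by
  obtain ⟨l₀, hl₀⟩ := exists_projChart k (γ (specPt (IsLocalRing.closedPoint K)))
  obtain ⟨Θ₀, h₀⟩ := exists_factor_chart γ (projChart k l₀) hl₀
  refine ⟨fun j => Θ₀ (affineCoord k l₀ j), fun l Θ h => ?_⟩
  have hl : γ (specPt (IsLocalRing.closedPoint K)) ∈ Set.range (projChart k l) := by
    rw [← h]
    exact ⟨_, rfl⟩
  have hX := X_mem_homogeneousSubmodule k (r := r)
  let x : MvPolynomial (Fin (r + 1)) k := MvPolynomial.X l₀ * MvPolynomial.X l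
  have hx : x = MvPolynomial.X l * MvPolynomial.X l₀ := mul_comm _ _
  have hxd : x ∈ polyGrading k r (1 + 1) := SetLike.mul_mem_graded (hX l₀) (hX l)
  let e : Spec (.of (Away (polyGrading k r) x)) ⟶ projSpace k r :=
    Proj.awayι (polyGrading k r) x hxd two_pos
  have : IsOpenImmersion e := inferInstanceAs (IsOpenImmersion (Proj.awayι (polyGrading k r) x hxd two_pos))
  have e₀ : Spec.map (CommRingCat.ofHom (awayMap (polyGrading k r) (hX l) (x := x) rfl)) ≫
      projChart k l₀ = e := Proj.SpecMap_awayMap_awayι ..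
  have e₁ : Spec.map (CommRingCat.ofHom (awayMap (polyGrading k r) (hX l₀) hx)) ≫
      projChart k l = e := Proj.SpecMap_awayMap_awayι ..
  have he : γ (specPt (IsLocalRing.closedPoint K)) ∈ Set.range e := by
    have h1 : e.opensRange = Proj.basicOpen (polyGrading k r) x := Proj.opensRange_awayι ..
    have h2 : (projChart k l₀).opensRange = Proj.basicOpen (polyGrading k r) _ :=
      Proj.opensRange_awayι ..
    have h3 : (projChart k l).opensRange = Proj.basicOpen (polyGrading k r) _ :=
      Proj.opensRange_awayι ..
    rw [Proj.basicOpen_mul, ← h2, ← h3] at h1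
    have : γ (specPt (IsLocalRing.closedPoint K)) ∈ e.opensRange := by
      rw [h1]
      exact ⟨hl₀, hl⟩
    exact this
  obtain ⟨Ψ, hΨ⟩ := exists_factor_chart γ e he
  have hΨ₀ : Ψ.comp (awayMap (polyGrading k r) (hX l) (x := x) rfl) = Θ₀ := by
    refine Spec_map_comp_chart_injective (projChart k l₀) ?_
    rw [h₀, CommRingCat.ofHom_comp, Spec.map_comp, Category.assoc, e₀, hΨ]
  have hΨ₁ : Ψ.comp (awayMap (polyGrading k r) (hX l₀) hx) = Θ := by
    refine Spec_map_comp_chart_injective (projChart k l) ?_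
    rw [h, CommRingCat.ofHom_comp, Spec.map_comp, Category.assoc, e₁, hΨ]
  have key : ∀ j, awayMap (polyGrading k r) (hX l₀) hx (affineCoord k l j) *
      awayMap (polyGrading k r) (hX l) (x := x) rfl (affineCoord k l₀ l) =
      awayMap (polyGrading k r) (hX l) (x := x) rfl (affineCoord k l₀ j) := by
    intro j
    rw [affineCoord, affineCoord, affineCoord, awayMap_mk, awayMap_mk, awayMap_mk]
    apply HomogeneousLocalization.val_injective
    rw [HomogeneousLocalization.val_mul, Away.val_mk, Away.val_mk, Away.val_mk,
      Localization.mk_mul, Localization.mk_eq_mk_iff, Localization.r_iff_exists]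
    refine ⟨1, ?_⟩
    simp only [x, pow_one, OneMemClass.coe_one, Submonoid.coe_mul]
    ring
  have hone : awayMap (polyGrading k r) (hX l) (x := x) rfl (affineCoord k l₀ l₀) = 1 := by
    rw [← map_one (awayMap (polyGrading k r) (hX l) (x := x) rfl)]
    congr 1
    apply HomogeneousLocalization.val_injective
    rw [affineCoord, Away.val_mk, HomogeneousLocalization.val_one]
    simp only [pow_one]
    exact Localization.mk_self (⟨_, _⟩ : Submonoid.powers _)
  have hkey : ∀ j, Θ (affineCoord k l j) * Θ₀ (affineCoord k l₀ l) = Θ₀ (affineCoord k l₀ j) := by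
    intro j
    rw [← hΨ₀, ← hΨ₁, RingHom.comp_apply, RingHom.comp_apply, RingHom.comp_apply, ← map_mul, key]
  have hne : Θ₀ (affineCoord k l₀ l) ≠ 0 := by
    intro h0
    have := hkey l₀
    rw [h0, mul_zero, ← hΨ₀, RingHom.comp_apply, hone, map_one] at this
    exact zero_ne_one this
  exact ⟨hne, fun j => by rw [eq_div_iff hne, hkey]⟩

/-- The preimage of a standard chart under a closed immersion is affine, with coordinate ring a
quotient of that of the chart. Hence its functions are polynomials in the ratios `g j / g l`. -/
lemma exists_projective_coordinates {X : Scheme.{u}} {p : X ⟶ Spec (.of k)} (hp : IsProjective p)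
    (γ : Spec (.of K) ⟶ X) [hγ : IsGeneric γ] (κ : k →+* K)
    (hκ : γ ≫ p = Spec.map (CommRingCat.ofHom κ)) :
    ∃ (r : ℕ) (g : Fin (r + 1) → K), ∀ x : X, ∃ l, g l ≠ 0 ∧
      ∃ (C : Type u) (_ : CommRing C) (e : Spec (.of C) ⟶ X) (_ : IsOpenImmersion e) (θ : C →+* K),
        Spec.map (CommRingCat.ofHom θ) ≫ e = γ ∧ x ∈ Set.range e ∧
        (∀ j, g j / g l ∈ θ.range) ∧
        ∀ c, ∃ P : MvPolynomial (Fin (r + 1)) k, θ c = P.eval₂ κ (fun j => g j / g l) := by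
  obtain ⟨r, i, hi, hip⟩ := hp
  obtain ⟨g, hg⟩ := exists_affineCoord_values (γ ≫ i)
  refine ⟨r, g, fun x => ?_⟩
  obtain ⟨l, hl⟩ := exists_projChart k (i x)
  have hsnd : IsClosedImmersion (pullback.snd i (projChart k l)) := inferInstance
  obtain ⟨I, e, he⟩ := IsClosedImmersion.Spec_iff.1 hsnd
  let e' : Spec (.of (Away (polyGrading k r)
    (MvPolynomial.X l) ⧸ I)) ⟶ X := e.inv ≫ pullback.fst i (projChart k l)
  have he' : e' ≫ i = Spec.map (CommRingCat.ofHom (Ideal.Quotient.mk I)) ≫ projChart k l := by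
    rw [Category.assoc, pullback.condition, he, ← Category.assoc, e.inv_hom_id_assoc]
  have hx : x ∈ Set.range e' := by
    have h1 : x ∈ Set.range (pullback.fst i (projChart k l)) := by
      rw [IsOpenImmersion.range_pullbackFst]
      exact hl
    obtain ⟨y, rfl⟩ := h1
    obtain ⟨z, rfl⟩ := e.inv.surjective y
    exact ⟨z, rfl⟩
  obtain ⟨θ, hθ⟩ := exists_factor_chart γ e' ((hγ.specializes x).mem_open e'.opensRange.isOpen hx)
  have hΘ : Spec.map (CommRingCat.ofHom (θ.comp (Ideal.Quotient.mk I))) ≫ projChart k l =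
      γ ≫ i := by
    rw [CommRingCat.ofHom_comp, Spec.map_comp, Category.assoc, ← he', ← Category.assoc, hθ]
  obtain ⟨hgl, hgj⟩ := hg l _ hΘ
  have hconst : (θ.comp (Ideal.Quotient.mk I)).comp (constAway k l) = κ := by
    have : Spec.map (CommRingCat.ofHom ((θ.comp (Ideal.Quotient.mk I)).comp (constAway k l))) =
        Spec.map (CommRingCat.ofHom κ) := by
      rw [← hκ, ← hip, ← Category.assoc, ← hΘ, Category.assoc, projChart_toSpec, ← Spec.map_comp]
      rfl
    exact congrArg CommRingCat.Hom.hom (Spec.map_injective this)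
  refine ⟨l, hgl, _, inferInstance, e', inferInstance, θ, hθ, hx, fun j => ?_, fun c => ?_⟩
  · rw [← hgj]
    exact ⟨_, rfl⟩
  · obtain ⟨z, rfl⟩ := Ideal.Quotient.mk_surjective c
    obtain ⟨P, hP⟩ := exists_eval₂_affineCoord k l z
    refine ⟨P, ?_⟩
    have := congrArg (θ.comp (Ideal.Quotient.mk I)) hP
    rw [MvPolynomial.hom_eval₂, hconst] at this
    simp only [← hgj]
    exact this

end Projective

/-! ### The polytope of a projective toric variety -/

section Polytope

variable {k : Type u} [Field k] {n : ℕ} {K : Type u} [Field K]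
  {ι : AddMonoidAlgebra k (Fin n → ℤ) →+* K}

lemma polyToField_C (b : Module.Basis (Fin n) ℤ (Fin n → ℤ)) (c : k) :
    polyToField b ι (MvPolynomial.C c) = ι (algebraMap k _ c) := by
  rw [polyToField_apply]
  exact congrArg ι ((polyToTorus k b).commutes c)

lemma localFractions_comp_of_localFractions {R S : Type*} [CommRing R] [CommRing S] (φ : R →+* S)
    (ρ : S →+* K) {p : PrimeSpectrum S} {a : K}
    (h : a ∈ localFractions (ρ.comp φ) (PrimeSpectrum.comap φ p)) : a ∈ localFractions ρ p := by
  obtain ⟨r, s, hs, h⟩ := h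
  exact ⟨φ r, φ s, hs, h⟩

/-- At each point of the torus `f / f'` factors as `(f / g l) * (g l / f')` with both factors
regular. It compares the generators found on two charts. -/
lemma div_mem_range_of_local_generators {b : Module.Basis (Fin n) ℤ (Fin n → ℤ)} {J : Type*}
    {g : J → K} {f f' : K}
    (hloc : ∀ p, ∃ l, g l ≠ 0 ∧ f / g l ∈ localFractions (polyToField b ι) p)
    (hdiv : ∀ j, g j / f' ∈ ι.range) : f / f' ∈ ι.range := by
  have := mem_range_of_forall_localFractions (ρ := ι) (a := f / f') (t := 1) fun p _ => by
    obtain ⟨l, hl, h⟩ := hloc (PrimeSpectrum.comap (polyToTorus k b : _ →+* _) p)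
    rw [← div_mul_div_cancel₀ hl]
    exact localFractions_mul (localFractions_comp_of_localFractions _ _ h)
      (mem_localFractions_of_mem_range (hdiv l))
  obtain ⟨N, hN⟩ := this
  simpa using hN

/-- On each chart the `g j` generate a principal fractional ideal, since polynomial rings are
factorial. The quotient of two of its generators `f t` is a unit of the Laurent ring, that is, a
monomial up to a constant, whose exponent relative to a fixed chart is `m t`. Up to the common
factor `F`, the `g j` become Laurent polynomials `H j`; after removal of `χ^(m t)` they are
polynomials on chart `t` without common zero. -/
lemma exists_vertices (hι : Function.Injective ι)
    (hfrac : ∀ a : K, ∃ r s, s ≠ 0 ∧ a * ι s = ι r) {T J : Type*} [Finite J] [Nonempty T]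
    (b : T → Module.Basis (Fin n) ℤ (Fin n → ℤ)) (g : J → K)
    (hg : ∀ t p, ∃ l, g l ≠ 0 ∧ ∀ j, g j / g l ∈ localFractions (polyToField (b t) ι) p) :
    ∃ (F : K) (H : J → AddMonoidAlgebra k (Fin n → ℤ)) (m : T → Fin n → ℤ)
      (r : T → J → MvPolynomial (Fin n) k), F ≠ 0 ∧ (∀ j, g j = F * ι (H j)) ∧
      (∀ t j, H j = AddMonoidAlgebra.single (m t) 1 * polyToTorus k (b t) (r t j)) ∧
      ∀ t p, ∃ l, r t l ∉ (p : PrimeSpectrum (MvPolynomial (Fin n) k)).asIdeal := by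
  have hex := fun t => exists_gcd_generator (polyToField_injective (b := b t) hι)
    (polyToField_exists_frac (b := b t) hfrac) g (hg t)
  choose f hf0 hfdiv hfloc using hex
  have hsub : ∀ t, (polyToField (b t) ι).range ≤ ι.range := by
    rintro t _ ⟨a, rfl⟩
    exact ⟨polyToTorus k (b t) a, (polyToField_apply ..).symm⟩
  have hunit : ∀ s t, ∃ m c, c ≠ 0 ∧ f t / f s = ι (AddMonoidAlgebra.single m c) := by
    intro s t
    obtain ⟨u, hu⟩ := div_mem_range_of_local_generators (hfloc t) fun j => hsub s (hfdiv s j)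
    obtain ⟨v, hv⟩ := div_mem_range_of_local_generators (hfloc s) fun j => hsub t (hfdiv t j)
    have huv : u * v = 1 := by
      apply hι
      rw [map_mul, hu, hv, map_one, div_mul_div_cancel₀ (hf0 s), div_self (hf0 t)]
    obtain ⟨m, c, hc, h⟩ := isUnit_eq_single (IsUnit.of_mul_eq_one v huv)
    exact ⟨m, c, hc, by rw [← hu, h]⟩
  let t₀ : T := Classical.arbitrary T
  choose m c hc hm using hunit t₀
  choose r' hr' using hfdiv
  choose H hH using fun j => hsub t₀ ⟨r' t₀ j, hr' t₀ j⟩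
  refine ⟨f t₀, H, m, fun t j => MvPolynomial.C (c t) * r' t j, hf0 t₀, fun j => ?_, fun t j => ?_,
    fun t p => ?_⟩
  · rw [hH, mul_div_cancel₀ _ (hf0 t₀)]
  · apply hι
    have hs : (AddMonoidAlgebra.single (m t) (c t) : AddMonoidAlgebra k (Fin n → ℤ)) =
        AddMonoidAlgebra.single (m t) 1 * algebraMap k _ (c t) := by
      rw [AddMonoidAlgebra.coe_algebraMap]
      simp [AddMonoidAlgebra.single_mul_single]
    rw [map_mul (polyToTorus k (b t)), ← mul_assoc, map_mul, hH, ← polyToField_apply, hr',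
      show polyToTorus k (b t) (MvPolynomial.C (c t)) = algebraMap k _ (c t) from
        (polyToTorus k (b t)).commutes _, ← hs, ← hm, mul_comm, div_mul_div_cancel₀ (hf0 t)]
  · obtain ⟨l, hl, x, s, hs, h⟩ := hfloc t p
    refine ⟨l, fun hmem => hs ?_⟩
    have hl' : r' t l ∈ p.asIdeal := by
      refine (p.isPrime.mem_or_mem hmem).resolve_left fun hC => ?_
      exact p.isPrime.ne_top (Ideal.eq_top_of_isUnit_mem _ hC
        ((isUnit_iff_ne_zero.2 (hc t)).map MvPolynomial.C))
    have : s = r' t l * x := by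
      apply polyToField_injective (b := b t) hι
      rw [map_mul, hr', ← h]
      field_simp [hf0 t]
    rw [this]
    exact Ideal.mul_mem_right _ _ hl'

/-- The origin of affine space. -/
def originPt (k : Type u) [Field k] (n : ℕ) : PrimeSpectrum (MvPolynomial (Fin n) k) :=
  ⟨RingHom.ker (MvPolynomial.constantCoeff (R := k) (σ := Fin n)), RingHom.ker_isPrime _⟩

lemma mem_originPt {f : MvPolynomial (Fin n) k} :
    f ∈ (originPt k n).asIdeal ↔ MvPolynomial.constantCoeff f = 0 := Iff.rfl

/-- The element `a` of `K` is regular at the origin of the chart given by `b`, with value `c`. -/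
def HasValue (ι : AddMonoidAlgebra k (Fin n → ℤ) →+* K) (b : Module.Basis (Fin n) ℤ (Fin n → ℤ))
    (a : K) (c : k) : Prop :=
  ∃ r s : MvPolynomial (Fin n) k, MvPolynomial.constantCoeff s ≠ 0 ∧
    a * polyToField b ι s = polyToField b ι r ∧
    MvPolynomial.constantCoeff r = c * MvPolynomial.constantCoeff s

variable {b : Module.Basis (Fin n) ℤ (Fin n → ℤ)}

lemma HasValue.add {a a' : K} {c c' : k} (h : HasValue ι b a c) (h' : HasValue ι b a' c') :
    HasValue ι b (a + a') (c + c') := by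
  obtain ⟨r, s, hs, h1, h2⟩ := h
  obtain ⟨r', s', hs', h1', h2'⟩ := h'
  refine ⟨r * s' + r' * s, s * s', by simp [hs, hs'], ?_, ?_⟩
  · rw [map_add, map_mul, map_mul, map_mul, ← h1, ← h1']; ring
  · rw [map_add, map_mul, map_mul, map_mul, h2, h2']; ring

lemma HasValue.mul {a a' : K} {c c' : k} (h : HasValue ι b a c) (h' : HasValue ι b a' c') :
    HasValue ι b (a * a') (c * c') := by
  obtain ⟨r, s, hs, h1, h2⟩ := h
  obtain ⟨r', s', hs', h1', h2'⟩ := h'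
  refine ⟨r * r', s * s', by simp [hs, hs'], ?_, ?_⟩
  · rw [map_mul, map_mul, ← h1, ← h1']; ring
  · rw [map_mul, map_mul, h2, h2']; ring

lemma HasValue.const (c : k) : HasValue ι b (ι (algebraMap k _ c)) c :=
  ⟨MvPolynomial.C c, 1, by simp, by rw [map_one, mul_one, polyToField_C], by simp⟩

lemma HasValue.eval₂ {J : Type*} {a : J → K} {c : J → k} (h : ∀ j, HasValue ι b (a j) (c j))
    (P : MvPolynomial J k) :
    HasValue ι b (P.eval₂ (ι.comp (algebraMap k _)) a) (P.eval c) := by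
  induction P using MvPolynomial.induction_on with
  | C x => simpa using HasValue.const x
  | add p q hp hq => simpa using hp.add hq
  | mul_X p i hp => simpa using hp.mul (h i)

lemma HasValue.mem {a : K} {c : k} (h : HasValue ι b a c) :
    a ∈ localFractions (polyToField b ι) (originPt k n) := by
  obtain ⟨r, s, hs, h1, -⟩ := h
  exact ⟨r, s, hs, h1⟩

/-- Invertibility in the local ring can be read off from the value at the origin; this is how
residues are later compared across charts. -/
lemma HasValue.exists_inv_iff (hι : Function.Injective ι) {a : K} {c : k} (h : HasValue ι b a c) :
    (∃ a' ∈ localFractions (polyToField b ι) (originPt k n), a' * a = 1) ↔ c ≠ 0 := by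
  have hinj := polyToField_injective (b := b) hι
  obtain ⟨r, s, hs, h1, h2⟩ := h
  constructor
  · rintro ⟨a', ⟨r', s', hs', h'⟩, haa⟩ rfl
    have : s' * s = r' * r := by
      apply hinj
      rw [map_mul, map_mul, ← h', ← h1]
      linear_combination -(polyToField b ι s' * polyToField b ι s) * haa
    have := congrArg MvPolynomial.constantCoeff this
    rw [map_mul, map_mul, h2, zero_mul, mul_zero] at this
    exact (mul_ne_zero hs' hs) this
  · intro hc
    have hr0 : MvPolynomial.constantCoeff r ≠ 0 := by
      rw [h2]; exact mul_ne_zero hc hs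
    have hr : polyToField b ι r ≠ 0 := by
      rw [Ne, map_eq_zero_iff _ hinj]
      rintro rfl
      exact hr0 (map_zero _)
    have hs0 : polyToField b ι s ≠ 0 := by
      rw [Ne, map_eq_zero_iff _ hinj]
      rintro rfl
      exact hs (map_zero _)
    refine ⟨polyToField b ι s / polyToField b ι r, ⟨s, r, hr0, div_mul_cancel₀ _ hr⟩, ?_⟩
    rw [eq_div_of_mul_eq hs0 h1, div_mul_div_cancel₀ hr, div_self hs0]

lemma chi_mem_localFractions_originPt (hι : Function.Injective ι) (m : Fin n → ℤ) :
    chi ι m ∈ localFractions (polyToField b ι) (originPt k n) ↔ ∀ i, 0 ≤ b.repr m i := by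
  rw [chi_mem_localFractions b hι]
  exact forall_congr' fun i => forall_prop_of_true (by simp [mem_originPt])

end Polytope

section Points

variable {K : Type u} [Field K] {X : Scheme.{u}}

lemma range_le_localRing {C : Type u} [CommRing C] {e : Spec (.of C) ⟶ X} [IsOpenImmersion e]
    {θ : C →+* K} {γ : Spec (.of K) ⟶ X} [IsGeneric γ]
    (h : Spec.map (CommRingCat.ofHom θ) ≫ e = γ) {x : X} (hx : x ∈ Set.range e) :
    θ.range ≤ localRing γ x := by
  obtain ⟨y, rfl⟩ := hx
  obtain ⟨p, rfl⟩ := exists_specPt y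
  intro a ha
  exact (mem_localRing_chart θ e γ h p a).2 (mem_localFractions_of_mem_range ha)

/-- A prime ideal is recovered from its local ring as the set of non-units. Genericity puts the
kernel of `θ` in every prime, so nothing is lost in `K`. -/
lemma notMem_iff_exists_inv {C : Type u} [CommRing C] {θ : C →+* K}
    [hθ : IsGeneric (Spec.map (CommRingCat.ofHom θ))] (p : PrimeSpectrum C) (c : C) :
    c ∉ p.asIdeal ↔ ∃ a ∈ localFractions θ p, a * θ c = 1 := by
  have hker : RingHom.ker θ ≤ p.asIdeal := by
    have h := (PrimeSpectrum.le_iff_specializes _ _).2 (hθ.specializes (specPt p))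
    intro x hx
    refine h ?_
    change θ x ∈ IsLocalRing.maximalIdeal K
    rw [RingHom.mem_ker.1 hx]
    exact zero_mem _
  constructor
  · intro hc
    have h0 : θ c ≠ 0 := fun h => hc (hker h)
    exact ⟨(θ c)⁻¹, ⟨1, c, hc, by rw [inv_mul_cancel₀ h0, map_one]⟩, inv_mul_cancel₀ h0⟩
  · rintro ⟨a, ⟨r, s, hs, h⟩, hac⟩ hc
    refine hs ?_
    have : s - r * c ∈ RingHom.ker θ := by
      rw [RingHom.mem_ker, map_sub, map_mul, ← h]
      linear_combination -(θ s) * hac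
    rw [← sub_add_cancel s (r * c)]
    exact add_mem (hker this) (Ideal.mul_mem_left _ _ hc)

/-- Points of a separated scheme with the same residues of the functions on a chart at one of them
are equal. -/
lemma eq_of_localRing_inv_iff [X.IsSeparated] {C : Type u} [CommRing C] {e : Spec (.of C) ⟶ X}
    [IsOpenImmersion e] {θ : C →+* K} {γ : Spec (.of K) ⟶ X} [hγ : IsGeneric γ]
    (h : Spec.map (CommRingCat.ofHom θ) ≫ e = γ) {x y : X} (hx : x ∈ Set.range e)
    (hy : θ.range ≤ localRing γ y)
    (hxy : ∀ c, (∃ a ∈ localRing γ x, a * θ c = 1) ↔ ∃ a ∈ localRing γ y, a * θ c = 1) :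
    x = y := by
  obtain ⟨x, rfl⟩ := hx
  obtain ⟨y, rfl⟩ := mem_range_of_range_le_localRing θ e γ h y hy
  obtain ⟨p, rfl⟩ := exists_specPt x
  obtain ⟨q, rfl⟩ := exists_specPt y
  have : IsGeneric (Spec.map (CommRingCat.ofHom θ) ≫ e) := by rw [h]; exact hγ
  have := IsGeneric.of_comp (Spec.map (CommRingCat.ofHom θ)) e
  congr 2
  refine PrimeSpectrum.ext (Ideal.ext fun c => ?_)
  rw [← not_iff_not, notMem_iff_exists_inv (θ := θ), notMem_iff_exists_inv (θ := θ)]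
  simpa only [mem_localRing_chart θ e γ h] using hxy c

end Points

section Polytope

variable {k : Type u} [Field k] {n : ℕ} {K : Type u} [Field K]
  {ι : AddMonoidAlgebra k (Fin n → ℤ) →+* K}

/-- A projective toric variety carries a strictly convex piecewise linear function, which is linear
on the cones of the charts. -/
lemma exists_strictlyConvex_of_isProjective (hι : Function.Injective ι)
    (hfrac : ∀ a : K, ∃ r s, s ≠ 0 ∧ a * ι s = ι r) {X : Scheme.{u}} [X.IsSeparated]
    {p : X ⟶ Spec (.of k)} (hp : IsProjective p) {γ : Spec (.of K) ⟶ X} [IsGeneric γ]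
    (hγ : γ ≫ p = Spec.map (CommRingCat.ofHom (ι.comp (algebraMap k _)))) {T : Type*} [Nonempty T]
    (b : T → Module.Basis (Fin n) ℤ (Fin n → ℤ))
    (e : T → (Spec (.of (MvPolynomial (Fin n) k)) ⟶ X)) (hb : ∀ t, IsBasisChart ι γ (b t) (e t)) :
    ∃ m : T → Fin n → ℤ, (∀ s t i, 0 ≤ (b s).repr (m t - m s) i) ∧
      ∀ s t, m s = m t → ∀ a, (∀ i, 0 ≤ (b s).repr a i) ↔ ∀ i, 0 ≤ (b t).repr a i := by
  obtain ⟨N, g, hg⟩ := exists_projective_coordinates hp γ _ hγ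
  have hopen : ∀ t, IsOpenImmersion (e t) := fun t => (hb t).isOpenImmersion
  have hloc : ∀ t p x, x ∈ localRing γ (e t (specPt p)) ↔
      x ∈ localFractions (polyToField (b t) ι) p := fun t p x =>
    mem_localRing_chart _ _ _ (hb t).map_comp p x
  obtain ⟨F, H, m, r, hF, hgF, hH, hr⟩ := exists_vertices hι hfrac b g fun t p => by
    obtain ⟨l, hl, C, _, e', _, θ, hθ, hx, hj, -⟩ := hg (e t (specPt p))
    exact ⟨l, hl, fun j => (hloc t p _).1 (range_le_localRing hθ hx (hj j))⟩
  -- Thus the coefficients at the vertex `m t` are the homogeneous coordinates of the image of the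
  -- fixed point of chart `t`.
  have hcoeff : ∀ t j, (H j).coeff (m t) = MvPolynomial.constantCoeff (r t j) := by
    intro t j
    rw [hH t j, AddMonoidAlgebra.coeff_single_mul_apply, one_mul, neg_add_cancel,
      MvPolynomial.constantCoeff_eq, ← coeff_polyToTorus k (b t), map_zero (expHom (b t))]
  have hquot : ∀ t j l, MvPolynomial.constantCoeff (r t l) ≠ 0 →
      HasValue ι (b t) (g j / g l) ((H j).coeff (m t) / (H l).coeff (m t)) := by
    intro t j l hl
    refine ⟨r t j, r t l, hl, ?_, by rw [hcoeff, hcoeff, div_mul_cancel₀ _ hl]⟩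
    have hl0 : polyToField (b t) ι (r t l) ≠ 0 := by
      rw [Ne, map_eq_zero_iff _ (polyToField_injective (b := b t) hι)]
      intro h
      exact hl (by rw [h, map_zero])
    have hm := chi_ne_zero (ι := ι) (m t)
    have hval : ∀ j, g j = F * (chi ι (m t) * polyToField (b t) ι (r t j)) := by
      intro j
      rw [hgF, hH t j, map_mul, polyToField_apply]
      rfl
    rw [hval j, hval l]
    field_simp
  refine ⟨m, fun s t i => ?_, fun s t hst a => ?_⟩
  -- Some `H l` has `m t` in its support, whereas all its exponents lie in `m s` plus the cone
  -- spanned by `b s`.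
  · obtain ⟨l, hl⟩ := hr t (originPt k n)
    rw [mem_originPt, ← hcoeff, hH s l, AddMonoidAlgebra.coeff_single_mul_apply, one_mul] at hl
    by_contra! hneg
    refine hl (coeff_polyToTorus_eq_zero k (b s) (r s l) (i := i) ?_)
    rwa [neg_add_eq_sub]
  · obtain ⟨l, hl, C, _, e', _, θ, hθ, hx, hj, hC⟩ := hg (e s (specPt (originPt k n)))
    -- The index `l` comes from a standard chart through the image of the origin. Compared with some
    -- `l'` whose coordinate is nonzero there, the ratio `g l / g l'` is invertible at the origin,
    -- so its value is nonzero.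
    have hls : MvPolynomial.constantCoeff (r s l) ≠ 0 := by
      obtain ⟨l', hl'⟩ := hr s (originPt k n)
      rw [mem_originPt] at hl'
      have hgl' : g l' ≠ 0 := by
        intro h
        rw [hgF, mul_eq_zero, or_iff_right hF, map_eq_zero_iff _ hι] at h
        rw [← hcoeff, h] at hl'
        exact hl' rfl
      have := ((hquot s l l' hl').exists_inv_iff hι).1 ⟨g l' / g l,
        (hloc s _ _).1 (range_le_localRing hθ hx (hj l')),
        by rw [div_mul_div_cancel₀ hl, div_self hgl']⟩
      rw [← hcoeff]
      exact (div_ne_zero_iff.1 this).1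
    have hlt : MvPolynomial.constantCoeff (r t l) ≠ 0 := by
      rwa [← hcoeff, ← hst, hcoeff]
    have hvs : ∀ j, HasValue ι (b s) (g j / g l) _ := fun j => hquot s j l hls
    have hvt : ∀ j, HasValue ι (b t) (g j / g l) ((H j).coeff (m s) / (H l).coeff (m s)) :=
      fun j => by simpa only [← hst] using hquot t j l hlt
    -- If the vertices coincide, all ratios `g j / g l` have the same values at both origins, and so
    -- do the functions on the affine open set, which are polynomials in these. A closed immersion
    -- separates points, so the two origins coincide.
    have heq : e s (specPt (originPt k n)) = e t (specPt (originPt k n)) := by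
      refine eq_of_localRing_inv_iff hθ hx ?_ fun c => ?_
      · rintro _ ⟨c, rfl⟩
        obtain ⟨P, hP⟩ := hC c
        rw [hloc, hP]
        exact (HasValue.eval₂ hvt P).mem
      · obtain ⟨P, hP⟩ := hC c
        simp only [hloc, hP]
        rw [(HasValue.eval₂ hvs P).exists_inv_iff hι, (HasValue.eval₂ hvt P).exists_inv_iff hι]
    rw [← chi_mem_localFractions_originPt hι, ← chi_mem_localFractions_originPt hι, ← hloc, ← hloc,
      heq]

end Polytope

section Projective

attribute [local instance] MvPolynomial.gradedAlgebra

/-- `Proj` is proper over its degree zero part, which for the polynomial ring is `k`. -/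
lemma isProper_of_isProjective {k : Type u} [Field k] {X : Scheme.{u}} {p : X ⟶ Spec (.of k)}
    (hp : IsProjective p) : IsProper p := by
  obtain ⟨r, i, hi, rfl⟩ := hp
  have hbij : Function.Bijective (algebraMap k (polyGrading k r 0)) := by
    refine ⟨fun a b hab => MvPolynomial.C_injective (Fin (r + 1)) k (congrArg Subtype.val hab),
      fun x => ?_⟩
    obtain ⟨x, hx⟩ := x
    have hx' := MvPolynomial.totalDegree_eq_zero_iff_eq_C.1
      (Nat.le_zero.1 (MvPolynomial.IsHomogeneous.totalDegree_le hx))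
    exact ⟨_, Subtype.ext hx'.symm⟩
  have : IsScalarTower k (polyGrading k r 0) (MvPolynomial (Fin (r + 1)) k) :=
    ⟨fun a x y => smul_mul_assoc a (x : MvPolynomial (Fin (r + 1)) k) y⟩
  have : Algebra.FiniteType (polyGrading k r 0) (MvPolynomial (Fin (r + 1)) k) :=
    Algebra.FiniteType.of_restrictScalars_finiteType k _ _
  have h1 : IsProper (Proj.toSpecZero (polyGrading k r)) := inferInstance
  have h2 : IsIso (CommRingCat.ofHom (algebraMap k (polyGrading k r 0))) :=
    (ConcreteCategory.isIso_iff_bijective _).2 hbij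
  have h3 : IsProper (projSpaceToSpec k r) :=
    MorphismProperty.comp_mem _ _ _ h1 inferInstance
  exact MorphismProperty.comp_mem _ _ _ inferInstance h3

end Projective

/-! ### Rays and points of codimension one. -/

section Charts

variable {k : Type u} [Field k] {n : ℕ}

/-- The generic point of a coordinate hyperplane. -/
def primeX (k : Type u) [Field k] {n : ℕ} (i : Fin n) : PrimeSpectrum (MvPolynomial (Fin n) k) :=
  ⟨Ideal.span {MvPolynomial.X i},
    (Ideal.span_singleton_prime (MvPolynomial.X_ne_zero i)).2 (MvPolynomial.X_prime)⟩

lemma X_mem_primeX {i j : Fin n} : MvPolynomial.X j ∈ (primeX k i).asIdeal ↔ i = j :=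
  Ideal.mem_span_singleton.trans MvPolynomial.X_dvd_X

/-- By Krull's principal ideal theorem. Such a point survives any isomorphism in codimension one. -/
lemma coheight_primeX_lt {X : Scheme.{u}} (e : Spec (.of (MvPolynomial (Fin n) k)) ⟶ X)
    [IsOpenImmersion e] (i : Fin n) : ¬ 2 ≤ Order.coheight (e (specPt (primeX k i))) := by
  have h1 : Order.coheight (e (specPt (primeX k i))) = Order.coheight (specPt (primeX k i)) :=
    coheight_eq_of_isOpenImmersion e
  have h2 := idealHeight_eq_coheight (.of (MvPolynomial (Fin n) k)) (specPt (primeX k i))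
  have h3 : (primeX k i).asIdeal.height ≤ 1 := by
    have : (Ideal.span {MvPolynomial.X i} : Ideal (MvPolynomial (Fin n) k)).IsPrime :=
      (primeX k i).isPrime
    refine Ideal.height_le_one_of_isPrincipal_of_mem_minimalPrimes (Ideal.span {MvPolynomial.X i})
      _ ?_
    rw [Ideal.minimalPrimes_eq_subsingleton_self]
    rfl
  rw [h1, ← h2]
  intro h
  exact absurd (h.trans h3) (by norm_num)

variable {K : Type u} [Field K] {ι : AddMonoidAlgebra k (Fin n → ℤ) →+* K}

lemma chi_mem_localFractions_primeX {b : Module.Basis (Fin n) ℤ (Fin n → ℤ)}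
    (hι : Function.Injective ι) (i : Fin n) (m : Fin n → ℤ) :
    chi ι m ∈ localFractions (polyToField b ι) (primeX k i) ↔ 0 ≤ b.repr m i := by
  rw [chi_mem_localFractions b hι]
  simp only [X_mem_primeX, forall_eq']

lemma range_polyToField_le {b : Module.Basis (Fin n) ℤ (Fin n → ℤ)} {S : Subring K}
    (hC : ∀ c, ι (algebraMap k _ c) ∈ S) (hS : ∀ i, chi ι (b i) ∈ S) :
    (polyToField b ι).range ≤ S := by
  rintro _ ⟨f, rfl⟩
  induction f using MvPolynomial.induction_on with
  | C a => rw [polyToField_C]; exact hC a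
  | add p q hp hq => rw [map_add]; exact add_mem hp hq
  | mul_X p i hp =>
    rw [map_mul]
    refine mul_mem hp ?_
    rw [polyToField_apply, polyToTorus_X]
    exact hS i

end Charts

section Codimension

variable {k : Type u} [Field k] {K : Type u} [Field K]
  {ι : AddMonoidAlgebra k (Fin 3 → ℤ) →+* K} [IsGeneric (zFan.point ι)]

lemma mem_localRing_zChart (t : Fin 12) (p : PrimeSpectrum (MvPolynomial (Fin 3) k)) (a : K) :
    a ∈ localRing (zFan.point ι) (zChart k t (specPt p)) ↔
      a ∈ localFractions (polyToField (zBasis t) ι) p :=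
  mem_localRing_chart _ _ _ (isBasisChart_zChart k ι t).map_comp p a

variable {X : Scheme.{u}} {γ : Spec (.of K) ⟶ X} [IsGeneric γ]
  {b : Module.Basis (Fin 3) ℤ (Fin 3 → ℤ)} {e : Spec (.of (MvPolynomial (Fin 3) k)) ⟶ X}

/-- The generic point of the coordinate hyperplane corresponds to a point of the variety of `zFan`
with the same local ring. Its regular characters form a half space, so it is the generic point of a
coordinate hyperplane there too, with the same functional. -/
lemma IsBasisChart.exists_ray (hι : Function.Injective ι) (hb : IsBasisChart ι γ b e)
    (hX : ∀ y : X, ¬ 2 ≤ Order.coheight y → ∃ x, localRing (zFan.point ι) x = localRing γ y)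
    (i : Fin 3) : ∃ i', ∀ m, b.repr m i = intPairing m (zRay i') := by
  have := hb.isOpenImmersion
  obtain ⟨x, hx⟩ := hX _ (coheight_primeX_lt e i)
  obtain ⟨t, p, rfl⟩ := exists_zChart k x
  obtain ⟨i', hi'⟩ := exists_dual_eq (zBasis t) hι p (b.coord i : (Fin 3 → ℤ) →ₗ[ℤ] ℤ).toAddMonoidHom
    ⟨b i, by simp⟩ fun m => by
      rw [← mem_localRing_zChart, hx, mem_localRing_chart _ _ _ hb.map_comp,
        chi_mem_localFractions_primeX hι]
      rfl
  refine ⟨triple t i', fun m => ?_⟩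
  rw [← zBasis_repr, hi']
  rfl

/-- A ray of `zFan` inside the cone of the chart gives a codimension one point of `X` at which the
coordinates of the chart are regular. By separatedness the point lies in the chart, and it is the
generic point of a coordinate hyperplane; so the ray is an edge of the cone. -/
lemma IsBasisChart.exists_eq_ray [X.IsSeparated] (hι : Function.Injective ι)
    (hb : IsBasisChart ι γ b e)
    (hX : ∀ x : zFan.variety k, ¬ 2 ≤ Order.coheight x →
      ∃ y, localRing (zFan.point ι) x = localRing γ y) (i : Fin 8)
    (hi : ∀ j, 0 ≤ intPairing (b j) (zRay i)) : ∃ j, ∀ m, b.repr m j = intPairing m (zRay i) := by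
  have := hb.isOpenImmersion
  obtain ⟨t, l, rfl⟩ := exists_triple_eq i
  obtain ⟨y, hy⟩ := hX _ (coheight_primeX_lt (zChart k t) l)
  have hmem : ∀ a, a ∈ localRing γ y ↔
      a ∈ localFractions (polyToField (zBasis t) ι) (primeX k l) := fun a => by
    rw [← hy, mem_localRing_zChart]
  obtain ⟨q, rfl⟩ := mem_range_of_range_le_localRing _ e γ hb.map_comp y
    (range_polyToField_le (fun c => by
      rw [hmem, ← polyToField_C (zBasis t)]
      exact mem_localFractions_of_mem_range ⟨_, rfl⟩) fun j => by
      rw [hmem, chi_mem_localFractions_primeX hι, zBasis_repr]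
      exact hi j)
  obtain ⟨q, rfl⟩ := exists_specPt q
  obtain ⟨j, hj⟩ := exists_dual_eq b hι q ((zBasis t).coord l : (Fin 3 → ℤ) →ₗ[ℤ] ℤ).toAddMonoidHom
    ⟨zBasis t l, by simp⟩ fun m => by
      rw [← mem_localRing_chart _ _ _ hb.map_comp, hmem, chi_mem_localFractions_primeX hι]
      rfl
  refine ⟨j, fun m => ?_⟩
  rw [hj, ← zBasis_repr]
  rfl

end Codimension

/-! ### Rigidity of the fan and nonprojectivity. -/

lemma zRay_injective : Function.Injective zRay := by decide +kernel

lemma eq_of_forall_intPairing {n : ℕ} {v w : Fin n → ℤ} (h : ∀ m, intPairing m v = intPairing m w) :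
    v = w := by
  funext i
  simpa [intPairing, Pi.single_apply] using h (Pi.single i 1)

lemma zBasis_nonneg_injective {s t : Fin 12}
    (h : ∀ m, (∀ i, 0 ≤ (zBasis s).repr m i) ↔ ∀ i, 0 ≤ (zBasis t).repr m i) : s = t := by
  have key : ∀ s t, s ≠ t → ∃ i j, intPairing (dualVec s i) (zRay (triple t j)) < 0 := by
    decide +kernel
  by_contra hst
  obtain ⟨i, j, hij⟩ := key s t hst
  have := (h (zBasis s i)).1 (fun j => by
    rw [Module.Basis.repr_self, Finsupp.single_apply]; split_ifs <;> simp) j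
  rw [zBasis_repr, zBasis_apply] at this
  exact absurd this hij.not_ge

variable {k : Type u} [Field k]

/-- Choose a chart whose cone contains the interior point of the cone `t`. Its edges are rays of
`zFan` and it contains no other rays, so the finite check identifies it with `t` up to the order of
the edges. -/
lemma exists_basisChart_iff {K : Type u} [Field K]
    {ι : AddMonoidAlgebra k (Fin 3 → ℤ) →+* K} [IsGeneric (zFan.point ι)]
    (hι : Function.Injective ι) {X : Scheme.{u}} [X.IsSeparated] {γ : Spec (.of K) ⟶ X}
    [IsGeneric γ]
    (hchart : ∀ W : (Fin 3 → ℤ) →+ ℤ, ∃ b e, IsBasisChart ι γ b e ∧ ∀ i, 0 ≤ W (b i))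
    (h₁ : ∀ x : zFan.variety k, ¬ 2 ≤ Order.coheight x →
      ∃ y, localRing (zFan.point ι) x = localRing γ y)
    (h₂ : ∀ y : X, ¬ 2 ≤ Order.coheight y → ∃ x, localRing (zFan.point ι) x = localRing γ y)
    (t : Fin 12) : ∃ b e, IsBasisChart ι γ b e ∧
      ∀ m, (∀ i, 0 ≤ b.repr m i) ↔ ∀ i, 0 ≤ (zBasis t).repr m i := by
  obtain ⟨b, e, hb, hW⟩ := hchart
    { toFun := fun m => intPairing m (interiorPoint t)
      map_zero' := intPairing_zero_left _
      map_add' := fun m m' => intPairing_add_left m m' _ }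
  choose p hp using hb.exists_ray hι h₂
  have hperm := exists_perm_of_interiorPoint b p (fun m i => hp i m) (fun i hi => by
    obtain ⟨j, hj⟩ := hb.exists_eq_ray hι h₁ i hi
    exact ⟨j, zRay_injective (eq_of_forall_intPairing fun m => by rw [← hj, hp])⟩) t hW
  choose σ hσ using hperm
  have hσinj : Function.Injective σ := fun i j hij =>
    triple_injective t (by rw [hσ, hσ, hij])
  have hσsurj := Finite.surjective_of_injective hσinj
  refine ⟨b, e, hb, fun m => ⟨fun h j => ?_, fun h i => ?_⟩⟩
  · rw [zBasis_repr, hσ, ← hp]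
    exact h _
  · obtain ⟨j, rfl⟩ := hσsurj i
    rw [hp, ← hσ, ← zBasis_repr]
    exact h j

/-- A toric variety that is isomorphic in codimension one to the variety of `zFan` is not both
smooth and projective. -/
lemma not_isProjective_of_isBasisChart {K : Type u} [Field K]
    {ι : AddMonoidAlgebra k (Fin 3 → ℤ) →+* K} [IsGeneric (zFan.point ι)]
    (hι : Function.Injective ι) (hfrac : ∀ a : K, ∃ r s, s ≠ 0 ∧ a * ι s = ι r)
    {X : Scheme.{u}} {p : X ⟶ Spec (.of k)} {γ : Spec (.of K) ⟶ X}
    [IsGeneric γ] (hγ : γ ≫ p = Spec.map (CommRingCat.ofHom (ι.comp (algebraMap k _))))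
    (hchart : ∀ W : (Fin 3 → ℤ) →+ ℤ, ∃ b e, IsBasisChart ι γ b e ∧ ∀ i, 0 ≤ W (b i))
    (h₁ : ∀ x : zFan.variety k, ¬ 2 ≤ Order.coheight x →
      ∃ y, localRing (zFan.point ι) x = localRing γ y)
    (h₂ : ∀ y : X, ¬ 2 ≤ Order.coheight y → ∃ x, localRing (zFan.point ι) x = localRing γ y) :
    ¬ IsProjective p := by
  intro hp
  have hproper := isProper_of_isProjective hp
  have : X.IsSeparated := by
    refine ⟨?_⟩
    rw [← terminal.comp_from p]
    infer_instance
  choose b e hb hiff using exists_basisChart_iff hι hchart h₁ h₂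
  obtain ⟨m, hm, hm'⟩ := exists_strictlyConvex_of_isProjective hι hfrac hp hγ b e hb
  refine not_exists_strictlyConvex m (fun s t i => ?_) fun s t hst => ?_
  · have := (hiff s _).1 (hm s t) i
    rw [zBasis_repr, intPairing_sub_left] at this
    linarith
  · exact zBasis_nonneg_injective fun a => by rw [← hiff, ← hiff, hm' s t hst]

lemma Fan.point_toSpec {n : ℕ} (F : Fan n) {K : Type u} [Field K]
    (ι : AddMonoidAlgebra k (Fin n → ℤ) →+* K) :
    F.point ι ≫ F.toSpec k = Spec.map (CommRingCat.ofHom (ι.comp (algebraMap k _))) := by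
  rw [Fan.point, Category.assoc, F.torusι_toSpec k, ← Spec.map_comp]
  rfl

/-- Everything is compared in the fraction field of the Laurent ring. The toric map supplies the
isomorphism `L` of character lattices, which forces `n = 3`, and smoothness with properness supplies
the charts. -/
lemma not_smooth_of_isProjective {n : ℕ} (F : Fan n)
    (f : (zFan.variety k).PartialIso (F.variety k)) (hf : IsToric f) (hf' : IsIsoInCodimOne f)
    (hp : IsProjective (F.toSpec k)) : ¬ Smooth (F.toSpec k) := by
  intro hsm
  let A := AddMonoidAlgebra k (Fin 3 → ℤ)
  let ι : A →+* FractionRing A := algebraMap A (FractionRing A)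
  have hι : Function.Injective ι := IsFractionRing.injective A (FractionRing A)
  have hfrac : ∀ a, ∃ r s, s ≠ 0 ∧ a * ι s = ι r := by
    intro a
    obtain ⟨r, s, hs, rfl⟩ := IsFractionRing.div_surjective A a
    have hs0 := nonZeroDivisors.ne_zero hs
    exact ⟨r, s, hs0, div_mul_cancel₀ _ ((map_ne_zero_iff _ hι).2 hs0)⟩
  obtain ⟨L, ι', γ₀, hι', hL, hs, ht⟩ := hf.exists_point hι
  obtain rfl : n = 3 := by
    simpa using L.toIntLinearEquiv.finrank_eq
  have := zFan.isGeneric_point hι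
  have := F.isGeneric_point hι'
  have := isProper_of_isProjective hp
  refine not_isProjective_of_isBasisChart hι hfrac (γ := F.point ι') ?_ (fun W => ?_)
    (fun x hx => ?_) (fun y hy => ?_) hp
  · rw [F.point_toSpec]
    congr 2
    ext c
    simp only [RingHom.comp_apply, AddMonoidAlgebra.coe_algebraMap, Function.comp_apply]
    rw [hL, map_zero]
  · obtain ⟨b, e, hb, hW⟩ := F.exists_basisChart_nonneg ι' (W.comp L.toAddMonoidHom)
    exact ⟨_, e, hb.map hL, fun i => by simpa using hW i⟩
  · exact exists_localRing_eq_of_mem_source f hs ht (by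
      by_contra h
      exact hx (hf'.1 x h))
  · exact exists_localRing_eq_of_mem_target f hs ht (by
      by_contra h
      exact hy (hf'.2 y h))

/-! ### Properness -/

section LimitPoints

variable {k : Type u} [Field k] {n : ℕ} {K : Type u} [Field K]

/-- The limit at `t = 0` of the point `t^u h` of the torus in an affine toric variety, as a
homomorphism from the coordinate ring. -/
def limitHom (σ : PointedCone ℝ (Fin n → ℝ)) (c : k →+* K) (u : (Fin n → ℤ) →ₗ[ℤ] ℤ)
    (hu : ∀ m ∈ dualMonoid σ, 0 ≤ u m) (h : (Fin n → ℤ) →ₗ[ℤ] Additive Kˣ) : coneRing k σ →+* K :=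
  AddMonoidAlgebra.liftNCRingHom c
    { toFun := fun m => if u (m.toAdd : Fin n → ℤ) = 0 then
        ((h (m.toAdd : Fin n → ℤ)).toMul : K) else 0
      map_one' := by simp
      map_mul' := fun a b => by
        have ha := hu _ a.toAdd.2
        have hb := hu _ b.toAdd.2
        simp only [toAdd_mul, AddSubmonoid.coe_add, map_add, toMul_add, Units.val_mul]
        by_cases h1 : u (a.toAdd : Fin n → ℤ) = 0
        · by_cases h2 : u (b.toAdd : Fin n → ℤ) = 0
          · rw [if_pos h1, if_pos h2, if_pos (by rw [h1, h2, add_zero])]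
          · rw [if_neg h2, if_neg (by omega), mul_zero]
        · rw [if_neg h1, if_neg (by omega), zero_mul] }
    fun _ _ => Commute.all _ _

variable {c : k →+* K} {u : (Fin n → ℤ) →ₗ[ℤ] ℤ} {h : (Fin n → ℤ) →ₗ[ℤ] Additive Kˣ}

lemma limitHom_single {σ : PointedCone ℝ (Fin n → ℝ)} (hu : ∀ m ∈ dualMonoid σ, 0 ≤ u m)
    (m : dualMonoid σ) (r : k) :
    limitHom σ c u hu h (AddMonoidAlgebra.single m r) =
      c r * if u (m : Fin n → ℤ) = 0 then ((h (m : Fin n → ℤ)).toMul : K) else 0 :=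
  AddMonoidAlgebra.liftNCRingHom_single ..

lemma limitHom_comp {σ τ : PointedCone ℝ (Fin n → ℝ)} (hle : τ ≤ σ)
    (hu : ∀ m ∈ dualMonoid τ, 0 ≤ u m) :
    (limitHom τ c u hu h).comp (coneRingMap k hle) =
      limitHom σ c u (fun m hm => hu m (dualMonoid_anti hle hm)) h := by
  refine AddMonoidAlgebra.ringHom_ext (fun r => ?_) fun m => ?_
  · rw [RingHom.comp_apply, coneRingMap_single, limitHom_single, limitHom_single]
    rfl
  · rw [RingHom.comp_apply, coneRingMap_single, limitHom_single, limitHom_single]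
    rfl

lemma polyEquivCone_X {σ : PointedCone ℝ (Fin n → ℝ)}
    (b : Module.Basis (Fin n) ℤ (Fin n → ℤ)) (hb : ∀ m, m ∈ dualMonoid σ ↔ ∀ i, 0 ≤ b.repr m i)
    (i : Fin n) (hi : b i ∈ dualMonoid σ) :
    polyEquivCone k b hb (MvPolynomial.X i) = AddMonoidAlgebra.single ⟨b i, hi⟩ 1 := by
  apply coneToTorus_injective k σ
  rw [coneToTorus_single, ← polyToTorus_X]
  exact RingHom.congr_fun (coneToTorus_polyEquivCone k b hb) (MvPolynomial.X i)

/-- In affine space, `u` is the indicator of the vanishing coordinates and `h` records the others.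
Where a coordinate vanishes, `h` is set to the unit 1 (written additively as 0), an arbitrary choice
that the limit does not see. -/
lemma exists_eq_limitHom {σ : PointedCone ℝ (Fin n → ℝ)} (b : Module.Basis (Fin n) ℤ (Fin n → ℤ))
    (hb : ∀ m, m ∈ dualMonoid σ ↔ ∀ i, 0 ≤ b.repr m i) (φ : coneRing k σ →+* K) :
    ∃ u hu h, φ = limitHom σ (φ.comp (algebraMap k _)) u hu h := by
  classical
  have hmem : ∀ i, b i ∈ dualMonoid σ := fun i => (hb _).2 fun j => by
    rw [Module.Basis.repr_self, Finsupp.single_apply]; split_ifs <;> simp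
  let a : Fin n → K := fun i => φ (AddMonoidAlgebra.single ⟨b i, hmem i⟩ 1)
  let u : (Fin n → ℤ) →ₗ[ℤ] ℤ := b.constr ℤ fun i => if a i = 0 then 1 else 0
  let h : (Fin n → ℤ) →ₗ[ℤ] Additive Kˣ := b.constr ℤ fun i =>
    if ha : a i = 0 then 0 else Additive.ofMul (Units.mk0 (a i) ha)
  have hu : ∀ m ∈ dualMonoid σ, 0 ≤ u m := fun m hm => by
    rw [Module.Basis.constr_apply_fintype]
    refine Finset.sum_nonneg fun i _ => smul_nonneg ((hb m).1 hm i) ?_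
    split_ifs <;> simp
  refine ⟨u, hu, h, ?_⟩
  have key : φ.comp (polyEquivCone k b hb : MvPolynomial (Fin n) k →+* coneRing k σ) =
      (limitHom σ (φ.comp (algebraMap k _)) u hu h).comp
        (polyEquivCone k b hb : MvPolynomial (Fin n) k →+* coneRing k σ) := by
    apply MvPolynomial.ringHom_ext
    · intro r
      have : polyEquivCone k b hb (MvPolynomial.C r) = AddMonoidAlgebra.single 0 r :=
        (polyEquivCone k b hb).commutes r
      rw [RingHom.comp_apply, RingHom.comp_apply, RingHom.coe_coe, this, limitHom_single]
      simp
    · intro i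
      rw [RingHom.comp_apply, RingHom.comp_apply, RingHom.coe_coe, polyEquivCone_X b hb i (hmem i),
        limitHom_single, map_one, one_mul]
      simp only [u, h, Module.Basis.constr_basis]
      change a i = _
      by_cases ha : a i = 0
      · rw [if_pos ha, if_neg one_ne_zero, ha]
      · rw [if_neg ha, if_pos rfl, dif_neg ha]
        rfl
  refine RingHom.ext fun x => ?_
  obtain ⟨y, rfl⟩ := (polyEquivCone k b hb).surjective x
  exact RingHom.congr_fun key y

/-- Both limits come from the chart of the common face. -/
lemma Fan.limitHom_chart_eq (F : Fan n) (σ τ : F.cones) (hσ : ∀ m ∈ dualMonoid (σ.1 ⊓ τ.1), 0 ≤ u m) :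
    Spec.map (CommRingCat.ofHom (limitHom σ.1 c u
        (fun m hm => hσ m (dualMonoid_anti inf_le_left hm)) h)) ≫ F.chart k σ =
      Spec.map (CommRingCat.ofHom (limitHom τ.1 c u
        (fun m hm => hσ m (dualMonoid_anti inf_le_right hm)) h)) ≫ F.chart k τ := by
  let ρ : F.cones := ⟨σ.1 ⊓ τ.1, F.face_mem _ σ.2 _ (F.inter_face _ σ.2 _ τ.2).1⟩
  have h1 : ρ.1 ≤ σ.1 := inf_le_left
  have h2 : ρ.1 ≤ τ.1 := inf_le_right
  rw [← limitHom_comp h1 hσ, ← limitHom_comp h2 hσ, CommRingCat.ofHom_comp, CommRingCat.ofHom_comp,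
    Spec.map_comp, Spec.map_comp, Category.assoc, Category.assoc, F.map_chart k, F.map_chart k]

end LimitPoints

lemma exists_separator (s t : Fin 12) : ∃ m : Fin 3 → ℤ, m ∈ dualMonoid (zCone s).1 ∧
    -m ∈ dualMonoid (zCone t).1 ∧
    ∀ v, v ∈ (zCone s).1 ⊓ (zCone t).1 ↔ v ∈ (zCone s).1 ∧ pairing m v = 0 := by
  obtain ⟨m, h1, h2, h3⟩ := hasSeparators _ (triple_mem s) _ (triple_mem t)
  have hs : ∀ i ∈ Finset.univ.image (triple s), 0 ≤ intPairing m (zRay i) := fun i hi => by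
    by_cases h : i ∈ Finset.univ.image (triple t)
    · exact (h3 i hi h).ge
    · exact (h1 i hi h).le
  have ht : ∀ i ∈ Finset.univ.image (triple t), 0 ≤ intPairing (-m) (zRay i) := fun i hi => by
    rw [intPairing_neg_left]
    by_cases h : i ∈ Finset.univ.image (triple s)
    · exact (neg_eq_zero.2 (h3 i h hi)).ge
    · exact (neg_pos.2 (h2 i hi h)).le
  have hs' : m ∈ dualMonoid (zCone s).1 := mem_dualMonoid_simplexCone.2 hs
  have ht' : -m ∈ dualMonoid (zCone t).1 := mem_dualMonoid_simplexCone.2 ht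
  refine ⟨m, hs', ht', fun v => ⟨fun hv => ⟨hv.1, le_antisymm ?_ (hs' v hv.1)⟩, fun hv => ⟨hv.1, ?_⟩⟩⟩
  · have := ht' v hv.2
    rw [pairing_neg_left] at this
    linarith
  · obtain ⟨a, ha, ha', rfl⟩ := (mem_simplexCone zRay).1 hv.1
    refine (mem_simplexCone zRay).2 ⟨a, ha, fun i hi => ?_, rfl⟩
    by_cases h : i ∈ Finset.univ.image (triple s)
    · exact coeff_eq_zero_of_pairing ha ha' hs hv.2 i (h1 i h hi)
    · exact ha' i h

/-- A separating `m₀` is nonnegative on one cone and nonpositive on the other, so `u` vanishes on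
it. Adding multiples of `m₀` moves a character of the common face into the dual of the cone `s`
without changing `u`. -/
lemma nonneg_dualMonoid_inf {s t : Fin 12} {u : (Fin 3 → ℤ) →ₗ[ℤ] ℤ}
    (hs : ∀ m ∈ dualMonoid (zCone s).1, 0 ≤ u m) (ht : ∀ m ∈ dualMonoid (zCone t).1, 0 ≤ u m) :
    ∀ m ∈ dualMonoid ((zCone s).1 ⊓ (zCone t).1), 0 ≤ u m := by
  intro m hm
  obtain ⟨m₀, h1, h2, h3⟩ := exists_separator s t
  obtain ⟨N, hN⟩ := exists_nat_dual (Set.toFinite _) rfl h1 h3 hm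
  have h4 := hs _ hN
  have h5 := hs _ h1
  have h6 := ht _ h2
  rw [map_neg] at h6
  rw [map_add, map_nsmul, le_antisymm (by linarith) h5, smul_zero, add_zero] at h4
  exact h4

lemma exists_comp_eq_of_range_le {A R K : Type*} [Ring A] [Ring R] [Ring K] {i : R →+* K}
    (hi : Function.Injective i) {ψ : A →+* K} (h : ψ.range ≤ i.range) :
    ∃ ψ' : A →+* R, i.comp ψ' = ψ := by
  let e : R ≃+* i.range := RingEquiv.ofBijective i.rangeRestrict
    ⟨fun x y hxy => hi (congrArg Subtype.val hxy), i.rangeRestrict_surjective⟩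
  refine ⟨e.symm.toRingHom.comp ((Subring.inclusion h).comp ψ.rangeRestrict), RingHom.ext fun x => ?_⟩
  exact congrArg Subtype.val (e.apply_symm_apply (Subring.inclusion h (ψ.rangeRestrict x)))

section Valuative

variable {k : Type u} [Field k]

/-- The given `K`-point may lie on the boundary, so it is written as a limit of `t^u h`.
Completeness of the fan over a lexicographic group, with `u` first and the valuation of `h` second,
gives a cone `t` whose chart contains the point, with integral coordinates there. -/
lemma existence_zFan : ValuativeCriterion.Existence (zFan.toSpec k) := by
  rintro ⟨R, K, i₁, i₂, ⟨hsq⟩⟩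
  obtain ⟨s, p, hp⟩ := exists_zChart k (i₁ (specPt (IsLocalRing.closedPoint K)))
  have hs : i₁ (specPt (IsLocalRing.closedPoint K)) ∈ Set.range (zFan.chart k (zCone s)) := by
    rw [← zFan.range_basisChart k (zCone s) (zBasis s) fun _ => mem_dualMonoid_zCone]
    exact ⟨_, hp⟩
  obtain ⟨φ, rfl⟩ := exists_factor_chart i₁ _ hs
  obtain ⟨u, hu, h, hφ⟩ := exists_eq_limitHom (zBasis s) (fun _ => mem_dualMonoid_zCone) φ
  obtain ⟨c₀, rfl⟩ : ∃ c₀ : k →+* R, Spec.map (CommRingCat.ofHom c₀) = i₂ :=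
    ⟨(Spec.preimage i₂).hom, by rw [CommRingCat.ofHom_hom, Spec.map_preimage]⟩
  have hc : φ.comp (algebraMap k _) = (algebraMap R K).comp c₀ := by
    rw [Category.assoc, zFan.chart_toSpec k, ← Spec.map_comp, ← Spec.map_comp] at hsq
    exact congrArg CommRingCat.Hom.hom (Spec.map_injective hsq)
  let v := ValuationRing.valuation R K
  -- The sign is reversed since integral elements have multiplicative valuation at most 1.
  let w : (Fin 3 → ℤ) →+ Additive (ValuationRing.ValueGroup R K)ˣ :=
    -((MonoidHom.toAdditive (Units.map (v : K →* ValuationRing.ValueGroup R K))).comp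
      h.toAddMonoidHom)
  let W : (Fin 3 → ℤ) →+ ℤ ×ₗ Additive (ValuationRing.ValueGroup R K)ˣ :=
    { toFun := fun m => toLex (u m, w m)
      map_zero' := by rw [map_zero, map_zero]; rfl
      map_add' := fun a b => by rw [map_add, map_add]; rfl }
  obtain ⟨t, ht⟩ := exists_zBasis_nonneg W
  have hW : ∀ m ∈ dualMonoid (zCone t).1, 0 ≤ W m := fun m hm => by
    rw [← (zBasis t).sum_repr m, map_sum]
    refine Finset.sum_nonneg fun i _ => ?_
    rw [map_zsmul]
    exact zsmul_nonneg (ht i) (mem_dualMonoid_zCone.1 hm i)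
  have hW' : ∀ m ∈ dualMonoid (zCone t).1, 0 < u m ∨ 0 = u m ∧ 0 ≤ w m := fun m hm =>
    Prod.Lex.le_iff.1 (hW m hm)
  have hut : ∀ m ∈ dualMonoid (zCone t).1, 0 ≤ u m := fun m hm =>
    (hW' m hm).elim le_of_lt fun h => h.1.le
  have hrange : (limitHom (zCone t).1 ((algebraMap R K).comp c₀) u hut h).range ≤
      (algebraMap R K).range := by
    rintro _ ⟨x, rfl⟩
    induction x using AddMonoidAlgebra.induction_linear with
    | zero => rw [map_zero]; exact zero_mem _
    | add f g hf hg => rw [map_add]; exact add_mem hf hg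
    | single m r =>
      rw [limitHom_single]
      refine mul_mem ⟨c₀ r, rfl⟩ ?_
      split_ifs with hm
      · have hw := ((hW' m m.2).resolve_left hm.le.not_gt).2
        refine (ValuationRing.mem_integer_iff R K _).1 ?_
        have : (Units.map (v : K →* ValuationRing.ValueGroup R K)) (h m).toMul ≤ 1 :=
          one_le_inv'.1 hw
        exact this
      · exact zero_mem _
  obtain ⟨ψ, hψ⟩ := exists_comp_eq_of_range_le (IsFractionRing.injective R K) hrange
  refine ⟨⟨⟨Spec.map (CommRingCat.ofHom ψ) ≫ zFan.chart k (zCone t), ?_, ?_⟩⟩⟩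
  · have := zFan.limitHom_chart_eq (c := (algebraMap R K).comp c₀) (h := h) (zCone s) (zCone t)
      (nonneg_dualMonoid_inf hu hut)
    rw [← hc, ← hφ, hc, ← hψ, CommRingCat.ofHom_comp, Spec.map_comp, Category.assoc] at this
    exact this.symm
  · rw [Category.assoc, zFan.chart_toSpec k, ← Spec.map_comp, ← CommRingCat.ofHom_comp]
    congr 2
    refine RingHom.ext fun r => IsFractionRing.injective R K ?_
    have := RingHom.congr_fun hψ (algebraMap k _ r)
    rw [RingHom.comp_apply] at this ⊢
    rw [this, AddMonoidAlgebra.coe_algebraMap, Function.comp_apply, limitHom_single]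
    simp

/-- Let two lifts lie in the charts `s` and `t`, and let `m` separate these cones. The values of
`χ^m` and `χ^(-m)` under the two lifts are in `R` and have product 1, so both are units. Hence the
first lift factors through the chart of the common face, and so does the second, by the same map,
because `R` embeds in `K`. -/
lemma uniqueness_zFan : ValuativeCriterion.Uniqueness (zFan.toSpec k) := by
  rintro ⟨R, K, i₁, i₂, ⟨hsq⟩⟩
  refine ⟨fun ⟨l, hl, _⟩ ⟨l', hl', _⟩ => CommSq.LiftStruct.ext ?_⟩
  change l = l'
  replace hl := hl.trans hl'.symm
  have hlift : ∀ l : Spec (.of R) ⟶ zFan.variety k, ∃ (t : Fin 12) (g : coneRing k (zCone t).1 →+* R),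
      Spec.map (CommRingCat.ofHom g) ≫ zFan.chart k (zCone t) = l := fun l => by
    obtain ⟨t, p, hp⟩ := exists_zChart k (l (specPt (IsLocalRing.closedPoint R)))
    obtain ⟨g, hg⟩ := exists_factor_chart l (zFan.chart k (zCone t)) (by
      rw [← zFan.range_basisChart k (zCone t) (zBasis t) fun _ => mem_dualMonoid_zCone]
      exact ⟨_, hp⟩)
    exact ⟨t, g, hg⟩
  obtain ⟨s, g, rfl⟩ := hlift l
  obtain ⟨t, g', rfl⟩ := hlift l'
  obtain ⟨m, h1, h2, h3⟩ := exists_separator s t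
  let ρ : zFan.cones := ⟨(zCone s).1 ⊓ (zCone t).1,
    zFan.face_mem _ (zCone s).2 _ (zFan.inter_face _ (zCone s).2 _ (zCone t).2).1⟩
  have hs : ρ.1 ≤ (zCone s).1 := inf_le_left
  have ht : ρ.1 ≤ (zCone t).1 := inf_le_right
  have hl2 : Spec.map (CommRingCat.ofHom ((algebraMap R K).comp g)) ≫ zFan.chart k (zCone s) =
      Spec.map (CommRingCat.ofHom ((algebraMap R K).comp g')) ≫ zFan.chart k (zCone t) := by
    rw [CommRingCat.ofHom_comp, CommRingCat.ofHom_comp, Spec.map_comp, Spec.map_comp,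
      Category.assoc, Category.assoc]
    exact hl
  obtain ⟨κ, hκ⟩ : ∃ κ : coneRing k ρ.1 →+* K, Spec.map (CommRingCat.ofHom κ) ≫ zFan.chart k ρ =
      Spec.map (CommRingCat.ofHom ((algebraMap R K).comp g)) ≫ zFan.chart k (zCone s) := by
    refine exists_factor_chart _ _ ?_
    have h := congrArg (fun f => f (specPt (IsLocalRing.closedPoint K))) hl2
    obtain ⟨τ, fs, ft, x, hxs, -⟩ := (Scheme.IsLocallyDirected.ι_eq_ι_iff (zFan.diagram k)).1 h
    let f : τ ⟶ ρ := homOfLE (show τ.1 ≤ ρ.1 from le_inf (leOfHom fs) (leOfHom ft))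
    refine ⟨(zFan.diagram k).map f x, ?_⟩
    have h1 : (zFan.diagram k).map f ≫ zFan.chart k ρ = zFan.chart k τ := colimit.w _ f
    have h2 : (zFan.diagram k).map fs ≫ zFan.chart k (zCone s) = zFan.chart k τ := colimit.w _ fs
    exact (congrArg (fun f => f x) (h1.trans h2.symm)).trans
      (congrArg (zFan.chart k (zCone s)) hxs)
  have hκs : κ.comp (coneRingMap k hs) = (algebraMap R K).comp g := by
    refine Spec_map_comp_chart_injective (zFan.chart k (zCone s)) ?_
    rw [← hκ, CommRingCat.ofHom_comp, Spec.map_comp, Category.assoc, zFan.map_chart k]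
  have hκt : κ.comp (coneRingMap k ht) = (algebraMap R K).comp g' := by
    refine Spec_map_comp_chart_injective (zFan.chart k (zCone t)) ?_
    rw [← hl2, ← hκ, CommRingCat.ofHom_comp, Spec.map_comp, Category.assoc, zFan.map_chart k]
  let χ : coneRing k (zCone s).1 := AddMonoidAlgebra.single ⟨m, h1⟩ 1
  let χ' : coneRing k (zCone t).1 := AddMonoidAlgebra.single ⟨-m, h2⟩ 1
  have hχ : coneRingMap k hs χ * coneRingMap k ht χ' = 1 := by
    rw [coneRingMap_single, coneRingMap_single, AddMonoidAlgebra.single_mul_single, mul_one,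
      AddMonoidAlgebra.one_def]
    congr 1
    exact Subtype.ext (add_neg_cancel m)
  have hunit : IsUnit (g χ) := by
    refine IsUnit.of_mul_eq_one (g' χ') (IsFractionRing.injective R K ?_)
    rw [map_mul, ← RingHom.comp_apply, ← hκs, ← RingHom.comp_apply, ← hκt, RingHom.comp_apply,
      RingHom.comp_apply, ← map_mul, hχ, map_one, map_one]
  let := (coneRingMap k hs).toAlgebra
  have hloc : IsLocalization.Away χ (coneRing k ρ.1) := isLocalization_coneRing k (Set.toFinite _) rfl h1 h3 hs
  let G : coneRing k ρ.1 →+* R := IsLocalization.Away.lift χ hunit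
  have hG : G.comp (coneRingMap k hs) = g := IsLocalization.Away.lift_comp χ hunit
  have hGκ : (algebraMap R K).comp G = κ := by
    refine IsLocalization.ringHom_ext (Submonoid.powers χ) ?_
    change ((algebraMap R K).comp G).comp (coneRingMap k hs) = κ.comp (coneRingMap k hs)
    rw [RingHom.comp_assoc, hG, hκs]
  have hG' : G.comp (coneRingMap k ht) = g' := by
    refine RingHom.ext fun x => IsFractionRing.injective R K ?_
    rw [← RingHom.comp_apply, ← RingHom.comp_assoc, hGκ, hκt]
    rfl
  rw [← hG, ← hG', CommRingCat.ofHom_comp, CommRingCat.ofHom_comp, Spec.map_comp, Spec.map_comp,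
    Category.assoc, Category.assoc, zFan.map_chart k, zFan.map_chart k]

lemma isProper_zFan (k : Type u) [Field k] : IsProper (zFan.toSpec k) := by
  have := smooth_zFan k
  have : Smooth (zFan.toSpec k) := SmoothOfRelativeDimension.smooth 3 _
  have : LocallyOfFiniteType (zFan.toSpec k) := inferInstance
  have : CompactSpace (zFan.variety k) := by
    have : ∀ i, CompactSpace ((zCover k).X i) := fun i =>
      inferInstanceAs (CompactSpace (Spec (.of (MvPolynomial (Fin 3) k))))
    have : Finite (zCover k).I₀ := inferInstanceAs (Finite (Fin 12))
    exact (zCover k).compactSpace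
  have : QuasiCompact (zFan.toSpec k) := (quasiCompact_iff_compactSpace _).2 this
  have : IsLocallyNoetherian (zFan.variety k) := LocallyOfFiniteType.isLocallyNoetherian (zFan.toSpec k)
  exact IsProper.of_valuativeCriterion _
    (ValuativeCriterion.iff.2 ⟨existence_zFan, uniqueness_zFan⟩)

end Valuative

/-! ### The Picard group -/

section FunctionField

variable (X : Scheme.{u}) [IsIntegral X]

/-- The generic point of an integral scheme, as a morphism. -/
def genericMap : Spec (@CommRingCat.of X.functionField Field.toCommRing) ⟶ X :=
  X.fromSpecStalk (genericPoint X)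

lemma genericMap_closedPoint :
    genericMap X (IsLocalRing.closedPoint X.functionField) = genericPoint X :=
  Scheme.fromSpecStalk_closedPoint

instance : IsGeneric (genericMap X) :=
  ⟨fun x => by
    have h := genericMap_closedPoint X
    have := (genericPoint_spec X).specializes (x := genericPoint X) (y := x) trivial
    exact (specializes_of_eq h).trans this⟩

/-- Identifies the abstract local subrings with the stalks inside the function field, through which
Cartier divisors are defined. -/
lemma localHom_genericMap (x : X) :
    (localHom (genericMap X) x).hom = algebraMap (X.presheaf.stalk x) X.functionField := by
  have h : Scheme.stalkClosedPointTo (R := .of X.functionField) (genericMap X) =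
      X.presheaf.stalkSpecializes (specializes_of_eq Scheme.fromSpecStalk_closedPoint.symm) :=
    Scheme.stalkClosedPointTo_fromSpecStalk (genericPoint X)
  rw [localHom, h]
  refine (congrArg CommRingCat.Hom.hom
    (X.presheaf.stalkSpecializes_comp _ _)).trans ?_
  rfl

lemma mem_stalkUnits_iff (x : X) (f : X.functionFieldˣ) : f ∈ stalkUnits X x ↔
    (f : X.functionField) ∈ localRing (genericMap X) x ∧
      (f : X.functionField)⁻¹ ∈ localRing (genericMap X) x := by
  simp only [mem_localRing, localHom_genericMap]
  constructor
  · rintro ⟨s, rfl⟩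
    exact ⟨⟨s, rfl⟩, ⟨(s⁻¹ : (X.presheaf.stalk x)ˣ), map_units_inv _ s⟩⟩
  · rintro ⟨⟨s, hs⟩, t, ht⟩
    have hst : s * t = 1 := by
      apply IsFractionRing.injective (X.presheaf.stalk x) X.functionField
      rw [map_mul, hs, ht, map_one]
      exact mul_inv_cancel₀ f.ne_zero
    exact ⟨⟨s, t, hst, (mul_comm _ _).trans hst⟩, Units.ext hs⟩

lemma germDiv_eq_iff (x : X) (f g : Additive X.functionFieldˣ) :
    germDiv X x f = germDiv X x g ↔
      ((f.toMul / g.toMul : X.functionFieldˣ) : X.functionField) ∈ localRing (genericMap X) x ∧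
      ((g.toMul / f.toMul : X.functionFieldˣ) : X.functionField) ∈ localRing (genericMap X) x := by
  rw [← sub_eq_zero, ← map_sub]
  have : germDiv X x (f - g) = 0 ↔ (f.toMul / g.toMul) ∈ stalkUnits X x :=
    QuotientGroup.eq_one_iff (N := stalkUnits X x) (f.toMul / g.toMul)
  rw [this, mem_stalkUnits_iff, ← Units.val_inv_eq_inv_val, inv_div]

lemma localRing_genericPoint : localRing (genericMap X) (genericPoint X) = ⊤ := by
  refine eq_top_iff.2 fun a _ => ?_
  rw [mem_localRing, localHom_genericMap]
  refine ⟨a, ?_⟩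
  have := X.presheaf.stalkSpecializes_refl (genericPoint X)
  exact RingHom.congr_fun (congrArg CommRingCat.Hom.hom this) a

end FunctionField

section Torus

variable {k : Type u} [Field k] {n : ℕ}

instance (F : Fan n) : IsOpenImmersion (F.torusι k) := by
  have hbij : Function.Bijective (AddMonoidAlgebra.mapDomainRingHom k
      (dualMonoid (⊥ : PointedCone ℝ (Fin n → ℝ))).subtype) := by
    refine ⟨coneToTorus_injective k ⊥, fun x => ?_⟩
    induction x using AddMonoidAlgebra.induction_linear with
    | zero => exact ⟨0, map_zero _⟩
    | add f g hf hg =>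
      obtain ⟨f, rfl⟩ := hf
      obtain ⟨g, rfl⟩ := hg
      exact ⟨f + g, map_add _ _ _⟩
    | single m r =>
      refine ⟨AddMonoidAlgebra.single ⟨m, fun v hv => ?_⟩ r, coneToTorus_single k ⊥ _ r⟩
      rw [(Submodule.mem_bot _).1 hv, pairing_zero_right]
  have : IsIso (CommRingCat.ofHom (AddMonoidAlgebra.mapDomainRingHom k
      (dualMonoid (⊥ : PointedCone ℝ (Fin n → ℝ))).subtype)) :=
    (ConcreteCategory.isIso_iff_bijective _).2 hbij
  rw [Fan.torusι]
  infer_instance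

/-- The generic point lies in the torus, so the function field is the fraction field of the Laurent
ring. -/
lemma exists_point_eq_genericMap (k : Type u) [Field k] [IsIntegral (zFan.variety k)] :
    ∃ ι : AddMonoidAlgebra k (Fin 3 → ℤ) →+* (zFan.variety k).functionField,
      zFan.point ι = genericMap (zFan.variety k) ∧ Function.Injective ι ∧
      ∀ a, ∃ r s, s ≠ 0 ∧ a * ι s = ι r := by
  let γ := genericMap (zFan.variety k)
  obtain ⟨ι, hι⟩ := exists_factor_chart γ (zFan.torusι k)
    ((IsGeneric.specializes (γ := γ) (zFan.torusι k (specPt ⊥))).mem_open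
      (zFan.torusι k).opensRange.isOpen ⟨_, rfl⟩)
  have hgen : IsGeneric (Spec.map (CommRingCat.ofHom ι)) := by
    have : IsGeneric (Spec.map (CommRingCat.ofHom ι) ≫ zFan.torusι k) := by
      rw [hι]
      exact inferInstanceAs (IsGeneric (genericMap _))
    exact IsGeneric.of_comp _ (zFan.torusι k)
  have hinj : Function.Injective ι := by
    rw [injective_iff_map_eq_zero]
    intro a ha
    by_contra h0
    obtain ⟨b, -, hb⟩ := (notMem_iff_exists_inv (θ := ι) ⊥ a).1 h0
    rw [ha, mul_zero] at hb
    exact zero_ne_one hb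
  refine ⟨ι, hι, hinj, fun a => ?_⟩
  obtain ⟨t, p, hp⟩ := exists_zChart k (genericPoint (zFan.variety k))
  have ha : a ∈ localRing γ (genericPoint (zFan.variety k)) := by
    rw [localRing_genericPoint]
    trivial
  rw [← hp, mem_localRing_chart (polyToField (zBasis t) ι) (zChart k t) γ (by
    rw [(isBasisChart_zChart k ι t).map_comp]; exact hι)] at ha
  obtain ⟨r, s, hs, h⟩ := ha
  refine ⟨polyToTorus k (zBasis t) r, polyToTorus k (zBasis t) s, ?_, ?_⟩
  · rw [Ne, map_eq_zero_iff _ (polyToTorus_injective k (zBasis t))]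
    rintro rfl
    exact hs (zero_mem _)
  · rw [← polyToField_apply, ← polyToField_apply, h]

end Torus

/-- The element of `M` with prescribed values on the rays of a maximal cone. -/
def coneSupport (t : Fin 12) : (Fin 8 → ℤ) →+ (Fin 3 → ℤ) where
  toFun a := ∑ i, a (triple t i) • zBasis t i
  map_zero' := by simp
  map_add' a b := by simp [add_smul, Finset.sum_add_distrib]

lemma intPairing_coneSupport (t : Fin 12) (a : Fin 8 → ℤ) (i : Fin 3) :
    intPairing (coneSupport t a) (zRay (triple t i)) = a (triple t i) := by
  rw [← zBasis_repr]
  exact congrFun ((zBasis t).repr_sum_self fun i => a (triple t i)) i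

/-- The values of an element of `M` on the rays. -/
def rayPairing : (Fin 3 → ℤ) →+ (Fin 8 → ℤ) where
  toFun m i := intPairing m (zRay i)
  map_zero' := funext fun _ => intPairing_zero_left _
  map_add' m m' := funext fun _ => intPairing_add_left m m' _

lemma rayPairing_injective : Function.Injective rayPairing := by
  intro m m' h
  apply (zBasis 0).repr.injective
  ext i
  rw [zBasis_repr, zBasis_repr]
  exact congrFun h _

/-! ### Regular characters at a point and the orbit that contains it. -/

section ZeroRays

variable {k : Type u} [Field k]

/-- The rays of the smallest cone whose orbit contains a given point. -/
def zeroRays (x : zFan.variety k) : Set (Fin 8) :=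
  {ρ | ∃ t p i, zChart k t (specPt p) = x ∧ MvPolynomial.X i ∈ p.asIdeal ∧ triple t i = ρ}

variable {K : Type u} [Field K] {ι : AddMonoidAlgebra k (Fin 3 → ℤ) →+* K}
  [IsGeneric (zFan.point ι)]

lemma chi_mem_localRing_zChart (hι : Function.Injective ι) (t : Fin 12)
    (p : PrimeSpectrum (MvPolynomial (Fin 3) k)) (m : Fin 3 → ℤ) :
    chi ι m ∈ localRing (zFan.point ι) (zChart k t (specPt p)) ↔
      ∀ i, MvPolynomial.X i ∈ p.asIdeal → 0 ≤ intPairing m (zRay (triple t i)) := by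
  rw [mem_localRing_zChart, chi_mem_localFractions _ hι]
  simp only [zBasis_repr]

lemma algebraMap_mem_localRing (x : zFan.variety k) (c : k) :
    ι (algebraMap k _ c) ∈ localRing (zFan.point ι) x := by
  obtain ⟨t, p, rfl⟩ := exists_zChart k x
  rw [mem_localRing_zChart, ← polyToField_C (zBasis t)]
  exact mem_localFractions_of_mem_range ⟨_, rfl⟩

end ZeroRays

section ZeroRays

variable {k : Type u} [Field k]

/-- The characters regular at the point do not depend on the chart. A separating character shows
that a ray found in the chart `s` belongs to the cone `t`; the inverse of the corresponding
coordinate shows that this coordinate vanishes at the point. -/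
lemma mem_zeroRays_zChart {t : Fin 12} {p : PrimeSpectrum (MvPolynomial (Fin 3) k)} {ρ : Fin 8} :
    ρ ∈ zeroRays (zChart k t (specPt p)) ↔ ∃ i, MvPolynomial.X i ∈ p.asIdeal ∧ triple t i = ρ := by
  let ι := algebraMap (AddMonoidAlgebra k (Fin 3 → ℤ)) (FractionRing (AddMonoidAlgebra k (Fin 3 → ℤ)))
  have hι : Function.Injective ι := IsFractionRing.injective _ _
  have := zFan.isGeneric_point hι
  refine ⟨?_, fun ⟨i, hi, h⟩ => ⟨t, p, i, rfl, hi, h⟩⟩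
  rintro ⟨s, q, j, hq, hj, rfl⟩
  have key : ∀ m, (∀ i, MvPolynomial.X i ∈ p.asIdeal → 0 ≤ intPairing m (zRay (triple t i))) ↔
      ∀ i, MvPolynomial.X i ∈ q.asIdeal → 0 ≤ intPairing m (zRay (triple s i)) := fun m => by
    rw [← chi_mem_localRing_zChart hι, ← chi_mem_localRing_zChart hι, hq]
  obtain ⟨m, -, h2, h3⟩ := hasSeparators _ (triple_mem s) _ (triple_mem t)
  obtain ⟨m', h1', h2', h3'⟩ := hasSeparators _ (triple_mem t) _ (triple_mem s)
  have hmem : triple s j ∈ Finset.univ.image (triple t) := by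
    by_contra h
    have hm' := (key m').1 (fun i _ => by
      by_cases h : triple t i ∈ Finset.univ.image (triple s)
      · exact (h3' _ (Finset.mem_image_of_mem _ (Finset.mem_univ i)) h).ge
      · exact (h1' _ (Finset.mem_image_of_mem _ (Finset.mem_univ i)) h).le) j hj
    exact absurd (h2' _ (Finset.mem_image_of_mem _ (Finset.mem_univ j)) h) hm'.not_gt
  obtain ⟨i, -, hi⟩ := Finset.mem_image.1 hmem
  refine ⟨i, ?_, hi⟩
  by_contra hX
  have := (key (-zBasis t i)).1 (fun l hl => by
    rw [intPairing_neg_left, ← zBasis_repr, Module.Basis.repr_self, Finsupp.single_eq_of_ne]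
    · simp
    · rintro rfl; exact hX hl) j hj
  rw [intPairing_neg_left, ← hi, ← zBasis_repr, Module.Basis.repr_self,
    Finsupp.single_eq_same] at this
  omega

lemma mem_image_of_mem_zeroRays {t : Fin 12} {x : zFan.variety k} (hx : x ∈ Set.range (zChart k t))
    {ρ : Fin 8} (hρ : ρ ∈ zeroRays x) : ∃ i, triple t i = ρ := by
  obtain ⟨y, rfl⟩ := hx
  obtain ⟨p, rfl⟩ := exists_specPt y
  obtain ⟨i, -, h⟩ := mem_zeroRays_zChart.1 hρ
  exact ⟨i, h⟩

lemma isSeparated_zFan (k : Type u) [Field k] : (zFan.variety k).IsSeparated := by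
  have := isProper_zFan k
  refine ⟨?_⟩
  rw [← terminal.comp_from (zFan.toSpec k)]
  infer_instance

/-- The generic point of the divisor of a ray lies in the charts of all cones with this ray. -/
lemma exists_rayPt (k : Type u) [Field k] (ρ : Fin 8) : ∃ x : zFan.variety k, ρ ∈ zeroRays x ∧
    ∀ s j, triple s j = ρ → x ∈ Set.range (zChart k s) := by
  let ι := algebraMap (AddMonoidAlgebra k (Fin 3 → ℤ)) (FractionRing (AddMonoidAlgebra k (Fin 3 → ℤ)))
  have hι : Function.Injective ι := IsFractionRing.injective _ _
  have := zFan.isGeneric_point hι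
  have := isSeparated_zFan k
  obtain ⟨t, i, rfl⟩ := exists_triple_eq ρ
  refine ⟨zChart k t (specPt (primeX k i)), ⟨t, _, i, rfl, X_mem_primeX.2 rfl, rfl⟩,
    fun s j hsj => ?_⟩
  refine mem_range_of_range_le_localRing _ _ _ (isBasisChart_zChart k ι s).map_comp _
    (range_polyToField_le (algebraMap_mem_localRing _) fun l => ?_)
  rw [chi_mem_localRing_zChart hι]
  intro i' hi'
  obtain rfl := X_mem_primeX.1 hi'
  rw [← hsj, ← zBasis_repr, Module.Basis.repr_self, Finsupp.single_apply]
  split_ifs <;> simp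

lemma torusι_mem_range (t : Fin 12) (p : PrimeSpectrum (AddMonoidAlgebra k (Fin 3 → ℤ))) :
    zFan.torusι k (specPt p) ∈ Set.range (zChart k t) := by
  rw [← zFan.map_basisChart k (zCone t) (zBasis t) fun _ => mem_dualMonoid_zCone,
    Scheme.Hom.comp_apply]
  exact ⟨_, rfl⟩

variable {K : Type u} [Field K] {ι : AddMonoidAlgebra k (Fin 3 → ℤ) →+* K}
  [IsGeneric (zFan.point ι)]

lemma chi_mem_localRing (hι : Function.Injective ι) (x : zFan.variety k) (m : Fin 3 → ℤ) :
    chi ι m ∈ localRing (zFan.point ι) x ↔ ∀ ρ ∈ zeroRays x, 0 ≤ intPairing m (zRay ρ) := by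
  obtain ⟨t, p, rfl⟩ := exists_zChart k x
  rw [chi_mem_localRing_zChart hι]
  constructor
  · intro h ρ hρ
    obtain ⟨i, hi, rfl⟩ := mem_zeroRays_zChart.1 hρ
    exact h i hi
  · exact fun h i hi => h _ (mem_zeroRays_zChart.2 ⟨i, hi, rfl⟩)

lemma mem_localRing_torusι (p : PrimeSpectrum (AddMonoidAlgebra k (Fin 3 → ℤ))) (a : K) :
    a ∈ localRing (zFan.point ι) (zFan.torusι k (specPt p)) ↔ a ∈ localFractions ι p :=
  mem_localRing_chart ι (zFan.torusι k) (zFan.point ι) rfl p a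

/-- A rational function without zeros and poles on the torus is a character up to a constant. -/
lemma exists_eq_single_of_mem_localRing (hι : Function.Injective ι) {f g : K} (hf : f ≠ 0)
    (hg : g ≠ 0) (h : ∀ p, f / g ∈ localRing (zFan.point ι) (zFan.torusι k (specPt p)) ∧
      g / f ∈ localRing (zFan.point ι) (zFan.torusι k (specPt p))) :
    ∃ m c, c ≠ 0 ∧ f = ι (algebraMap k _ c) * (g * chi ι m) := by
  have key : ∀ a : K, (∀ p, a ∈ localRing (zFan.point ι) (zFan.torusι k (specPt p))) →
      a ∈ ι.range := fun a ha => by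
    obtain ⟨N, hN⟩ := mem_range_of_forall_localFractions (ρ := ι) (a := a) (t := 1)
      fun p _ => (mem_localRing_torusι p a).1 (ha p)
    simpa using hN
  obtain ⟨u, hu⟩ := key _ fun p => (h p).1
  obtain ⟨v, hv⟩ := key _ fun p => (h p).2
  have huv : u * v = 1 := by
    apply hι
    rw [map_mul, hu, hv, map_one, div_mul_div_cancel₀ hg, div_self hf]
  obtain ⟨m, c, hc, rfl⟩ := isUnit_eq_single (IsUnit.of_mul_eq_one v huv)
  refine ⟨m, c, hc, ?_⟩
  rw [mul_left_comm, chi, ← map_mul, AddMonoidAlgebra.coe_algebraMap, Function.comp_apply,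
    AddMonoidAlgebra.single_mul_single, zero_add, Algebra.algebraMap_self_apply, mul_one, hu, mul_div_cancel₀ _ hg]

end ZeroRays

/-! ### Torus invariant divisors and the Picard group. -/

section Picard

variable {k : Type u} [Field k]

/-- The index of a chart around a point. -/
def chartIndex (x : zFan.variety k) : Fin 12 := (exists_zChart k x).choose

lemma mem_range_chartIndex (x : zFan.variety k) : x ∈ Set.range (zChart k (chartIndex x)) := by
  obtain ⟨p, hp⟩ := (exists_zChart k x).choose_spec
  exact ⟨_, hp⟩

variable [IsIntegral (zFan.variety k)]
  {ι : AddMonoidAlgebra k (Fin 3 → ℤ) →+* (zFan.variety k).functionField}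

variable (ι) in
/-- The characters of the torus, as rational functions. -/
def chiUnit : (Fin 3 → ℤ) →+ Additive (zFan.variety k).functionFieldˣ where
  toFun m := Additive.ofMul (Units.mk0 (chi ι m) (chi_ne_zero m))
  map_zero' := by
    rw [← ofMul_one]
    exact congrArg _ (Units.ext chi_zero)
  map_add' m m' := by
    rw [← ofMul_mul]
    exact congrArg _ (Units.ext (chi_add m m'))

variable (hγ : zFan.point ι = genericMap (zFan.variety k)) (hι : Function.Injective ι)

lemma germDiv_eq_iff_localRing (hγ : zFan.point ι = genericMap (zFan.variety k))
    [IsGeneric (zFan.point ι)] (x : zFan.variety k)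
    (f g : Additive (zFan.variety k).functionFieldˣ) :
    germDiv _ x f = germDiv _ x g ↔
      ((f.toMul : (zFan.variety k).functionField) / g.toMul) ∈ localRing (zFan.point ι) x ∧
      ((g.toMul : (zFan.variety k).functionField) / f.toMul) ∈ localRing (zFan.point ι) x := by
  simp only [hγ]
  rw [germDiv_eq_iff, Units.val_div_eq_div_val, Units.val_div_eq_div_val]

lemma germDiv_chiUnit_eq_iff (hγ : zFan.point ι = genericMap (zFan.variety k))
    (hι : Function.Injective ι) (x : zFan.variety k) (m m' : Fin 3 → ℤ) :
    germDiv _ x (chiUnit ι m) = germDiv _ x (chiUnit ι m') ↔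
      ∀ ρ ∈ zeroRays x, intPairing m (zRay ρ) = intPairing m' (zRay ρ) := by
  have := zFan.isGeneric_point hι
  rw [germDiv_eq_iff_localRing hγ]
  change chi ι m / chi ι m' ∈ _ ∧ chi ι m' / chi ι m ∈ _ ↔ _
  rw [← chi_sub, ← chi_sub, chi_mem_localRing hι, chi_mem_localRing hι, ← forall₂_and]
  refine forall₂_congr fun ρ _ => ?_
  rw [intPairing_sub_left, intPairing_sub_left]
  omega

lemma germDiv_eq_germDiv_of_eq_mul (hγ : zFan.point ι = genericMap (zFan.variety k))
    (hι : Function.Injective ι) (x : zFan.variety k)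
    {f g : Additive (zFan.variety k).functionFieldˣ} {c : k} (hc : c ≠ 0)
    (h : (f.toMul : (zFan.variety k).functionField) = ι (algebraMap k _ c) * g.toMul) :
    germDiv _ x f = germDiv _ x g := by
  have := zFan.isGeneric_point hι
  have hinv : ι (algebraMap k _ c) * ι (algebraMap k _ c⁻¹) = 1 := by
    rw [← map_mul, ← map_mul, mul_inv_cancel₀ hc, map_one, map_one]
  have hne := left_ne_zero_of_mul_eq_one hinv
  rw [germDiv_eq_iff_localRing hγ, h, mul_div_assoc, div_self g.toMul.ne_zero, mul_one,
    div_mul_cancel_right₀ g.toMul.ne_zero, inv_eq_of_mul_eq_one_right hinv]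
  exact ⟨algebraMap_mem_localRing x c, algebraMap_mem_localRing x c⁻¹⟩

/-- The torus invariant Cartier divisors. -/
def invariantDivisor (hγ : zFan.point ι = genericMap (zFan.variety k)) (hι : Function.Injective ι) :
    (Fin 8 → ℤ) →+ cartierDivisors (zFan.variety k) :=
  AddMonoidHom.codRestrict
    (AddMonoidHom.pi fun x => ((germDiv _ x).comp (chiUnit ι)).comp (coneSupport (chartIndex x))) _
    fun a x => by
      refine ⟨(zChart k (chartIndex x)).opensRange, mem_range_chartIndex x,
        chiUnit ι (coneSupport (chartIndex x) a), fun y hy => ?_⟩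
      -- The rays through `y` belong to the cones of both charts, and both local equations take the
      -- prescribed value on them.
      refine (germDiv_chiUnit_eq_iff hγ hι y _ _).2 fun ρ hρ => ?_
      obtain ⟨i, rfl⟩ := mem_image_of_mem_zeroRays (mem_range_chartIndex y) hρ
      obtain ⟨j, hj⟩ := mem_image_of_mem_zeroRays (t := chartIndex x) hy hρ
      rw [intPairing_coneSupport, ← hj, intPairing_coneSupport]

lemma invariantDivisor_apply (a : Fin 8 → ℤ) (x : zFan.variety k) :
    (invariantDivisor hγ hι a : ∀ x, CartierGerm _ x) x =
      germDiv _ x (chiUnit ι (coneSupport (chartIndex x) a)) := rfl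

lemma germDiv_coneSupport_eq_iff (hγ : zFan.point ι = genericMap (zFan.variety k))
    (hι : Function.Injective ι) (x : zFan.variety k) (m : Fin 3 → ℤ) (a : Fin 8 → ℤ) :
    germDiv _ x (chiUnit ι m) = (invariantDivisor hγ hι a : ∀ x, CartierGerm _ x) x ↔
      ∀ ρ ∈ zeroRays x, intPairing m (zRay ρ) = a ρ := by
  rw [invariantDivisor_apply, germDiv_chiUnit_eq_iff hγ hι]
  refine forall₂_congr fun ρ hρ => ?_
  obtain ⟨i, rfl⟩ := mem_image_of_mem_zeroRays (mem_range_chartIndex x) hρ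
  rw [intPairing_coneSupport]

/-- An invariant divisor is trivial on the torus, so a function defining it is a character up to a
constant. Comparison at the generic point of each ray's divisor gives the values `a`. -/
lemma invariantDivisor_eq_principal_iff (a : Fin 8 → ℤ) :
    invariantDivisor hγ hι a ∈ (principalDivisor (zFan.variety k)).range ↔
      a ∈ rayPairing.range := by
  have := zFan.isGeneric_point hι
  constructor
  · rintro ⟨f, hf⟩
    have hfx : ∀ x, germDiv _ x f = (invariantDivisor hγ hι a : ∀ x, CartierGerm _ x) x :=
      fun x => congrFun (congrArg Subtype.val hf) x
    obtain ⟨m, c, hc, h⟩ := exists_eq_single_of_mem_localRing hι f.toMul.ne_zero one_ne_zero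
      fun p => by
        have h0 : germDiv _ (zFan.torusι k (specPt p)) f =
            germDiv _ (zFan.torusι k (specPt p)) 0 := by
          rw [hfx, ← map_zero (chiUnit ι), eq_comm, germDiv_coneSupport_eq_iff hγ hι]
          intro ρ hρ
          obtain ⟨t, i, rfl⟩ := exists_triple_eq ρ
          have h := (chi_mem_localRing hι _ (-zBasis t i)).1
            ((mem_localRing_torusι p _).2 (mem_localFractions_of_mem_range ⟨_, rfl⟩)) _ hρ
          rw [intPairing_neg_left, ← zBasis_repr, Module.Basis.repr_self,
            Finsupp.single_eq_same] at h
          omega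
        exact (germDiv_eq_iff_localRing hγ _ _ _).1 h0
    refine ⟨m, funext fun ρ => ?_⟩
    obtain ⟨x, hρ, -⟩ := exists_rayPt k ρ
    refine (germDiv_coneSupport_eq_iff hγ hι x m a).1 ?_ ρ hρ
    rw [← hfx]
    refine (germDiv_eq_germDiv_of_eq_mul hγ hι x hc ?_).symm
    rw [h, one_mul]
    rfl
  · rintro ⟨m, rfl⟩
    exact ⟨chiUnit ι m, Subtype.ext (funext fun x =>
      (germDiv_coneSupport_eq_iff hγ hι x m _).2 fun _ _ => rfl)⟩

/-- On each chart `D` has an equation `f t`, since the polynomial ring is factorial. On the torus `f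
t / f 0` is a unit, hence a monomial up to a constant. After subtraction of the divisor of `f 0`,
only characters remain as local equations; their values on a ray agree between charts, as is seen at
the generic point of its divisor. -/
lemma exists_eq_invariantDivisor_add (hfrac : ∀ a, ∃ r s, s ≠ 0 ∧ a * ι s = ι r)
    (D : cartierDivisors (zFan.variety k)) :
    ∃ a f, D = invariantDivisor hγ hι a + principalDivisor _ f := by
  have := zFan.isGeneric_point hι
  have hgen : ∀ t, ∃ f : (zFan.variety k).functionField, f ≠ 0 ∧
      ∀ p : PrimeSpectrum (MvPolynomial (Fin 3) k), ∃ h : f ≠ 0,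
        (D : ∀ x, CartierGerm _ x) (zChart k t (specPt p)) =
          germDiv _ _ (Additive.ofMul (Units.mk0 f h)) := by
    intro t
    refine exists_global_generator (polyToField_injective (b := zBasis t) hι)
      (polyToField_exists_frac (b := zBasis t) hfrac) _ (fun p f g hf hg hE => ?_) fun p => ?_
    · obtain ⟨_, hE⟩ := hE
      rw [exists_prop_of_true hg, hE, germDiv_eq_iff_localRing hγ, ← mem_localRing_zChart,
        ← mem_localRing_zChart]
      rfl
    · obtain ⟨U, hU, f, hf⟩ := D.2 (zChart k t (specPt p))
      have hopen : IsOpen {q : PrimeSpectrum (MvPolynomial (Fin 3) k) | zChart k t (specPt q) ∈ U} :=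
        ((zChart k t) ⁻¹ᵁ U).isOpen
      obtain ⟨_, ⟨s, rfl⟩, hps, hsU⟩ :=
        PrimeSpectrum.isTopologicalBasis_basic_opens.exists_subset_of_mem_open
          (show p ∈ _ from hU) hopen
      exact ⟨s, hps, f.toMul, f.toMul.ne_zero, fun q hq => ⟨f.toMul.ne_zero, by
        rw [hf _ (hsU hq)]
        exact congrArg _ (congrArg Additive.ofMul (Units.ext rfl))⟩⟩
  choose f hf0 hf using hgen
  have hD : ∀ t x, x ∈ Set.range (zChart k t) → (D : ∀ x, CartierGerm _ x) x =
      germDiv _ x (Additive.ofMul (Units.mk0 (f t) (hf0 t))) := by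
    rintro t _ ⟨y, rfl⟩
    obtain ⟨p, rfl⟩ := exists_specPt y
    exact (hf t p).2
  have hm : ∀ t, ∃ m c, c ≠ 0 ∧ f t = ι (algebraMap k _ c) * (f 0 * chi ι m) := fun t =>
    exists_eq_single_of_mem_localRing hι (hf0 t) (hf0 0) fun p =>
      (germDiv_eq_iff_localRing hγ _ (Additive.ofMul (Units.mk0 (f t) (hf0 t)))
        (Additive.ofMul (Units.mk0 (f 0) (hf0 0)))).1
        ((hD t _ (torusι_mem_range t p)).symm.trans (hD 0 _ (torusι_mem_range 0 p)))
  choose m c hc hm using hm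
  have hD' : ∀ t x, x ∈ Set.range (zChart k t) → (D : ∀ x, CartierGerm _ x) x =
      germDiv _ x (chiUnit ι (m t)) +
        germDiv _ x (Additive.ofMul (Units.mk0 (f 0) (hf0 0))) := by
    intro t x hx
    rw [hD t x hx, ← map_add]
    refine germDiv_eq_germDiv_of_eq_mul hγ hι x (hc t) ?_
    have h := hm t
    rw [mul_comm (f 0)] at h
    exact h
  choose T j hTj using exists_triple_eq
  refine ⟨fun ρ => intPairing (m (T ρ)) (zRay ρ), Additive.ofMul (Units.mk0 (f 0) (hf0 0)),
    Subtype.ext (funext fun x => ?_)⟩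
  refine (hD' _ x (mem_range_chartIndex x)).trans ?_
  refine congrArg (· + germDiv _ x (Additive.ofMul (Units.mk0 (f 0) (hf0 0))))
    ((germDiv_coneSupport_eq_iff hγ hι x _ _).2 fun ρ hρ => ?_)
  obtain ⟨i, hi⟩ := mem_image_of_mem_zeroRays (mem_range_chartIndex x) hρ
  obtain ⟨y, hy, hy'⟩ := exists_rayPt k ρ
  refine (germDiv_chiUnit_eq_iff hγ hι y _ _).1 ?_ ρ hy
  exact add_right_cancel ((hD' _ y (hy' _ i hi)).symm.trans (hD' _ y (hy' _ _ (hTj ρ))))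

end Picard

/-- Rank count in 0 → M → ℤ⁸ → Pic → 0, with M of rank 3. -/
lemma picardNumber_zFan (k : Type u) [Field k] [IsIntegral (zFan.variety k)] :
    picardNumber (zFan.variety k) = 5 := by
  obtain ⟨ι, hγ, hι, hfrac⟩ := exists_point_eq_genericMap k
  let Ψ : (Fin 8 → ℤ) →+ Pic (zFan.variety k) :=
    (QuotientAddGroup.mk' _).comp (invariantDivisor hγ hι)
  have hsurj : Function.Surjective Ψ.toIntLinearMap := by
    intro D
    obtain ⟨D, rfl⟩ := QuotientAddGroup.mk_surjective D
    obtain ⟨a, f, h⟩ := exists_eq_invariantDivisor_add hγ hι hfrac D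
    refine ⟨a, QuotientAddGroup.eq.2 ⟨f, ?_⟩⟩
    rw [h, neg_add_cancel_left]
  have hker : LinearMap.ker Ψ.toIntLinearMap = LinearMap.range rayPairing.toIntLinearMap := by
    ext a
    exact (QuotientAddGroup.eq_zero_iff _).trans (invariantDivisor_eq_principal_iff hγ hι a)
  have h := Submodule.finrank_quotient_add_finrank (LinearMap.ker Ψ.toIntLinearMap)
  rw [(LinearMap.quotKerEquivOfSurjective _ hsurj).finrank_eq, hker,
    LinearMap.finrank_range_of_inj (f := rayPairing.toIntLinearMap) rayPairing_injective, Module.finrank_fintype_fun_eq_card, Module.finrank_fintype_fun_eq_card,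
    Fintype.card_fin, Fintype.card_fin] at h
  rw [picardNumber]
  omega

/-- The general obstruction applied to the variety itself; completeness of the fan supplies the
charts. -/
lemma not_isProjective_zFan (k : Type u) [Field k] : ¬ IsProjective (zFan.toSpec k) := by
  let A := AddMonoidAlgebra k (Fin 3 → ℤ)
  let ι : A →+* FractionRing A := algebraMap A (FractionRing A)
  have hι : Function.Injective ι := IsFractionRing.injective A (FractionRing A)
  have := zFan.isGeneric_point hι
  refine not_isProjective_of_isBasisChart hι ?_ (zFan.point_toSpec ι) (fun W => ?_)
    (fun x _ => ⟨x, rfl⟩) fun y _ => ⟨y, rfl⟩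
  · intro a
    obtain ⟨r, s, hs, rfl⟩ := IsFractionRing.div_surjective A a
    have hs0 := nonZeroDivisors.ne_zero hs
    exact ⟨r, s, hs0, div_mul_cancel₀ _ ((map_ne_zero_iff _ hι).2 hs0)⟩
  · obtain ⟨t, ht⟩ := exists_zBasis_nonneg W
    exact ⟨_, _, isBasisChart_zChart k ι t, ht⟩

end Toric

end

theorem corollary5p4 (k : Type u) [Field k] [IsAlgClosed k] :
    SmoothOfRelativeDimension 3 (Toric.zFan.toSpec k) ∧
    IsProper (Toric.zFan.toSpec k) ∧
    (∃ _ : IsIntegral (Toric.zFan.variety k),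
      Toric.picardNumber (Toric.zFan.variety k) = 5) ∧
    ¬ Toric.IsProjective (Toric.zFan.toSpec k) ∧
    ∀ (n : ℕ) (F : Toric.Fan n) (f : (Toric.zFan.variety k).PartialIso (F.variety k)),
      Toric.IsToric f → Toric.IsIsoInCodimOne f → Toric.IsProjective (F.toSpec k) →
        ¬ Smooth (F.toSpec k) := by
  exact ⟨Toric.smooth_zFan k, Toric.isProper_zFan k,
    ⟨Toric.isIntegral_zFan k, have := Toric.isIntegral_zFan k; Toric.picardNumber_zFan k⟩,
    Toric.not_isProjective_zFan k, fun _ F f hf hf' hp =>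
      Toric.not_smooth_of_isProjective F f hf hf' hp⟩
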